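/- **Setup.** Products of permutations are compositions, $(uv)(p)=u(v(p))$, permutations in $S_m$ are regarded as permutations of $\{1,2,3,\dots\}$ fixing all $p>m$, $s_i=(i\;\,i{+}1)$, $\ell$ is the number of inversions, and $w_0^{(m)}$ is the longest element of $S_m$. Given $u$ and $i$, put $u\cdot s_i=us_i$ if $u(i)<u(i+1)$ and $u\cdot s_i=u$ otherwise; the absolute Hecke product $u\cdot v$ is $(\cdots(u\cdot s_{i_1})\cdots)\cdot s_{i_k}$ for a reduced word $v=s_{i_1}\cdots s_{i_k}$ (this is, up to sign, the product of $u$ and $v$ in the degenerate Hecke algebra, where $s_i^2=-s_i$). *Grothendieck polynomials.* For $w\in S_N$ the double Grothendieck (Laurent) polynomial $\mathfrak G_w(a;b)\in\mathbb Z[a_i^{-1},b_i]$ of Lascoux and Schützenberger is determined by $\mathfrak G_{w_0^{(N)}}(a;b)=\prod_{p+q\le N}(1-b_p/a_q)$ and $(a_i-a_{i+1})\,\mathfrak G_w(a;b)=a_i\,\mathfrak G_{ws_i}(a;b)-a_{i+1}\,\mathfrak G_{ws_i}(a_{s_i};b)$ whenever $1\le i<N$ and $w(i)<w(i+1)$,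 where $a_{s_i}$ is $a$ with $a_i$ and $a_{i+1}$ exchanged. The stable double Grothendieck polynomial is $G_w(a_1,\dots,a_q;b_1,\dots,b_p)=\mathfrak G_{1^m\times w}(a_1,\dots,a_q,1,\dots,1;\,b_1,\dots,b_p,1,\dots,1)$ for $m\ge\max(p,q)$ (the result does not depend on such $m$; take $m=\max(p,q)$), where $1^m\times w$ fixes $1,\dots,m$ and maps $j>m$ to $w(j-m)+m$. *Rank conditions.* Let $n\ge0$ and let $r=(r_{ij})_{0\le i\le j\le n}$ be non-negative integers with $r_{ij}\le\min(r_{i,j-1},r_{i+1,j})$ for $0\le i<j\le n$ and $r_{ij}+r_{i-1,j+1}\ge r_{i-1,j}+r_{i,j+1}$ for $0<i\le j<n$. Put $e_i=r_{ii}$, $N=e_0+\dots+e_n$, $d(r)=\sum_{i<j}(r_{i,j-1}-r_{ij})(r_{i+1,j}-r_{ij})$, and extend $r$ by $r_{ij}=e_j+e_{j+1}+\dots+e_i$ for $j\le i$. For $0\le i<n$ and $0<j\le n$ let $W_{ij}$ be the permutation with $W_{ij}(p)=p+r_{i,j-1}-r_{ij}$ if $r_{ij}<p\le r_{i+1,j}$,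 $W_{ij}(p)=p-r_{i+1,j}+r_{ij}$ if $r_{i+1,j}<p\le r_{i+1,j}+r_{i,j-1}-r_{ij}$, and $W_{ij}(p)=p$ otherwise. Let $z(r)=\prod_{j=1}^n\prod_{i=0}^{n-1}W_{ij}\in S_N$ (factors written from left to right), $\widehat z(r)=w_0^{(N)}z(r)^{-1}w_0^{(N)}$, and $\widehat z(e)=\widehat z(r^e)$ where $r^e_{ij}=\min\{e_i,\dots,e_j\}$ for $i\le j$. For $1\le j\le n-1$ let $\delta_j=W_{jj}W_{j+1,j}\cdots W_{n-1,j}$. A KMS-factorization for $r$ is a sequence $(w_1,\dots,w_n)$ with $w_i\in S_{e_{i-1}+e_i}$ whose absolute Hecke product $w_1\cdot\delta_1\cdot w_2\cdot\delta_2\cdots\delta_{n-1}\cdot w_n$ equals $z(r)$. *Variables.* Let $a^i=(a^i_1,\dots,a^i_{e_i})$, $0\le i\le n$, be sets of independent variables, and put $a=(a^0,a^1,\dots,a^n)$ and $\breve a=(a^n,a^{n-1},\dots,a^0)$, both sequences of $N$ variables. **Theorem (stable $K$-theoretic component formula).** For any such set of rank conditions $r$ we have $\mathfrak G_{\widehat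 z(e)}(\breve a;a)\ne0$ and, in the field of rational functions in the variables $a^i_j$, $$\frac{\mathfrak G_{\widehat z(r)}(\breve a;a)}{\mathfrak G_{\widehat z(e)}(\breve a;a)}=\sum_{(w_1,\dots,w_n)}(-1)^{\ell(w_1\cdots w_n)-d(r)}\,G_{w_1}(a^1;a^0)\,G_{w_2}(a^2;a^1)\cdots G_{w_n}(a^n;a^{n-1}),$$ where the sum is over all KMS-factorizations $(w_1,\dots,w_n)$ for $r$ and $w_1\cdots w_n$ is the ordinary product of permutations. -/

import Mathlib

/-! Conventions. Permutations of `{1, 2, 3, …}` moving finitely many integers are represented by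
`Equiv.Perm ℕ`, all positions and values being shifted down by one. So `S_m` consists of the
permutations fixing every `p ≥ m`, and the simple reflection exchanging the first two integers is
`simpleRefl 0`. Products of permutations are compositions, `(u * v) p = u (v p)`. -/

namespace Quiver

open Equiv MvPolynomial

noncomputable section

/-! ### Permutations, length, absolute Hecke product -/

/-- The simple reflection exchanging `i` and `i + 1`. -/
def simpleRefl (i : ℕ) : Perm ℕ := Equiv.swap i (i + 1)

/-- The inclusion `S_m ⊂ S_∞`. -/
def embed {m : ℕ} (w : Perm (Fin m)) : Perm ℕ := w.extendDomain Fin.equivSubtype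

/-- The longest element of `S_m`. -/
def longest (m : ℕ) : Perm ℕ := embed (Fin.revPerm : Perm (Fin m))

/-- The set of inversions of a permutation. -/
def inversions (w : Perm ℕ) : Set (ℕ × ℕ) := {x | x.1 < x.2 ∧ w x.2 < w x.1}

/-- The length `ℓ(w)`: the number of inversions. -/
def length (w : Perm ℕ) : ℕ := (inversions w).ncard

/-- The permutation `1^m × w`: the identity on the first `m` integers, and `w` shifted by `m`
on the others. -/
def shiftPerm (m : ℕ) (w : Perm ℕ) : Perm ℕ where
  toFun p := if p < m then p else w (p - m) + m
  invFun p := if p < m then p else w.symm (p - m) + m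
  left_inv p := by
    by_cases h : p < m
    · simp [h]
    · simp [h]; omega
  right_inv p := by
    by_cases h : p < m
    · simp [h]
    · simp [h]; omega

/-- `l` is (the list of indices of) a reduced word of `v`. -/
def IsReducedWord (l : List ℕ) (v : Perm ℕ) : Prop :=
  (l.map simpleRefl).prod = v ∧ l.length = length v

/-- Multiplication of a basis element `u` of the degenerate Hecke algebra by a generator `s_i` on
the right, up to sign: there `u · s_i` is `u s_i` if `ℓ(u s_i) > ℓ(u)`, that is if
`u(i) < u(i+1)`, and it is `-u` otherwise. -/
def heckeStep (u : Perm ℕ) (i : ℕ) : Perm ℕ :=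
  if u i < u (i + 1) then u * simpleRefl i else u

/-- A reduced word of `v` (every `v` in some `S_m` has one, see `exists_isReducedWord`). -/
def reducedWord (v : Perm ℕ) : List ℕ := Classical.epsilon fun l => IsReducedWord l v

/-- The product of `u` and `v` in the degenerate Hecke algebra, up to sign. -/
def heckeMul (u v : Perm ℕ) : Perm ℕ := (reducedWord v).foldl heckeStep u

/-- The absolute Hecke product `u_1 · u_2 ⋯ u_k` of a list of permutations. -/
def heckeProd (us : List (Perm ℕ)) : Perm ℕ := us.foldl heckeMul 1

lemma simpleRefl_mul_self (i : ℕ) : simpleRefl i * simpleRefl i = 1 := by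
  simp [simpleRefl]

lemma simpleRefl_lt {i p q : ℕ} (h : p < q) (hne : ¬ (p = i ∧ q = i + 1)) :
    simpleRefl i p < simpleRefl i q := by
  simp only [simpleRefl, Equiv.swap_apply_def]
  split_ifs <;> omega

lemma inversions_finite {m : ℕ} {v : Perm ℕ} (hv : ∀ p, m ≤ p → v p = p) :
    (inversions v).Finite := by
  have hlt : ∀ p, p < m → v p < m := by
    intro p hp
    by_contra hc
    have h1 := hv (v p) (by omega)
    have h2 := v.injective h1
    omega
  apply ((Set.finite_Iio m).prod (Set.finite_Iio m)).subset
  rintro ⟨p, q⟩ ⟨h1, h2⟩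
  simp only at h1 h2
  simp only [Set.mem_prod, Set.mem_Iio]
  by_cases hq : q < m
  · omega
  · have h3 := hv q (by omega)
    by_cases hp : p < m
    · have := hlt p hp; omega
    · have := hv p (by omega); omega

lemma length_mul_simpleRefl {m : ℕ} {v : Perm ℕ} (hv : ∀ p, m ≤ p → v p = p) {i : ℕ}
    (hi : v (i + 1) < v i) : length (v * simpleRefl i) + 1 = length v := by
  have hmem : ((i, i + 1) : ℕ × ℕ) ∈ inversions v := ⟨Nat.lt_succ_self i, hi⟩
  have hinj : Function.Injective (Prod.map (simpleRefl i) (simpleRefl i)) :=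
    (simpleRefl i).injective.prodMap (simpleRefl i).injective
  have himg : Prod.map (simpleRefl i) (simpleRefl i) '' inversions (v * simpleRefl i) =
      inversions v \ {(i, i + 1)} := by
    have hs : ∀ p, simpleRefl i (simpleRefl i p) = p := fun p => by simp [simpleRefl]
    have h0 : simpleRefl i i = i + 1 := by simp [simpleRefl]
    have h1 : simpleRefl i (i + 1) = i := by simp [simpleRefl]
    ext ⟨p, q⟩
    constructor
    · rintro ⟨⟨p', q'⟩, ⟨hlt, hv'⟩, heq⟩
      simp only [Prod.map_apply, Prod.mk.injEq] at heq
      obtain ⟨rfl, rfl⟩ := heq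
      simp only [Perm.mul_apply] at hv' hlt
      have hne : ¬ (p' = i ∧ q' = i + 1) := by
        rintro ⟨rfl, rfl⟩
        rw [h0, h1] at hv'
        omega
      refine ⟨⟨simpleRefl_lt hlt hne, hv'⟩, ?_⟩
      intro hc
      simp only [Set.mem_singleton_iff, Prod.mk.injEq] at hc
      have e1 := congrArg (simpleRefl i) hc.1
      have e2 := congrArg (simpleRefl i) hc.2
      rw [hs, h0] at e1
      rw [hs, h1] at e2
      omega
    · rintro ⟨⟨hlt, hv'⟩, hne⟩
      simp only [Set.mem_singleton_iff, Prod.mk.injEq] at hne hlt hv'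
      refine ⟨(simpleRefl i p, simpleRefl i q), ⟨simpleRefl_lt hlt hne, ?_⟩, ?_⟩
      · simpa [Perm.mul_apply, hs] using hv'
      · simp [hs]
  unfold length
  rw [← Set.ncard_image_of_injective _ hinj, himg]
  exact Set.ncard_sdiff_singleton_add_one hmem (inversions_finite hv)

/-- Every permutation in some `S_m` has a reduced word. -/
theorem exists_isReducedWord {m : ℕ} {v : Perm ℕ} (hv : ∀ p, m ≤ p → v p = p) :
    ∃ l, IsReducedWord l v := by
  induction h : length v using Nat.strong_induction_on generalizing v with
  | _ k ih =>
    by_cases hd : ∃ i, v (i + 1) < v i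
    · obtain ⟨i, hi⟩ := hd
      have him : i + 1 < m := by
        by_contra hc
        have h1 := hv (i + 1) (by omega)
        by_cases hm : m ≤ i
        · have := hv i hm; omega
        · have h2 := hv (v i) (by omega)
          have h3 := v.injective h2
          omega
      have hlen := length_mul_simpleRefl hv hi
      obtain ⟨l, hl1, hl2⟩ := ih (length (v * simpleRefl i)) (by omega)
        (v := v * simpleRefl i) (by
          intro p hp
          have : simpleRefl i p = p := by
            simp only [simpleRefl, Equiv.swap_apply_def]
            split_ifs <;> omega
          rw [Perm.mul_apply, this, hv p hp]) rfl
      refine ⟨l ++ [i], ?_, ?_⟩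
      · simp [hl1, mul_assoc, simpleRefl_mul_self]
      · simp [hl2, hlen]
    · push Not at hd
      have hmono : StrictMono v := strictMono_nat_of_lt_succ fun i =>
        lt_of_le_of_ne (hd i) fun hc => by
          have := v.injective hc
          omega
      refine ⟨[], ?_, ?_⟩
      · have hge : ∀ p, p ≤ v p := fun p => hmono.id_le p
        have hsm : StrictMono v.symm := fun p q hpq => by
          rw [← hmono.lt_iff_lt]; simpa using hpq
        have hge' : ∀ p, p ≤ v.symm p := fun p => hsm.id_le p
        ext p
        have h1 := hge p
        have h2 := hge' (v p)
        simp only [Equiv.symm_apply_apply] at h2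
        simp
        omega
      · have : inversions v = ∅ := by
          ext ⟨p, q⟩
          simp only [inversions, Set.mem_ofPred_eq, Set.mem_empty_iff_false, iff_false, not_and,
            not_lt]
          exact fun hpq => (hmono hpq).le
        simp [length, this]

/-! ### Double Grothendieck polynomials -/

/-- Polynomials over `ℤ` in the variables `a_i⁻¹` and `b_i`. -/
abbrev GPoly : Type := MvPolynomial (ℕ ⊕ ℕ) ℤ

/-- The variable `a_i⁻¹`. -/
def aInv (i : ℕ) : GPoly := X (Sum.inl i)

/-- The variable `b_i`. -/
def bVar (i : ℕ) : GPoly := X (Sum.inr i)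

/-- Exchange of `a_i` and `a_{i+1}`. -/
def swapA (i : ℕ) : GPoly →ₐ[ℤ] GPoly := rename (Sum.map (simpleRefl i) id)

/-- The division in the definition of `demazure` is exact. -/
theorem exists_demazure (i : ℕ) (F : GPoly) :
    ∃ Q : GPoly, (aInv (i + 1) - aInv i) * Q = aInv (i + 1) * F - aInv i * swapA i F := by
  have hdvd : aInv (i + 1) - aInv i ∣ F - swapA i F := by
    rw [← Ideal.mem_span_singleton, ← Ideal.Quotient.eq]
    have key : (Ideal.Quotient.mkₐ ℤ (Ideal.span {aInv (i + 1) - aInv i})) =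
        (Ideal.Quotient.mkₐ ℤ (Ideal.span {aInv (i + 1) - aInv i})).comp (swapA i) := by
      apply MvPolynomial.algHom_ext
      intro x
      have hmem : aInv (i + 1) - aInv i ∈ Ideal.span {aInv (i + 1) - aInv i} :=
        Ideal.mem_span_singleton_self _
      have h2 := (Ideal.Quotient.eq (I := Ideal.span {aInv (i + 1) - aInv i})).2 hmem
      rcases x with p | p
      · simp only [AlgHom.comp_apply, swapA, rename_X, Sum.map_inl, Ideal.Quotient.mkₐ_eq_mk]
        simp only [simpleRefl, Equiv.swap_apply_def]
        split_ifs with h h'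
        · subst h; exact h2.symm
        · subst h'; exact h2
        · rfl
      · simp [swapA]
    exact congrArg (fun f => f F) key
  obtain ⟨c, hc⟩ := hdvd
  refine ⟨F + aInv i * c, ?_⟩
  linear_combination aInv i * hc.symm

/-- The polynomial `Q` with `(a_i - a_{i+1}) Q = a_i F - a_{i+1} F(…, a_{i+1}, a_i, …)`. In the
defining property below this equation is multiplied by `a_i⁻¹ a_{i+1}⁻¹`. -/
def demazure (i : ℕ) (F : GPoly) : GPoly := (exists_demazure i F).choose

theorem demazure_spec (i : ℕ) (F : GPoly) :
    (aInv (i + 1) - aInv i) * demazure i F = aInv (i + 1) * F - aInv i * swapA i F :=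
  (exists_demazure i F).choose_spec

/-- The number of pairs `p < q < N` with `w p < w q`. -/
def numNonInv (N : ℕ) (w : Perm ℕ) : ℕ :=
  ((Finset.range N ×ˢ Finset.range N).filter fun x => x.1 < x.2 ∧ w x.1 < w x.2).card

/-- The positions `i < i + 1 < N` with `w i < w (i + 1)`. -/
def ascents (N : ℕ) (w : Perm ℕ) : Finset ℕ :=
  (Finset.range N).filter fun i => i + 1 < N ∧ w i < w (i + 1)

lemma numNonInv_lt {N : ℕ} {w : Perm ℕ} {i : ℕ} (hmem : i ∈ ascents N w) :
    numNonInv N (w * simpleRefl i) < numNonInv N w := by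
  have hi : i + 1 < N ∧ w i < w (i + 1) := (Finset.mem_filter.1 hmem).2
  have hs : ∀ p, simpleRefl i (simpleRefl i p) = p := fun p => by simp [simpleRefl]
  have h0 : simpleRefl i i = i + 1 := by simp [simpleRefl]
  have h1 : simpleRefl i (i + 1) = i := by simp [simpleRefl]
  have hN : ∀ p, p < N → simpleRefl i p < N := by
    intro p hp
    simp only [simpleRefl, Equiv.swap_apply_def]
    split_ifs <;> omega
  unfold numNonInv
  rw [← Finset.card_image_of_injective _
    ((simpleRefl i).injective.prodMap (simpleRefl i).injective)]
  apply Finset.card_lt_card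
  rw [Finset.ssubset_iff_of_subset]
  · refine ⟨(i, i + 1), ?_, ?_⟩
    · simp only [Finset.mem_filter, Finset.mem_product, Finset.mem_range]
      omega
    · intro hc
      simp only [Finset.mem_image, Finset.mem_filter, Prod.exists, Prod.map_apply,
        Prod.mk.injEq] at hc
      obtain ⟨p, q, ⟨-, hpq, -⟩, hp, hq⟩ := hc
      have e1 := congrArg (simpleRefl i) hp
      have e2 := congrArg (simpleRefl i) hq
      rw [hs, h0] at e1
      rw [hs, h1] at e2
      omega
  · intro x hx
    obtain ⟨⟨p, q⟩, hx', rfl⟩ := Finset.mem_image.1 hx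
    obtain ⟨hx1, hpq, hw⟩ := Finset.mem_filter.1 hx'
    obtain ⟨hp, hq⟩ := Finset.mem_product.1 hx1
    simp only [Finset.mem_range, Perm.mul_apply] at hp hq hpq hw
    have hne : ¬ (p = i ∧ q = i + 1) := by
      rintro ⟨rfl, rfl⟩
      rw [h0, h1] at hw
      omega
    simp only [Finset.mem_filter, Finset.mem_product, Finset.mem_range, Prod.map_apply]
    exact ⟨⟨hN p hp, hN q hq⟩, simpleRefl_lt hpq hne, hw⟩

/-- The double Grothendieck polynomial `𝔊_w(a; b)` of `w ∈ S_N`, as defined by Lascoux and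
Schützenberger: it is `∏_{p + q ≤ N} (1 - b_p / a_q)` for the longest element `w` of `S_N`, and
if `w(i) < w(i+1)` then `(a_i - a_{i+1}) 𝔊_w = a_i 𝔊_{w s_i} - a_{i+1} 𝔊_{w s_i}(a_{s_i}; b)`.
(The recursion uses the least such `i`; any other choice gives the same polynomial. An element of
`S_N` without such an `i < N` is the longest one.) -/
def groth (N : ℕ) (w : Perm ℕ) : GPoly :=
  if h : (ascents N w).Nonempty then
    demazure ((ascents N w).min' h) (groth N (w * simpleRefl ((ascents N w).min' h)))
  else
    ∏ x ∈ (Finset.range N ×ˢ Finset.range N).filter (fun x => (x.1 + 1) + (x.2 + 1) ≤ N),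
      (1 - bVar x.1 * aInv x.2)
termination_by numNonInv N w
decreasing_by exact numNonInv_lt (Finset.min'_mem _ h)

variable {K : Type*} [Field K]

/-- The value `𝔊_w(a_1, …, a_q, 1, 1, … ; b_1, …, b_p, 1, 1, …)` for `w ∈ S_N`. If both lists have
length `N` no ones are inserted, as only the first `N` variables of each kind occur. -/
def grothEval (N : ℕ) (w : Perm ℕ) (a b : List K) : K :=
  MvPolynomial.aeval (Sum.elim (fun i => (a.getD i 1)⁻¹) (fun i => b.getD i 1)) (groth N w)

/-- The stable double Grothendieck polynomial `G_w(a_1, …, a_q ; b_1, …, b_p)` of `w ∈ S_k`: the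
value `𝔊_{1^m × w}(a_1, …, a_q, 1, …, 1 ; b_1, …, b_p, 1, …, 1)`, which is the same for all
`m ≥ max(p, q)`, at `m = max(p, q)`. -/
def stableGroth {k : ℕ} (w : Perm (Fin k)) (a b : List K) : K :=
  grothEval (max a.length b.length + k) (shiftPerm (max a.length b.length) (embed w)) a b

/-! ### Rank conditions and Zelevinsky permutations -/

/-- `r = (r i j)`, `0 ≤ i ≤ j ≤ n`, is a set of rank conditions that can occur as the ranks of the
maps in a sequence of `n` linear maps of vector spaces of dimensions `r 0 0, …, r n n`. Values
`r i j` outside `0 ≤ i ≤ j ≤ n` are irrelevant. -/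
structure IsRankConditions (n : ℕ) (r : ℕ → ℕ → ℕ) : Prop where
  le_left : ∀ i j, i ≤ j → j + 1 ≤ n → r i (j + 1) ≤ r i j
  le_right : ∀ i j, i ≤ j → j + 1 ≤ n → r i (j + 1) ≤ r (i + 1) (j + 1)
  convex : ∀ i j, i + 1 ≤ j → j + 1 ≤ n →
    r i j + r (i + 1) (j + 1) ≤ r (i + 1) j + r i (j + 1)

/-- The extended rank conditions: `r_{ij} = e_j + ⋯ + e_i` for `j ≤ i`, where `e_k = r_{kk}`. -/
def ext (r : ℕ → ℕ → ℕ) (i j : ℕ) : ℕ :=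
  if i ≤ j then r i j else ∑ k ∈ Finset.Icc j i, r k k

/-- The expected codimension `d(r) = ∑_{i < j} (r_{i,j-1} - r_{ij}) (r_{i+1,j} - r_{ij})`. -/
def expCodim (n : ℕ) (r : ℕ → ℕ → ℕ) : ℤ :=
  ∑ j ∈ Finset.range (n + 1), ∑ i ∈ Finset.range j,
    ((r i (j - 1) : ℤ) - r i j) * ((r (i + 1) j : ℤ) - r i j)

/-- The permutation exchanging the block of the `A` positions after the first `c` ones with the
block of the next `B` positions. -/
def blockSwap (c A B : ℕ) : Perm ℕ where
  toFun p := if c ≤ p ∧ p < c + A then p + B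
    else if c + A ≤ p ∧ p < c + A + B then p - A else p
  invFun p := if c ≤ p ∧ p < c + B then p + A
    else if c + B ≤ p ∧ p < c + B + A then p - B else p
  left_inv p := by
    dsimp only
    split_ifs <;> omega
  right_inv p := by
    dsimp only
    split_ifs <;> omega

/-- The permutation `W_{ij}`, for `0 ≤ i < n` and `0 < j ≤ n`. It adds `r_{i,j-1} - r_{ij}` to the
positions following the first `r_{ij}` up to the `r_{i+1,j}`-th one, and subtracts
`r_{i+1,j} - r_{ij}` from the next `r_{i,j-1} - r_{ij}` positions. -/
def W (r : ℕ → ℕ → ℕ) (i j : ℕ) : Perm ℕ :=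
  blockSwap (ext r i j) (ext r (i + 1) j - ext r i j) (ext r i (j - 1) - ext r i j)

/-- The conjugate Zelevinsky permutation `z(r) = ∏_{j=1}^n ∏_{i=0}^{n-1} W_{ij}`. -/
def conjZel (n : ℕ) (r : ℕ → ℕ → ℕ) : Perm ℕ :=
  ((List.range n).map fun j => ((List.range n).map fun i => W r i (j + 1)).prod).prod

/-- `N = e_0 + ⋯ + e_n`. -/
def totalDim (n : ℕ) (r : ℕ → ℕ → ℕ) : ℕ := ∑ k ∈ Finset.range (n + 1), r k k

/-- The Zelevinsky permutation `ẑ(r) = w_0 z(r)⁻¹ w_0`, with `w_0` the longest element of `S_N`. -/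
def zel (n : ℕ) (r : ℕ → ℕ → ℕ) : Perm ℕ :=
  longest (totalDim n r) * (conjZel n r)⁻¹ * longest (totalDim n r)

/-- The maximal rank conditions `r^e_{ij} = min{e_i, …, e_j}`, `i ≤ j`, with the same dimension
vector `e` as `r`. Thus `ẑ(e)` is `zel n (maxRank r)`. -/
def maxRank (r : ℕ → ℕ → ℕ) (i j : ℕ) : ℕ := sInf ((fun k => r k k) '' Set.Icc i j)

/-! ### KMS-factorizations -/

/-- `δ_j = W_{jj} W_{j+1,j} ⋯ W_{n-1,j}`. (For `j = n` this is the empty product `1`.) -/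
def delta (n : ℕ) (r : ℕ → ℕ → ℕ) (j : ℕ) : Perm ℕ :=
  ((List.range' j (n - j)).map fun i => W r i j).prod

/-- Sequences `(w_1, …, w_n)` with `w_i ∈ S_{e_{i-1} + e_i}`; here `w_{i+1}` is the value at
`i = 0, …, n - 1`. -/
abbrev PermSeq (n : ℕ) (r : ℕ → ℕ → ℕ) : Type :=
  (i : Fin n) → Perm (Fin (r i i + r (i + 1) (i + 1)))

/-- `(w_1, …, w_n)` is a KMS-factorization for `r`: the absolute Hecke product
`w_1 · δ_1 · w_2 · δ_2 ⋯ δ_{n-1} · w_n` is `z(r)`. (The list ends with the extra factor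
`δ_n = 1`.) -/
def IsKMS (n : ℕ) (r : ℕ → ℕ → ℕ) (w : PermSeq n r) : Prop :=
  heckeProd ((List.finRange n).flatMap fun i => [embed (w i), delta n r (i + 1)]) = conjZel n r

/-! ### The variables -/

/-- The field of rational functions over `ℚ` in variables `a^i_j`, presented as the fraction field
of `ℤ[a^i_j]`. Only the `a^i_j` with `0 ≤ i ≤ n` and `0 ≤ j < e_i` are used. -/
abbrev RatField : Type := FractionRing (MvPolynomial (ℕ × ℕ) ℤ)

/-- The list of variables `a^i = (a^i_1, …, a^i_{e_i})`. -/
def block (r : ℕ → ℕ → ℕ) (i : ℕ) : List RatField :=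
  (List.range (r i i)).map fun j => algebraMap (MvPolynomial (ℕ × ℕ) ℤ) RatField (X (i, j))

/-- `a = (a^0, a^1, …, a^n)`. -/
def allVars (n : ℕ) (r : ℕ → ℕ → ℕ) : List RatField :=
  (List.range (n + 1)).flatMap (block r)

/-- `ă = (a^n, …, a^1, a^0)`. -/
def allVarsRev (n : ℕ) (r : ℕ → ℕ → ℕ) : List RatField :=
  (List.range (n + 1)).reverse.flatMap (block r)

end

end Quiver

/-!
The formula is an identity between coefficients of products in the degenerate Hecke algebra. Let
`τ_w` be the basis with `τ_u τ_v = τ_{u · v}` (absolute Hecke product), and put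
`h_i(u) = 1 + (u - 1) τ_i`; then `h_i(u) h_i(v) = h_i(u v)`, and the Yang-Baxter equation holds. By
Fomin and Kirillov the polynomial `𝔊_w(a; b)` of `w ∈ S_N` is, up to the sign `(-1)^ℓ(w)`, the
coefficient of `τ_{w_0 w⁻¹ w_0}` in a product of `h_i`'s: of the product `S(a) S(b)⁻¹`, for
`S(x) = ∏_k h_{k-1}(x_k⁻¹) ⋯ h_0(x_k⁻¹)` with the variables in reverse order (`grothEval_eq`). In
the stable case all rows of the staircases have the same length (`stableGroth_eq`).

For the variables of the theorem, `𝔊_{ẑ(r)}(ă; a)` is therefore, up to sign, the coefficient at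
`z(r)` of `P = S(a^0, …, a^n) S(a^n, …, a^0)⁻¹`, the entries of each block being reversed. The
blocks of parameters of `S` can be exchanged: `S(…, b, c, …)` is a rectangular product of `h_i`'s
times `S(…, c, b, …)` (`stair_rect`). Moving one block after the other turns `P` into
`R_1 D_1 R_2 D_2 ⋯ R_n`, where `R_j` depends on `a^{j-1}` and `a^j` only, and `D_j` is the
rectangular product that exchanges `a^{j-1}` with the blocks after `a^j` (`stairQuot_succ`). Now

* Permutations like `z(r)`, which send the last positions to small values, have so many inversions
  that only the top term of each `D_j`, a multiple of `τ_{δ_j}`, contributes to their coefficients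
  (`exists_cf_stairQuot`). So the coefficient of `P` is `C` times that of `R_1 τ_{δ_1} R_2 ⋯ R_n`,
  with a constant `C ≠ 0` that depends on `e` but not on `r`; it cancels in the quotient.
* `R_j` differs from the element `G_j` whose coefficients are the stable polynomials in `a^j` and
  `a^{j-1}` by factors that can be moved to the two ends of the product
  (`exists_altProd_stablePair`). There they do not affect the coefficient at `z(r)`, since `z(r)` is
  increasing on blocks of positions and its inverse on blocks of values (`conjZel_lt`,
  `conjZel_inv_lt`).
* The coefficient of `G_1 τ_{δ_1} G_2 ⋯ G_n` at `z(r)` is a sum over the KMS-factorizations, by the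
  definition of the product of the `τ_w` (`cf_altProd_eq_sum`).
* For the maximal rank conditions `z(r^e) = δ_1 ⋯ δ_{n-1}`, and the coefficient of
  `R_1 τ_{δ_1} R_2 ⋯ R_n` at this permutation is `1` (`conjZel_maxRank`, `cf_deltaProd`).

The signs agree because the signs of `z(r)` and `z(r^e)` differ by `(-1)^{d(r)}`
(`sgn_conjZel_mul`).
-/

namespace Quiver

open Equiv

noncomputable section

/-! ### The Demazure product -/

/-- The permutations of `ℕ` moving finitely many integers. -/
def FinSupp (w : Perm ℕ) : Prop := ∃ m, ∀ p, m ≤ p → w p = p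

lemma FinSupp.one : FinSupp 1 := ⟨0, fun _ _ => rfl⟩

lemma FinSupp.mul {u v : Perm ℕ} (hu : FinSupp u) (hv : FinSupp v) : FinSupp (u * v) := by
  obtain ⟨m, hm⟩ := hu
  obtain ⟨k, hk⟩ := hv
  refine ⟨max m k, fun p hp => ?_⟩
  rw [Perm.mul_apply, hk p (le_trans (le_max_right _ _) hp), hm p (le_trans (le_max_left _ _) hp)]

lemma FinSupp.inv {u : Perm ℕ} (hu : FinSupp u) : FinSupp u⁻¹ := by
  obtain ⟨m, hm⟩ := hu
  exact ⟨m, fun p hp => by rw [Perm.inv_eq_iff_eq]; exact (hm p hp).symm⟩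

lemma simpleRefl_apply (i p : ℕ) :
    simpleRefl i p = if p = i then i + 1 else if p = i + 1 then i else p := by
  simp only [simpleRefl, Equiv.swap_apply_def]

@[simp] lemma simpleRefl_left (i : ℕ) : simpleRefl i i = i + 1 := by simp [simpleRefl]

@[simp] lemma simpleRefl_right (i : ℕ) : simpleRefl i (i + 1) = i := by simp [simpleRefl]

@[simp] lemma simpleRefl_inv (i : ℕ) : (simpleRefl i)⁻¹ = simpleRefl i := by simp [simpleRefl]

lemma simpleRefl_of_lt {i p : ℕ} (h : p < i) : simpleRefl i p = p := by
  rw [simpleRefl_apply]; split_ifs <;> omega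

lemma simpleRefl_of_gt {i p : ℕ} (h : i + 1 < p) : simpleRefl i p = p := by
  rw [simpleRefl_apply]; split_ifs <;> omega

lemma FinSupp.simpleRefl (i : ℕ) : FinSupp (simpleRefl i) :=
  ⟨i + 2, fun _ hp => simpleRefl_of_gt (by omega)⟩

lemma simpleRefl_lt_iff {i p q : ℕ} (h : ¬ (p = i ∧ q = i + 1)) (h' : ¬ (p = i + 1 ∧ q = i)) :
    simpleRefl i p < simpleRefl i q ↔ p < q := by
  simp only [simpleRefl_apply]
  split_ifs <;> omega

lemma heckeStep_of_lt {u : Perm ℕ} {i : ℕ} (h : u i < u (i + 1)) :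
    heckeStep u i = u * simpleRefl i := if_pos h

lemma heckeStep_of_gt {u : Perm ℕ} {i : ℕ} (h : u (i + 1) < u i) :
    heckeStep u i = u := if_neg (by omega)

/-- The left analogue of `heckeStep`. -/
def heckeStepLeft (i : ℕ) (u : Perm ℕ) : Perm ℕ :=
  if u⁻¹ i < u⁻¹ (i + 1) then simpleRefl i * u else u

lemma heckeStepLeft_eq (i : ℕ) (u : Perm ℕ) : heckeStepLeft i u = (heckeStep u⁻¹ i)⁻¹ := by
  unfold heckeStepLeft heckeStep
  split_ifs <;> simp

/-- Left and right multiplication by generators commute: this is the associativity of the Demazure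
product. -/
lemma heckeStepLeft_comm (j : ℕ) (u : Perm ℕ) (i : ℕ) :
    heckeStepLeft j (heckeStep u i) = heckeStep (heckeStepLeft j u) i := by
  have e1 : u (u⁻¹ j) = j := by simp
  have e2 : u (u⁻¹ (j + 1)) = j + 1 := by simp
  by_cases h1 : u i = j ∧ u (i + 1) = j + 1
  · have a1 : u⁻¹ j = i := by rw [Perm.inv_eq_iff_eq]; exact h1.1.symm
    have a2 : u⁻¹ (j + 1) = i + 1 := by rw [Perm.inv_eq_iff_eq]; exact h1.2.symm
    have h3 : simpleRefl j * u = u * simpleRefl i := by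
      rw [simpleRefl, simpleRefl, Equiv.mul_swap_eq_swap_mul, h1.1, h1.2]
    rw [heckeStep_of_lt (by omega), heckeStepLeft, heckeStepLeft, if_neg, if_pos (by omega), h3,
      heckeStep_of_gt]
    · rw [Perm.mul_apply, Perm.mul_apply, simpleRefl_left, simpleRefl_right, h1.1, h1.2]
      exact Nat.lt_succ_self j
    · simp only [mul_inv_rev, simpleRefl_inv, Perm.mul_apply, a1, a2, simpleRefl_left,
        simpleRefl_right]
      omega
  by_cases h2 : u i = j + 1 ∧ u (i + 1) = j
  · have a1 : u⁻¹ (j + 1) = i := by rw [Perm.inv_eq_iff_eq]; exact h2.1.symm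
    have a2 : u⁻¹ j = i + 1 := by rw [Perm.inv_eq_iff_eq]; exact h2.2.symm
    rw [heckeStep_of_gt (by omega), heckeStepLeft, if_neg (by omega), heckeStep_of_gt (by omega)]
  have h3 : (simpleRefl j * u) i < (simpleRefl j * u) (i + 1) ↔ u i < u (i + 1) := by
    simp only [Perm.mul_apply]
    exact simpleRefl_lt_iff h1 h2
  have h4 : (u * simpleRefl i)⁻¹ j < (u * simpleRefl i)⁻¹ (j + 1) ↔ u⁻¹ j < u⁻¹ (j + 1) := by
    simp only [mul_inv_rev, simpleRefl_inv, Perm.mul_apply]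
    refine simpleRefl_lt_iff ?_ ?_
    · rintro ⟨a, b⟩; exact h1 ⟨by rw [← a, e1], by rw [← b, e2]⟩
    · rintro ⟨a, b⟩; exact h2 ⟨by rw [← b, e2], by rw [← a, e1]⟩
  unfold heckeStepLeft heckeStep
  by_cases A : u i < u (i + 1) <;> by_cases B : u⁻¹ j < u⁻¹ (j + 1) <;>
    simp only [A, B, h3, h4, if_true, if_false, mul_assoc]

lemma FinSupp.heckeStep {u : Perm ℕ} (hu : FinSupp u) (i : ℕ) : FinSupp (heckeStep u i) := by
  unfold Quiver.heckeStep
  split_ifs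
  exacts [hu.mul (.simpleRefl i), hu]

lemma FinSupp.foldl {u : Perm ℕ} (hu : FinSupp u) (l : List ℕ) :
    FinSupp (l.foldl Quiver.heckeStep u) := by
  induction l generalizing u with
  | nil => exact hu
  | cons i l ih => exact ih (hu.heckeStep i)

lemma length_heckeStep_le {u : Perm ℕ} (hu : FinSupp u) (i : ℕ) :
    length (u * simpleRefl i) + 1 = length u ∧ u (i + 1) < u i ∨
      length (u * simpleRefl i) = length u + 1 ∧ u i < u (i + 1) := by
  rcases lt_or_gt_of_ne (show u i ≠ u (i + 1) from fun h => by simpa using u.injective h) with h | h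
  · right
    obtain ⟨m, hm⟩ := hu.mul (.simpleRefl i)
    have := length_mul_simpleRefl hm (i := i) (by simpa using h)
    rw [mul_assoc, simpleRefl_mul_self, mul_one] at this
    exact ⟨this.symm, h⟩
  · left
    obtain ⟨m, hm⟩ := hu
    exact ⟨length_mul_simpleRefl hm h, h⟩

lemma FinSupp.prod (l : List ℕ) : FinSupp (l.map Quiver.simpleRefl).prod := by
  induction l with
  | nil => exact .one
  | cons i l ih => simpa using (FinSupp.simpleRefl i).mul ih

@[simp] lemma length_one : length 1 = 0 := by
  have : inversions 1 = ∅ := by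
    ext ⟨p, q⟩
    simp only [inversions, Set.mem_ofPred_eq, Set.mem_empty_iff_false, iff_false, not_and, not_lt,
      Perm.one_apply]
    exact fun h => h.le
  simp [length, this]

lemma length_prod_le (l : List ℕ) : length (l.map simpleRefl).prod ≤ l.length := by
  induction l using List.reverseRecOn with
  | nil => simp
  | append_singleton l i ih =>
    have := length_heckeStep_le (FinSupp.prod l) i
    simp only [List.map_append, List.prod_append, List.map_cons, List.map_nil, List.prod_singleton,
      List.length_append, List.length_singleton]
    omega

/-- Along a reduced word the Demazure product is the ordinary one. -/
lemma foldl_heckeStep_of_isReducedWord {l : List ℕ} {v : Perm ℕ} (h : IsReducedWord l v) :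
    l.foldl heckeStep 1 = v := by
  induction l using List.reverseRecOn generalizing v with
  | nil => simpa using h.1
  | append_singleton l i ih =>
    obtain ⟨h1, h2⟩ := h
    simp only [List.map_append, List.prod_append, List.map_cons, List.map_nil, List.prod_singleton,
      List.length_append, List.length_singleton] at h1 h2
    have h3 := length_heckeStep_le (FinSupp.prod l) i
    have h4 := length_prod_le l
    rw [h1] at h3
    have h5 := ih (v := (l.map simpleRefl).prod) ⟨rfl, by omega⟩
    rw [List.foldl_append, h5, List.foldl_cons, List.foldl_nil, heckeStep_of_lt (by omega), h1]

lemma exists_foldl_eq {v : Perm ℕ} (hv : FinSupp v) : ∃ l : List ℕ, l.foldl heckeStep 1 = v := by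
  obtain ⟨m, hm⟩ := hv
  obtain ⟨l, hl⟩ := exists_isReducedWord hm
  exact ⟨l, foldl_heckeStep_of_isReducedWord hl⟩

lemma isReducedWord_reducedWord {v : Perm ℕ} (hv : FinSupp v) :
    IsReducedWord (reducedWord v) v := by
  obtain ⟨m, hm⟩ := hv
  exact Classical.epsilon_spec (exists_isReducedWord hm)

lemma foldr_heckeStepLeft_foldl (l l' : List ℕ) (u : Perm ℕ) :
    l.foldr heckeStepLeft (l'.foldl heckeStep u) =
      l'.foldl heckeStep (l.foldr heckeStepLeft u) := by
  have h : ∀ i u,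
      l.foldr heckeStepLeft (heckeStep u i) = heckeStep (l.foldr heckeStepLeft u) i := by
    intro i u
    induction l with
    | nil => rfl
    | cons j l ih => rw [List.foldr_cons, List.foldr_cons, ih, heckeStepLeft_comm]
  induction l' generalizing u with
  | nil => rfl
  | cons i l' ih => rw [List.foldl_cons, List.foldl_cons, ih, h]

lemma exists_foldr_eq {u : Perm ℕ} (hu : FinSupp u) :
    ∃ l : List ℕ, l.foldr heckeStepLeft 1 = u := by
  obtain ⟨l, hl⟩ := exists_foldl_eq hu.inv
  refine ⟨l.reverse, ?_⟩
  have : ∀ l : List ℕ, l.reverse.foldr heckeStepLeft 1 = (l.foldl heckeStep 1)⁻¹ := by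
    intro l
    induction l using List.reverseRecOn with
    | nil => simp
    | append_singleton l i ih =>
      rw [List.reverse_append, List.foldl_append, List.reverse_singleton, List.singleton_append,
        List.foldr_cons, ih, heckeStepLeft_eq, inv_inv]
      rfl
  rw [this, hl, inv_inv]

/-- Right multiplication by a word depends only on the Demazure product of the word, since right
steps commute with left steps. -/
lemma foldl_heckeStep_congr {u : Perm ℕ} (hu : FinSupp u) {l l' : List ℕ}
    (h : l.foldl heckeStep 1 = l'.foldl heckeStep 1) :
    l.foldl heckeStep u = l'.foldl heckeStep u := by
  obtain ⟨k, rfl⟩ := exists_foldr_eq hu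
  rw [← foldr_heckeStepLeft_foldl, ← foldr_heckeStepLeft_foldl, h]

/-- The monoid of finitely supported permutations of `ℕ` under the Demazure product (the absolute
Hecke product). -/
@[ext] structure Dem where
  /-- The underlying permutation. -/
  perm : Perm ℕ
  finSupp : FinSupp perm

lemma heckeMul_eq_foldl {u v : Perm ℕ} (hu : FinSupp u) (hv : FinSupp v) {l : List ℕ}
    (hl : l.foldl heckeStep 1 = v) : heckeMul u v = l.foldl heckeStep u :=
  foldl_heckeStep_congr hu
    ((foldl_heckeStep_of_isReducedWord (isReducedWord_reducedWord hv)).trans hl.symm)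

lemma FinSupp.heckeMul {u v : Perm ℕ} (hu : FinSupp u) : FinSupp (heckeMul u v) :=
  hu.foldl _

instance : Monoid Dem where
  mul u v := ⟨heckeMul u.perm v.perm, u.finSupp.heckeMul⟩
  one := ⟨1, .one⟩
  mul_assoc := by
    rintro ⟨u, hu⟩ ⟨v, hv⟩ ⟨w, hw⟩
    obtain ⟨l, rfl⟩ := exists_foldl_eq hv
    obtain ⟨k, rfl⟩ := exists_foldl_eq hw
    apply Dem.ext
    change Quiver.heckeMul (Quiver.heckeMul u _) _ = Quiver.heckeMul u (Quiver.heckeMul _ _)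
    rw [heckeMul_eq_foldl hu hv rfl, heckeMul_eq_foldl (hu.foldl l) hw rfl,
      heckeMul_eq_foldl hv hw rfl, ← List.foldl_append, ← List.foldl_append,
      heckeMul_eq_foldl hu (FinSupp.foldl .one _) rfl]
  one_mul := by
    rintro ⟨v, hv⟩
    obtain ⟨l, rfl⟩ := exists_foldl_eq hv
    apply Dem.ext
    exact heckeMul_eq_foldl .one hv rfl
  mul_one := by
    rintro ⟨u, hu⟩
    apply Dem.ext
    exact heckeMul_eq_foldl hu .one (l := []) rfl

/-- The generator `s_i` of the Demazure monoid. -/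
def dgen (i : ℕ) : Dem := ⟨simpleRefl i, .simpleRefl i⟩

@[simp] lemma Dem.one_perm : (1 : Dem).perm = 1 := rfl

lemma Dem.mul_perm (u v : Dem) : (u * v).perm = heckeMul u.perm v.perm := rfl

lemma Dem.mul_dgen_perm (u : Dem) (i : ℕ) : (u * dgen i).perm = heckeStep u.perm i := by
  rw [Dem.mul_perm, heckeMul_eq_foldl u.finSupp (dgen i).finSupp (l := [i])]
  · rfl
  · rw [List.foldl_cons, List.foldl_nil, heckeStep_of_lt (by simp), one_mul]
    rfl

lemma Dem.dgen_mul_perm (i : ℕ) (u : Dem) : (dgen i * u).perm = heckeStepLeft i u.perm := by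
  obtain ⟨u, hu⟩ := u
  obtain ⟨l, rfl⟩ := exists_foldl_eq hu
  rw [Dem.mul_perm, heckeMul_eq_foldl (dgen i).finSupp hu rfl]
  have : heckeStepLeft i 1 = (dgen i).perm := by
    rw [heckeStepLeft, if_pos (by simp), mul_one]; rfl
  rw [← this]
  simpa using (foldr_heckeStepLeft_foldl [i] l 1).symm

lemma dgen_mul_self (i : ℕ) : dgen i * dgen i = dgen i := by
  apply Dem.ext
  rw [Dem.mul_dgen_perm, heckeStep_of_gt]
  simp [dgen]

lemma dgen_comm {i j : ℕ} (h : i + 2 ≤ j) : dgen i * dgen j = dgen j * dgen i := by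
  apply Dem.ext
  rw [Dem.mul_dgen_perm, Dem.mul_dgen_perm, heckeStep_of_lt, heckeStep_of_lt]
  · ext p
    simp only [dgen, Perm.mul_apply, simpleRefl_apply]
    split_ifs <;> omega
  · simp only [dgen, simpleRefl_apply]; split_ifs <;> omega
  · simp only [dgen, simpleRefl_apply]; split_ifs <;> omega

lemma dgen_braid (i : ℕ) :
    dgen i * dgen (i + 1) * dgen i = dgen (i + 1) * dgen i * dgen (i + 1) := by
  apply Dem.ext
  have e1 : (dgen i * dgen (i + 1)).perm = simpleRefl i * simpleRefl (i + 1) := by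
    rw [Dem.mul_dgen_perm, heckeStep_of_lt]
    · rfl
    · simp only [dgen, simpleRefl_apply]; split_ifs <;> omega
  have e2 : (dgen (i + 1) * dgen i).perm = simpleRefl (i + 1) * simpleRefl i := by
    rw [Dem.mul_dgen_perm, heckeStep_of_lt]
    · rfl
    · simp only [dgen, simpleRefl_apply]; split_ifs <;> omega
  rw [Dem.mul_dgen_perm, e1, Dem.mul_dgen_perm, e2, heckeStep_of_lt, heckeStep_of_lt]
  · ext p
    simp only [Perm.mul_apply, simpleRefl_apply]
    split_ifs <;> omega
  · simp only [Perm.mul_apply, simpleRefl_apply]; split_ifs <;> omega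
  · simp only [Perm.mul_apply, simpleRefl_apply]; split_ifs <;> omega

/-- The submonoid generated by the `s_g` with `g ∈ G`. -/
def demSub (G : Set ℕ) : Submonoid Dem := Submonoid.closure (dgen '' G)

/-- The subgroup of the ordinary permutation group generated by the `s_g` with `g ∈ G`. -/
def permSub (G : Set ℕ) : Subgroup (Perm ℕ) := Subgroup.closure (simpleRefl '' G)

lemma dgen_mem_demSub {G : Set ℕ} {g : ℕ} (h : g ∈ G) : dgen g ∈ demSub G :=
  Submonoid.subset_closure ⟨g, h, rfl⟩

lemma demSub_mono {G G' : Set ℕ} (h : G ⊆ G') : demSub G ≤ demSub G' :=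
  Submonoid.closure_mono (Set.image_mono h)

/-- The Demazure product with an element of a parabolic submonoid on the right is an ordinary
product with some element of the parabolic subgroup. -/
lemma exists_mul_right {G : Set ℕ} {y : Dem} (hy : y ∈ demSub G) (v : Dem) :
    ∃ y' ∈ permSub G, (v * y).perm = v.perm * y' := by
  induction hy using Submonoid.closure_induction generalizing v with
  | mem x hx =>
    obtain ⟨g, hg, rfl⟩ := hx
    rw [Dem.mul_dgen_perm]
    unfold heckeStep
    split_ifs
    · exact ⟨_, Subgroup.subset_closure ⟨g, hg, rfl⟩, rfl⟩
    · exact ⟨1, one_mem _, by simp⟩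
  | one => exact ⟨1, one_mem _, by simp⟩
  | mul x y _ _ hx hy =>
    obtain ⟨x', hx', ex⟩ := hx v
    obtain ⟨y', hy', ey⟩ := hy (v * x)
    exact ⟨x' * y', mul_mem hx' hy', by rw [← mul_assoc, ey, ex, mul_assoc]⟩

lemma exists_mul_left {G : Set ℕ} {x : Dem} (hx : x ∈ demSub G) (v : Dem) :
    ∃ x' ∈ permSub G, (x * v).perm = x' * v.perm := by
  induction hx using Submonoid.closure_induction generalizing v with
  | mem x hx =>
    obtain ⟨g, hg, rfl⟩ := hx
    rw [Dem.dgen_mul_perm]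
    unfold heckeStepLeft
    split_ifs
    · exact ⟨_, Subgroup.subset_closure ⟨g, hg, rfl⟩, rfl⟩
    · exact ⟨1, one_mem _, by simp⟩
  | one => exact ⟨1, one_mem _, by simp⟩
  | mul x y _ _ hx hy =>
    obtain ⟨y', hy', ey⟩ := hy v
    obtain ⟨x', hx', ex⟩ := hx (y * v)
    exact ⟨x' * y', mul_mem hx' hy', by rw [mul_assoc, ex, ey, mul_assoc]⟩

lemma perm_mem_permSub {G : Set ℕ} {x : Dem} (hx : x ∈ demSub G) : x.perm ∈ permSub G := by
  obtain ⟨x', hx', h⟩ := exists_mul_right hx 1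
  rw [one_mul, Dem.one_perm, one_mul] at h
  rwa [h]

lemma permSub_fix {G : Set ℕ} {x : Perm ℕ} (hx : x ∈ permSub G) {p : ℕ}
    (hp : ∀ g ∈ G, p ≠ g ∧ p ≠ g + 1) : x p = p := by
  induction hx using Subgroup.closure_induction with
  | mem x hx =>
    obtain ⟨g, hg, rfl⟩ := hx
    rw [simpleRefl_apply, if_neg (hp g hg).1, if_neg (hp g hg).2]
  | one => rfl
  | mul x y _ _ hx hy => rw [Perm.mul_apply, hy, hx]
  | inv x _ hx => rw [Perm.inv_eq_iff_eq, hx]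

/-- If no generator links `c - 1` and `c` the set of the integers `< c` is preserved. -/
lemma permSub_lt_iff {G : Set ℕ} {x : Perm ℕ} (hx : x ∈ permSub G) {c : ℕ}
    (hc : ∀ g ∈ G, g + 1 ≠ c) (p : ℕ) : x p < c ↔ p < c := by
  induction hx using Subgroup.closure_induction generalizing p with
  | mem x hx =>
    obtain ⟨g, hg, rfl⟩ := hx
    have := hc g hg
    rw [simpleRefl_apply]
    split_ifs <;> omega
  | one => rfl
  | mul x y _ _ hx hy => rw [Perm.mul_apply, hx, hy]
  | inv x _ hx => rw [← hx (x⁻¹ p)]; simp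

/-- Multiplication by `y` on the right is ordinary if the left factor is increasing on a window
containing the support of `y`. -/
lemma mul_perm_of_strictMonoOn {M : ℕ} {δ y : Dem} (hδ : ∀ p q, p < q → q < M → δ.perm p < δ.perm q)
    (hy : y ∈ demSub {g | g + 1 < M}) : (δ * y).perm = δ.perm * y.perm := by
  induction hy using Submonoid.closure_induction_right with
  | one => simp
  | mul_right x hx y hy ih =>
    obtain ⟨g, hg, rfl⟩ := hy
    rw [← mul_assoc, Dem.mul_dgen_perm, Dem.mul_dgen_perm, ih]
    have h1 : ∀ p, x.perm p < M ↔ p < M :=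
      permSub_lt_iff (perm_mem_permSub hx) (fun g hg => by simp at hg; omega)
    have hg' : g + 1 < M := hg
    have a1 := (h1 g).2 (by omega)
    have a2 := (h1 (g + 1)).2 hg'
    rcases lt_or_gt_of_ne (show x.perm g ≠ x.perm (g + 1) from
      fun h => by simpa using x.perm.injective h) with h | h
    · rw [heckeStep_of_lt h, heckeStep_of_lt (u := δ.perm * x.perm) (hδ _ _ h a2), mul_assoc]
    · rw [heckeStep_of_gt h, heckeStep_of_gt (u := δ.perm * x.perm) (hδ _ _ h a1)]

/-! ### The degenerate Hecke algebra -/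

/-- The permutation spelled by the letters of a word. -/
def wordPerm {S : Type*} (l : List (ℕ × S)) : Perm ℕ := (l.map fun x => simpleRefl x.1).prod

@[simp] lemma wordPerm_nil {S : Type*} : wordPerm ([] : List (ℕ × S)) = 1 := rfl

@[simp] lemma wordPerm_cons {S : Type*} (x : ℕ × S) (l : List (ℕ × S)) :
    wordPerm (x :: l) = simpleRefl x.1 * wordPerm l := by simp [wordPerm]

@[simp] lemma wordPerm_append {S : Type*} (l l' : List (ℕ × S)) :
    wordPerm (l ++ l') = wordPerm l * wordPerm l' := by
  simp [wordPerm]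

section HeckeAlgebra

variable {R : Type*} [CommRing R]

/-- The degenerate Hecke algebra over `R`, realized as the monoid algebra of the Demazure monoid.
Its basis element `τ_w` corresponds to `(-1) ^ ℓ(w)` times the usual basis element, so that `τ_i` is
idempotent. -/
abbrev HeckeAlg (R : Type*) [CommRing R] : Type _ := MonoidAlgebra R Dem

open Classical in
/-- The coefficient of `τ_w`; it is `0` if `w` moves infinitely many integers. -/
def cf (w : Perm ℕ) (x : HeckeAlg R) : R := if h : FinSupp w then x.coeff ⟨w, h⟩ else 0

lemma cf_perm (w : Dem) (x : HeckeAlg R) : cf w.perm x = x.coeff w := by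
  rw [cf, dif_pos w.finSupp]

@[simp] lemma cf_add (w : Perm ℕ) (x y : HeckeAlg R) : cf w (x + y) = cf w x + cf w y := by
  unfold cf; split_ifs <;> simp

@[simp] lemma cf_sub (w : Perm ℕ) (x y : HeckeAlg R) : cf w (x - y) = cf w x - cf w y := by
  unfold cf; split_ifs <;> simp

@[simp] lemma cf_zero (w : Perm ℕ) : cf w (0 : HeckeAlg R) = 0 := by
  unfold cf; split_ifs <;> simp

@[simp] lemma cf_smul (w : Perm ℕ) (c : R) (x : HeckeAlg R) : cf w (c • x) = c * cf w x := by
  unfold cf; split_ifs <;> simp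

open Classical in
lemma cf_single (w : Perm ℕ) (v : Dem) (a : R) :
    cf w (MonoidAlgebra.single v a) = if v.perm = w then a else 0 := by
  unfold cf
  split_ifs with h h' h'
  · subst h'; simp
  · rw [MonoidAlgebra.coeff_single, Finsupp.single_eq_of_ne]
    rintro rfl; exact h' rfl
  · subst h'; exact absurd v.finSupp h
  · rfl

/-- The element `1 + (u - 1) τ_i`, that is `h_i(1 - u)` in the notation of Fomin and Kirillov. -/
def hgen (i : ℕ) (u : R) : HeckeAlg R := 1 + MonoidAlgebra.single (dgen i) (u - 1)

lemma heckeStep_gt (u : Perm ℕ) (i : ℕ) : heckeStep u i (i + 1) < heckeStep u i i := by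
  rcases lt_or_gt_of_ne (show u i ≠ u (i + 1) from fun h => by simpa using u.injective h) with h | h
  · rw [heckeStep_of_lt h]; simpa using h
  · rwa [heckeStep_of_gt h]

lemma heckeStep_eq_iff {w : Perm ℕ} {i : ℕ} (hw : w (i + 1) < w i) (v : Perm ℕ) :
    heckeStep v i = w ↔ v = w ∨ v = w * simpleRefl i := by
  constructor
  · rintro rfl
    unfold heckeStep
    split_ifs
    · right; simp [mul_assoc, simpleRefl_mul_self]
    · left; rfl
  · rintro (rfl | rfl)
    · exact heckeStep_of_gt hw
    · rw [heckeStep_of_lt (by simpa using hw), mul_assoc, simpleRefl_mul_self, mul_one]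

lemma mul_simpleRefl_ne (w : Perm ℕ) (i : ℕ) : w ≠ w * simpleRefl i := by
  intro h
  have := congrArg (fun v => v i) h
  simp at this

lemma cf_mul_hgen_of_lt {w : Perm ℕ} {i : ℕ} (hw : w i < w (i + 1)) (X : HeckeAlg R) (u : R) :
    cf w (X * hgen i u) = cf w X := by
  induction X using MonoidAlgebra.induction_linear with
  | zero => simp
  | add x y hx hy => rw [add_mul, cf_add, cf_add, hx, hy]
  | single v a =>
    rw [hgen, mul_add, mul_one, MonoidAlgebra.single_mul_single, cf_add, add_eq_left, cf_single,
      if_neg]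
    intro h
    rw [Dem.mul_dgen_perm] at h
    have := heckeStep_gt v.perm i
    rw [h] at this
    omega

lemma cf_mul_hgen_of_gt {w : Perm ℕ} {i : ℕ} (hw : w (i + 1) < w i) (X : HeckeAlg R) (u : R) :
    cf w (X * hgen i u) = u * cf w X + (u - 1) * cf (w * simpleRefl i) X := by
  induction X using MonoidAlgebra.induction_linear with
  | zero => simp
  | add x y hx hy => rw [add_mul, cf_add, cf_add, cf_add, hx, hy]; ring
  | single v a =>
    rw [hgen, mul_add, mul_one, MonoidAlgebra.single_mul_single, cf_add, cf_single, cf_single,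
      cf_single, Dem.mul_dgen_perm]
    have h2 := mul_simpleRefl_ne w i
    have h5 := heckeStep_eq_iff hw v.perm
    by_cases h3 : v.perm = w
    · rw [if_pos h3, if_pos (h5.2 (Or.inl h3)), if_neg (by rw [h3]; exact h2)]; ring
    · by_cases h4 : v.perm = w * simpleRefl i
      · rw [if_neg h3, if_pos (h5.2 (Or.inr h4)), if_pos h4]; ring
      · rw [if_neg h3, if_neg (fun h => (h5.1 h).elim h3 h4), if_neg h4]; ring

lemma cf_hgen_mul_of_lt {w : Perm ℕ} {i : ℕ} (hw : w⁻¹ i < w⁻¹ (i + 1)) (X : HeckeAlg R) (u : R) :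
    cf w (hgen i u * X) = cf w X := by
  induction X using MonoidAlgebra.induction_linear with
  | zero => simp
  | add x y hx hy => rw [mul_add, cf_add, cf_add, hx, hy]
  | single v a =>
    rw [hgen, add_mul, one_mul, MonoidAlgebra.single_mul_single, cf_add, add_eq_left, cf_single,
      if_neg]
    intro h
    rw [Dem.dgen_mul_perm, heckeStepLeft_eq] at h
    have := heckeStep_gt v.perm⁻¹ i
    rw [← h, inv_inv] at hw
    omega

lemma cf_hgen_mul_of_gt {w : Perm ℕ} {i : ℕ} (hw : w⁻¹ (i + 1) < w⁻¹ i) (X : HeckeAlg R) (u : R) :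
    cf w (hgen i u * X) = u * cf w X + (u - 1) * cf (simpleRefl i * w) X := by
  induction X using MonoidAlgebra.induction_linear with
  | zero => simp
  | add x y hx hy => rw [mul_add, cf_add, cf_add, cf_add, hx, hy]; ring
  | single v a =>
    rw [hgen, add_mul, one_mul, MonoidAlgebra.single_mul_single, cf_add, cf_single, cf_single,
      cf_single, Dem.dgen_mul_perm, heckeStepLeft_eq]
    have h2 := mul_simpleRefl_ne w⁻¹ i
    have h2' : w ≠ simpleRefl i * w := fun h => h2 (by rw [← simpleRefl_inv, ← mul_inv_rev, ← h])
    have h5 : (heckeStep v.perm⁻¹ i)⁻¹ = w ↔ v.perm = w ∨ v.perm = simpleRefl i * w := by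
      rw [inv_eq_iff_eq_inv, heckeStep_eq_iff hw, inv_inj, inv_eq_iff_eq_inv, mul_inv_rev, inv_inv,
        simpleRefl_inv]
    by_cases h3 : v.perm = w
    · rw [if_pos h3, if_pos (h5.2 (Or.inl h3)), if_neg (by rw [h3]; exact h2')]; ring
    · by_cases h4 : v.perm = simpleRefl i * w
      · rw [if_neg h3, if_pos (h5.2 (Or.inr h4)), if_pos h4]; ring
      · rw [if_neg h3, if_neg (fun h => (h5.1 h).elim h3 h4), if_neg h4]; ring

/-- The generator `τ_i`. -/
abbrev tau (R : Type*) [CommRing R] (i : ℕ) : HeckeAlg R := MonoidAlgebra.single (dgen i) 1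

lemma hgen_eq (i : ℕ) (u : R) : hgen i u = 1 + (u - 1) • tau R i := by
  rw [hgen, MonoidAlgebra.smul_single', mul_one]

lemma tau_mul_self (i : ℕ) : tau R i * tau R i = tau R i := by
  rw [MonoidAlgebra.single_mul_single, dgen_mul_self, one_mul]

@[simp] lemma hgen_one (i : ℕ) : hgen i (1 : R) = 1 := by simp [hgen_eq]

lemma hgen_mul_hgen (i : ℕ) (u v : R) : hgen i u * hgen i v = hgen i (u * v) := by
  simp only [hgen_eq, mul_add, add_mul, one_mul, mul_one, smul_mul_smul_comm, tau_mul_self]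
  module

lemma hgen_comm_self (i : ℕ) (u v : R) : hgen i u * hgen i v = hgen i v * hgen i u := by
  rw [hgen_mul_hgen, hgen_mul_hgen, mul_comm]

lemma tau_commute {i j : ℕ} (h : i + 2 ≤ j) : Commute (tau R i) (tau R j) :=
  MonoidAlgebra.single_commute_single (dgen_comm h) (Commute.all _ _)

/-- The Yang-Baxter equation. -/
lemma hgen_yangBaxter (i : ℕ) (u v : R) :
    hgen i u * hgen (i + 1) (u * v) * hgen i v =
      hgen (i + 1) v * hgen i (u * v) * hgen (i + 1) u := by
  have hb : tau R i * tau R (i + 1) * tau R i = tau R (i + 1) * tau R i * tau R (i + 1) := by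
    simp only [MonoidAlgebra.single_mul_single, dgen_braid]
  have h1 := tau_mul_self (R := R) i
  have h2 := tau_mul_self (R := R) (i + 1)
  simp only [hgen_eq]
  generalize tau R i = a at *
  generalize tau R (i + 1) = b at *
  simp only [mul_add, add_mul, one_mul, mul_one, smul_mul_smul_comm, hb, h1, h2]
  module

/-- The product of the `hgen i u` over a list of pairs `(i, u)`. -/
def hprod (l : List (ℕ × R)) : HeckeAlg R := (l.map fun x => hgen x.1 x.2).prod

@[simp] lemma hprod_nil : hprod ([] : List (ℕ × R)) = 1 := rfl

@[simp] lemma hprod_cons (x : ℕ × R) (l : List (ℕ × R)) :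
    hprod (x :: l) = hgen x.1 x.2 * hprod l := by simp [hprod]

@[simp] lemma hprod_append (l l' : List (ℕ × R)) : hprod (l ++ l') = hprod l * hprod l' := by
  simp [hprod]

/-- The product of the coefficients `u - 1` of the `τ_i` in the factors of `hprod l`. -/
def topCoeff (l : List (ℕ × R)) : R := (l.map fun x => x.2 - 1).prod

lemma cf_of_not_finSupp {w : Perm ℕ} (h : ¬ FinSupp w) (x : HeckeAlg R) : cf w x = 0 := dif_neg h

open Classical in
lemma cf_one (w : Perm ℕ) : cf w (1 : HeckeAlg R) = if w = 1 then 1 else 0 := by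
  rw [MonoidAlgebra.one_def, cf_single, Dem.one_perm]
  simp only [eq_comm]

lemma apply_lt_or_gt (w : Perm ℕ) (i : ℕ) : w i < w (i + 1) ∨ w (i + 1) < w i :=
  lt_or_gt_of_ne (fun h => by simpa using w.injective h)

lemma cf_hprod_eq_zero {w : Perm ℕ} {l : List (ℕ × R)} (h : l.length < length w) :
    cf w (hprod l) = 0 := by
  by_cases hw : FinSupp w
  swap
  · exact cf_of_not_finSupp hw _
  induction l using List.reverseRecOn generalizing w with
  | nil =>
    rw [hprod_nil, cf_one, if_neg]
    rintro rfl
    simp at h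
  | append_singleton l x ih =>
    obtain ⟨i, u⟩ := x
    simp only [List.length_append, List.length_singleton] at h
    rw [hprod_append, hprod_cons, hprod_nil, mul_one]
    have h3 := length_heckeStep_le hw i
    rcases apply_lt_or_gt w i with h1 | h1
    · rw [cf_mul_hgen_of_lt h1, ih (by omega) hw]
    · rw [cf_mul_hgen_of_gt h1, ih (by omega) hw, ih (by omega) (hw.mul (.simpleRefl i))]
      ring

open Classical in
/-- The coefficient of a permutation of maximal length in a product of generators: the product has
to use all the factors. -/
lemma cf_hprod_of_length_eq {w : Perm ℕ} (hw : FinSupp w) {l : List (ℕ × R)}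
    (h : length w = l.length) : cf w (hprod l) = if wordPerm l = w then topCoeff l else 0 := by
  induction l using List.reverseRecOn generalizing w with
  | nil => simp [cf_one, topCoeff, eq_comm]
  | append_singleton l x ih =>
    obtain ⟨i, u⟩ := x
    simp only [List.length_append, List.length_singleton] at h
    rw [hprod_append, hprod_cons, hprod_nil, mul_one, wordPerm_append, wordPerm_cons, wordPerm_nil,
      mul_one]
    have h3 := length_heckeStep_le hw i
    have h4 : wordPerm l * simpleRefl i = w ↔ wordPerm l = w * simpleRefl i := by
      rw [← simpleRefl_inv, mul_inv_eq_iff_eq_mul, simpleRefl_inv]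
    rcases apply_lt_or_gt w i with h1 | h1
    · rw [cf_mul_hgen_of_lt h1, cf_hprod_eq_zero (by omega), if_neg]
      rw [h4]
      intro h5
      have h6 := length_prod_le (l.map Prod.fst)
      have h7 : ((l.map Prod.fst).map simpleRefl).prod = wordPerm l := by
        simp [wordPerm, Function.comp_def]
      rw [h7, h5, List.length_map] at h6
      omega
    · rw [cf_mul_hgen_of_gt h1, cf_hprod_eq_zero (w := w) (by omega),
        ih (hw.mul (.simpleRefl i)) (by omega)]
      simp only [h4]
      split_ifs
      · simp [topCoeff, mul_comm]
      · simp

/-! ### Parabolic subalgebras -/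

/-- The subalgebra generated by the `τ_g` with `g ∈ G`. -/
def algSub (R : Type*) [CommRing R] (G : Set ℕ) : Subalgebra R (HeckeAlg R) :=
  Algebra.adjoin R (tau R '' G)

lemma algSub_mono {G G' : Set ℕ} (h : G ⊆ G') : algSub R G ≤ algSub R G' :=
  Algebra.adjoin_mono (Set.image_mono h)

lemma tau_mem_algSub {G : Set ℕ} {g : ℕ} (h : g ∈ G) : tau R g ∈ algSub R G :=
  Algebra.subset_adjoin ⟨g, h, rfl⟩

lemma hgen_mem_algSub {G : Set ℕ} {g : ℕ} (h : g ∈ G) (u : R) : hgen g u ∈ algSub R G := by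
  rw [hgen_eq]
  exact add_mem (one_mem _) (Subalgebra.smul_mem _ (tau_mem_algSub h) _)

lemma hprod_mem_algSub {G : Set ℕ} {l : List (ℕ × R)} (h : ∀ x ∈ l, x.1 ∈ G) :
    hprod l ∈ algSub R G := by
  induction l with
  | nil => exact one_mem _
  | cons x l ih =>
    rw [hprod_cons]
    exact mul_mem (hgen_mem_algSub (h x (by simp)) _) (ih fun y hy => h y (by simp [hy]))

/-- The support of an element of the subalgebra lies in the corresponding submonoid. -/
lemma mem_demSub_of_mem_algSub {G : Set ℕ} {X : HeckeAlg R} (hX : X ∈ algSub R G) {x : Dem}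
    (hx : X.coeff x ≠ 0) : x ∈ demSub G := by
  classical
  induction hX using Algebra.adjoin_induction generalizing x with
  | mem X hX =>
    obtain ⟨g, hg, rfl⟩ := hX
    rw [MonoidAlgebra.coeff_single, Finsupp.single_apply] at hx
    split_ifs at hx with h
    · exact h ▸ dgen_mem_demSub hg
    · exact absurd rfl hx
  | algebraMap r =>
    rw [MonoidAlgebra.coe_algebraMap, Function.comp_apply, MonoidAlgebra.coeff_single,
      Finsupp.single_apply] at hx
    split_ifs at hx with h
    · exact h ▸ one_mem _
    · exact absurd rfl hx
  | add X Y _ _ hX hY =>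
    by_cases h : X.coeff x = 0
    · exact hY (fun h' => hx (by simp [h, h']))
    · exact hX h
  | mul X Y _ _ hX hY =>
    have := MonoidAlgebra.support_coeff_mul_subset X Y (Finsupp.mem_support_iff.2 hx)
    obtain ⟨a, ha, b, hb, rfl⟩ := Finset.mem_mul.1 this
    exact mul_mem (hX (Finsupp.mem_support_iff.1 ha)) (hY (Finsupp.mem_support_iff.1 hb))

lemma commute_of_mem_algSub {G G' : Set ℕ} (h : ∀ g ∈ G, ∀ g' ∈ G', g + 2 ≤ g' ∨ g' + 2 ≤ g)
    {X Y : HeckeAlg R} (hX : X ∈ algSub R G) (hY : Y ∈ algSub R G') : Commute X Y := by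
  induction hX using Algebra.adjoin_induction with
  | mem X hX =>
    obtain ⟨g, hg, rfl⟩ := hX
    induction hY using Algebra.adjoin_induction with
    | mem Y hY =>
      obtain ⟨g', hg', rfl⟩ := hY
      rcases h g hg g' hg' with h | h
      · exact tau_commute h
      · exact (tau_commute h).symm
    | algebraMap r => exact (Algebra.commutes r _).symm
    | add X Y _ _ hX hY => exact hX.add_right hY
    | mul X Y _ _ hX hY => exact hX.mul_right hY
  | algebraMap r => exact Algebra.commutes r _
  | add X Y _ _ hX hY => exact hX.add_left hY
  | mul X Y _ _ hX hY => exact hX.mul_left hY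

/-- A coefficient of a product vanishes if it cannot be obtained from the supports. -/
lemma cf_mul_eq_zero {w : Perm ℕ} {X Y : HeckeAlg R}
    (h : ∀ x y : Dem, X.coeff x ≠ 0 → Y.coeff y ≠ 0 → (x * y).perm = w → False) :
    cf w (X * Y) = 0 := by
  classical
  by_cases hw : FinSupp w
  swap
  · exact cf_of_not_finSupp hw _
  by_contra hc
  rw [show w = (⟨w, hw⟩ : Dem).perm from rfl, cf_perm] at hc
  have := MonoidAlgebra.support_coeff_mul_subset X Y (Finsupp.mem_support_iff.2 hc)
  obtain ⟨a, ha, b, hb, e⟩ := Finset.mem_mul.1 this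
  exact h a b (Finsupp.mem_support_iff.1 ha) (Finsupp.mem_support_iff.1 hb) (congrArg Dem.perm e)

lemma exists_of_coeff_mul_ne_zero {X Y : HeckeAlg R} {w : Dem} (h : (X * Y).coeff w ≠ 0) :
    ∃ x y : Dem, X.coeff x ≠ 0 ∧ Y.coeff y ≠ 0 ∧ x * y = w := by
  classical
  have := MonoidAlgebra.support_coeff_mul_subset X Y (Finsupp.mem_support_iff.2 h)
  obtain ⟨a, ha, b, hb, e⟩ := Finset.mem_mul.1 this
  exact ⟨a, b, Finsupp.mem_support_iff.1 ha, Finsupp.mem_support_iff.1 hb, e⟩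

/-! ### Groups of products of generators -/

/-- The generator `hgen i u` as a unit, for a unit `u`. -/
def hUnit (i : ℕ) (u : Rˣ) : (HeckeAlg R)ˣ where
  val := hgen i u
  inv := hgen i (u⁻¹ : Rˣ)
  val_inv := by rw [hgen_mul_hgen, Units.mul_inv, hgen_one]
  inv_val := by rw [hgen_mul_hgen, Units.inv_mul, hgen_one]

@[simp] lemma hUnit_val (i : ℕ) (u : Rˣ) : (hUnit i u : HeckeAlg R) = hgen i (u : R) := rfl

lemma hUnit_inv (i : ℕ) (u : Rˣ) : (hUnit i u)⁻¹ = hUnit (R := R) i u⁻¹ := rfl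

/-- The group generated by the `hgen g u` with `g ∈ G` and `u` a unit. -/
def unitSub (R : Type*) [CommRing R] (G : Set ℕ) : Subgroup (HeckeAlg R)ˣ :=
  Subgroup.closure {x | ∃ g ∈ G, ∃ u : Rˣ, x = hUnit g u}

lemma hUnit_mem {G : Set ℕ} {g : ℕ} (h : g ∈ G) (u : Rˣ) : hUnit g u ∈ unitSub R G :=
  Subgroup.subset_closure ⟨g, h, u, rfl⟩

lemma unitSub_mono {G G' : Set ℕ} (h : G ⊆ G') : unitSub R G ≤ unitSub R G' :=
  Subgroup.closure_mono fun _ ⟨g, hg, u, e⟩ => ⟨g, h hg, u, e⟩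

/-- Induction on elements of `unitSub`: as the generators are closed under inversion, products of
generators suffice. -/
lemma unitSub_induction {G : Set ℕ} {p : (HeckeAlg R)ˣ → Prop} (one : p 1)
    (mul : ∀ U : (HeckeAlg R)ˣ, p U → ∀ g ∈ G, ∀ u : Rˣ, p (U * hUnit g u)) {U : (HeckeAlg R)ˣ}
    (hU : U ∈ unitSub R G) : p U := by
  induction hU using Subgroup.closure_induction_right with
  | one => exact one
  | mul_right x _ y hy ih =>
    obtain ⟨g, hg, u, rfl⟩ := hy
    exact mul _ ih g hg u
  | mul_inv_cancel x _ y hy ih =>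
    obtain ⟨g, hg, u, rfl⟩ := hy
    exact mul _ ih g hg _

lemma val_mem_algSub {G : Set ℕ} {U : (HeckeAlg R)ˣ} (hU : U ∈ unitSub R G) :
    (U : HeckeAlg R) ∈ algSub R G := by
  refine unitSub_induction (R := R) (G := G)
    (p := fun U => (U : HeckeAlg R) ∈ algSub R G) (one_mem _)
    (fun U hU g hg u => ?_) hU
  rw [Units.val_mul]
  exact mul_mem hU (hgen_mem_algSub hg _)

/-- Factors on the right made of generators at which `w` increases do not affect the coefficient
of `τ_w`. -/
lemma cf_mul_unit {w : Perm ℕ} {G : Set ℕ} (hw : ∀ g ∈ G, w g < w (g + 1)) {U : (HeckeAlg R)ˣ}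
    (hU : U ∈ unitSub R G) (X : HeckeAlg R) : cf w (X * (U : HeckeAlg R)) = cf w X := by
  refine unitSub_induction (R := R) (G := G) (p := fun U => cf w (X * (U : HeckeAlg R)) = cf w X)
    (by rw [Units.val_one, mul_one])
    (fun U hU g hg u => ?_) hU
  rw [Units.val_mul, ← mul_assoc, hUnit_val, cf_mul_hgen_of_lt (hw g hg), hU]

/-- Factors on the left made of generators at which `w⁻¹` increases do not affect the coefficient
of `τ_w`. -/
lemma cf_unit_mul {w : Perm ℕ} {G : Set ℕ} (hw : ∀ g ∈ G, w⁻¹ g < w⁻¹ (g + 1)) {U : (HeckeAlg R)ˣ}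
    (hU : U ∈ unitSub R G) (X : HeckeAlg R) : cf w ((U : HeckeAlg R) * X) = cf w X := by
  refine unitSub_induction (R := R) (G := G)
    (p := fun U => ∀ X, cf w ((U : HeckeAlg R) * X) = cf w X)
    (fun X => by rw [Units.val_one, one_mul])
    (fun U hU g hg u X => ?_) hU X
  rw [Units.val_mul, mul_assoc, hU, hUnit_val, cf_hgen_mul_of_lt (hw g hg)]

end HeckeAlgebra

/-! ### Longest elements and embeddings -/

lemma embed_of_lt {m : ℕ} (w : Perm (Fin m)) {p : ℕ} (hp : p < m) :
    embed w p = w ⟨p, hp⟩ :=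
  Perm.extendDomain_apply_subtype w Fin.equivSubtype (b := p) hp

lemma embed_of_ge {m : ℕ} (w : Perm (Fin m)) {p : ℕ} (hp : m ≤ p) : embed w p = p :=
  Perm.extendDomain_apply_not_subtype w Fin.equivSubtype (by simpa using hp)

lemma embed_injective {m : ℕ} : Function.Injective (embed : Perm (Fin m) → Perm ℕ) := by
  intro u v h
  ext p
  have := congrArg (fun w => w (p : ℕ)) h
  simpa [embed_of_lt _ p.2] using this

lemma exists_embed_eq {m : ℕ} {w : Perm ℕ} (hw : ∀ p, m ≤ p → w p = p) :
    ∃ v : Perm (Fin m), embed v = w := by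
  have h : ∀ p, p < m ↔ w p < m := by
    intro p
    constructor
    · intro hp
      by_contra hc
      have := w.injective (hw (w p) (by omega))
      omega
    · intro hp
      by_contra hc
      rw [hw p (by omega)] at hp
      omega
  refine ⟨Fin.equivSubtype.permCongr.symm (w.subtypePerm (p := (· < m)) fun p => (h p).symm), ?_⟩
  ext p
  by_cases hp : p < m
  · rw [embed_of_lt _ hp]
    simp [Equiv.permCongr, Equiv.equivCongr]
  · rw [embed_of_ge _ (by omega), hw p (by omega)]

lemma longest_apply (N p : ℕ) : longest N p = if p < N then N - 1 - p else p := by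
  unfold longest
  split_ifs with h
  · rw [embed_of_lt _ h]
    simp [Fin.val_rev]
    omega
  · exact embed_of_ge _ (by omega)

lemma longest_mul_self (N : ℕ) : longest N * longest N = 1 := by
  ext p
  simp only [Perm.mul_apply, longest_apply, Perm.one_apply]
  split_ifs <;> omega

@[simp] lemma longest_inv (N : ℕ) : (longest N)⁻¹ = longest N :=
  inv_eq_of_mul_eq_one_left (longest_mul_self N)

lemma finSupp_longest (N : ℕ) : FinSupp (longest N) :=
  ⟨N, fun p hp => by rw [longest_apply, if_neg (by omega)]⟩

lemma length_longest (N : ℕ) : length (longest N) = ∑ k ∈ Finset.range N, k := by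
  have : inversions (longest N) =
      ((Finset.range N ×ˢ Finset.range N).filter fun x => x.1 < x.2 : Finset (ℕ × ℕ)) := by
    ext ⟨p, q⟩
    simp only [inversions, longest_apply, Set.mem_ofPred_eq, Finset.coe_filter, Finset.mem_product,
      Finset.mem_range]
    split_ifs <;> omega
  rw [length, this, Set.ncard_coe_finset, Finset.card_filter, Finset.sum_product_right]
  refine Finset.sum_congr rfl fun q hq => ?_
  rw [← Finset.card_filter]
  have : (Finset.range N).filter (fun x => x < q) = Finset.range q := by
    ext x
    simp only [Finset.mem_filter, Finset.mem_range] at *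
    omega
  rw [this, Finset.card_range]

section

variable {R : Type*} [CommRing R]

/-! ### Row and column products -/

/-- The product `h_{k-1} ⋯ h_1 h_0`, all with parameter `x`. -/
def descProd : ℕ → R → HeckeAlg R
  | 0, _ => 1
  | k + 1, x => hgen k x * descProd k x

/-- The product `h_0 h_1 ⋯ h_{k-1}`, all with parameter `y`. -/
def ascProd : ℕ → R → HeckeAlg R
  | 0, _ => 1
  | k + 1, y => ascProd k y * hgen k y

lemma descProd_mem (k : ℕ) (x : R) : descProd k x ∈ algSub R {g | g < k} := by
  induction k with
  | zero => exact one_mem _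
  | succ k ih =>
    exact mul_mem (hgen_mem_algSub (by simp) _) (algSub_mono (fun g hg => by simp at *; omega) ih)

lemma ascProd_mem (k : ℕ) (x : R) : ascProd k x ∈ algSub R {g | g < k} := by
  induction k with
  | zero => exact one_mem _
  | succ k ih =>
    exact mul_mem (algSub_mono (fun g hg => by simp at *; omega) ih) (hgen_mem_algSub (by simp) _)

lemma hgen_commute {G : Set ℕ} {g : ℕ} (u : R) {X : HeckeAlg R} (hX : X ∈ algSub R G)
    (h : ∀ g' ∈ G, g + 2 ≤ g' ∨ g' + 2 ≤ g) : Commute (hgen g u) X :=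
  commute_of_mem_algSub (G := {g}) (by rintro _ rfl; exact h)
    (hgen_mem_algSub (Set.mem_singleton g) u) hX

/-- Descending and ascending products commute, by the Yang-Baxter equation. -/
lemma descProd_mul_ascProd (k : ℕ) (x y : R) :
    descProd k x * ascProd k y = ascProd k y * descProd k x := by
  induction k with
  | zero => rfl
  | succ k ih =>
    cases k with
    | zero => simpa [descProd, ascProd] using hgen_comm_self 0 x y
    | succ k =>
      have c1 : hgen (k + 1) x * ascProd k y = ascProd k y * hgen (k + 1) x :=
        hgen_commute x (ascProd_mem k y) (fun g hg => by simp at hg; omega)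
      have c2 : hgen (k + 1) y * descProd k x = descProd k x * hgen (k + 1) y :=
        hgen_commute y (descProd_mem k x) (fun g hg => by simp at hg; omega)
      calc descProd (k + 2) x * ascProd (k + 2) y
          = hgen (k + 1) x * (descProd (k + 1) x * ascProd (k + 1) y) * hgen (k + 1) y := by
            simp only [descProd, ascProd, mul_assoc]
        _ = (hgen (k + 1) x * ascProd k y) * (hgen k y * hgen k x) *
              (descProd k x * hgen (k + 1) y) := by
            rw [ih]; simp only [descProd, ascProd, mul_assoc]
        _ = ascProd k y * (hgen (k + 1) x * hgen k (y * x) * hgen (k + 1) y) * descProd k x := by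
            rw [c1, ← c2, hgen_mul_hgen]; simp only [mul_assoc]
        _ = ascProd k y * (hgen k y * hgen (k + 1) (y * x) * hgen k x) * descProd k x := by
            rw [hgen_yangBaxter]
        _ = ascProd (k + 2) y * descProd (k + 2) x := by
            rw [← hgen_mul_hgen]; simp only [descProd, ascProd, mul_assoc]

@[simp] lemma descProd_one (k : ℕ) : descProd k (1 : R) = 1 := by
  induction k with
  | zero => rfl
  | succ k ih => simp [descProd, ih]

@[simp] lemma ascProd_one (k : ℕ) : ascProd k (1 : R) = 1 := by
  induction k with
  | zero => rfl
  | succ k ih => simp [ascProd, ih]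

lemma ascProd_mul_descProd_inv (k : ℕ) (u : Rˣ) :
    ascProd k ((u⁻¹ : Rˣ) : R) * descProd k (u : R) = 1 := by
  induction k with
  | zero => simp [ascProd, descProd]
  | succ k ih =>
    rw [ascProd, descProd, mul_assoc, ← mul_assoc (hgen k _) (hgen k _), hgen_mul_hgen,
      Units.inv_mul, hgen_one, one_mul, ih]

/-- `descProd k u` as a unit. -/
def descUnit (k : ℕ) (u : Rˣ) : (HeckeAlg R)ˣ where
  val := descProd k (u : R)
  inv := ascProd k ((u⁻¹ : Rˣ) : R)
  val_inv := by rw [descProd_mul_ascProd, ascProd_mul_descProd_inv]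
  inv_val := ascProd_mul_descProd_inv k u

@[simp] lemma descUnit_val (k : ℕ) (u : Rˣ) :
    (descUnit k u : HeckeAlg R) = descProd k (u : R) := rfl

lemma descUnit_inv_val (k : ℕ) (u : Rˣ) :
    ((descUnit k u)⁻¹ : (HeckeAlg R)ˣ) = ascProd k ((u⁻¹ : Rˣ) : R) := rfl

lemma descUnit_succ (k : ℕ) (u : Rˣ) : descUnit (k + 1) u = hUnit k u * descUnit k u :=
  Units.ext rfl

lemma descUnit_mem (k : ℕ) (u : Rˣ) : descUnit k u ∈ unitSub R {g | g < k} := by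
  induction k with
  | zero =>
    have : descUnit 0 u = 1 := Units.ext rfl
    rw [this]; exact one_mem _
  | succ k ih =>
    rw [descUnit_succ]
    exact mul_mem (hUnit_mem (by simp) _) (unitSub_mono (fun g hg => by simp at *; omega) ih)

/-- Over the field of fractions `u` is a unit, and the inverse of `descProd k u` is an ascending
product. -/
lemma descProd_commute_of_unit (k : ℕ) (u : Rˣ) (v : R) :
    Commute (descProd k (u : R)) (descProd k v) := by
  have : Commute ((descUnit k u)⁻¹ : (HeckeAlg R)ˣ).val (descProd k v) :=
    (descProd_mul_ascProd k v _).symm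
  simpa using this.units_inv_left

lemma descUnit_commute (k : ℕ) (u v : Rˣ) : Commute (descUnit k u) (descUnit k v) :=
  Units.ext (descProd_commute_of_unit k u v)

/-- Extension of scalars. -/
def mapHecke {S : Type*} [CommRing S] (f : R →+* S) : HeckeAlg R →+* HeckeAlg S :=
  MonoidAlgebra.mapRingHom Dem f

@[simp] lemma mapHecke_hgen {S : Type*} [CommRing S] (f : R →+* S) (i : ℕ) (u : R) :
    mapHecke f (hgen i u) = hgen i (f u) := by
  simp [mapHecke, hgen]

@[simp] lemma mapHecke_descProd {S : Type*} [CommRing S] (f : R →+* S) (k : ℕ) (u : R) :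
    mapHecke f (descProd k u) = descProd k (f u) := by
  induction k with
  | zero => simp [descProd]
  | succ k ih => simp [descProd, ih]

@[simp] lemma mapHecke_ascProd {S : Type*} [CommRing S] (f : R →+* S) (k : ℕ) (u : R) :
    mapHecke f (ascProd k u) = ascProd k (f u) := by
  induction k with
  | zero => simp [ascProd]
  | succ k ih => simp [ascProd, ih]

lemma cf_mapHecke {S : Type*} [CommRing S] (f : R →+* S) (w : Perm ℕ) (x : HeckeAlg R) :
    cf w (mapHecke f x) = f (cf w x) := by
  unfold cf
  split_ifs
  · simp [mapHecke]
  · simp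

lemma descProd_commute [IsDomain R] (k : ℕ) {u : R} (hu : u ≠ 0) (v : R) :
    descProd k u * descProd k v = descProd k v * descProd k u := by
  have hinj : Function.Injective (mapHecke (algebraMap R (FractionRing R))) := by
    intro x y h
    have h2 : ∀ w : Dem,
        algebraMap R (FractionRing R) (x.coeff w) = algebraMap R _ (y.coeff w) := by
      intro w
      rw [← cf_perm, ← cf_perm, ← cf_mapHecke, ← cf_mapHecke, h]
    ext w
    exact IsFractionRing.injective R (FractionRing R) (h2 w)
  apply hinj
  have hu' : algebraMap R (FractionRing R) u ≠ 0 := by simpa using hu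
  simp only [map_mul, mapHecke_descProd]
  exact descProd_commute_of_unit k (Units.mk0 _ hu') _

/-! ### Staircase products -/

/-- The product `∏_{k < N} descProd k (f k)`. -/
def descStair (f : ℕ → R) : ℕ → HeckeAlg R
  | 0 => 1
  | k + 1 => descStair f k * descProd k (f k)

/-- The product of the `ascProd k (g k)`, `k < N`, with decreasing `k`. -/
def ascStair (g : ℕ → R) : ℕ → HeckeAlg R
  | 0 => 1
  | k + 1 => ascProd k (g k) * ascStair g k

lemma descStair_mem (f : ℕ → R) (N : ℕ) : descStair f N ∈ algSub R {g | g + 1 < N} := by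
  induction N with
  | zero => exact one_mem _
  | succ k ih =>
    exact mul_mem (algSub_mono (fun g hg => by simp at *; omega) ih)
      (algSub_mono (fun g hg => by simp at *; omega) (descProd_mem k _))

lemma ascStair_mem (f : ℕ → R) (N : ℕ) : ascStair f N ∈ algSub R {g | g + 1 < N} := by
  induction N with
  | zero => exact one_mem _
  | succ k ih =>
    exact mul_mem (algSub_mono (fun g hg => by simp at *; omega) (ascProd_mem k _))
      (algSub_mono (fun g hg => by simp at *; omega) ih)

lemma descStair_congr {f f' : ℕ → R} {N : ℕ} (h : ∀ k < N, f k = f' k) :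
    descStair f N = descStair f' N := by
  induction N with
  | zero => rfl
  | succ N ih => rw [descStair, descStair, ih (fun k hk => h k (by omega)), h N (by omega)]

lemma ascStair_congr {f f' : ℕ → R} {N : ℕ} (h : ∀ k < N, f k = f' k) :
    ascStair f N = ascStair f' N := by
  induction N with
  | zero => rfl
  | succ N ih => rw [ascStair, ascStair, ih (fun k hk => h k (by omega)), h N (by omega)]

/-- Exchanging two adjacent parameters of a staircase product. -/
lemma hgen_mul_descStair {f : ℕ → R} {k N : ℕ} (hk : k + 1 < N)
    (hc : descProd (k + 1) (f k) * descProd (k + 1) (f (k + 1)) =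
      descProd (k + 1) (f (k + 1)) * descProd (k + 1) (f k)) :
    hgen k (f k) * descStair f N =
      hgen k (f (k + 1)) * descStair (fun p => f (simpleRefl k p)) N := by
  induction N with
  | zero => omega
  | succ N ih =>
    rcases Nat.lt_or_ge (k + 1) N with h | h
    · rw [descStair, descStair, ← mul_assoc, ih h, ← mul_assoc, simpleRefl_of_gt h]
    · obtain rfl : N = k + 1 := by omega
      have c : ∀ u : R, ∀ f' : ℕ → R, hgen k u * descStair f' k = descStair f' k * hgen k u :=
        fun u f' => hgen_commute u (descStair_mem f' k) (fun g hg => by simp at hg; omega)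
      have e : descStair (fun p => f (simpleRefl k p)) k = descStair f k :=
        descStair_congr fun p hp => by rw [simpleRefl_of_lt hp]
      calc hgen k (f k) * descStair f (k + 2)
          = descStair f k * (descProd (k + 1) (f k) * descProd (k + 1) (f (k + 1))) := by
            rw [descStair, descStair, ← mul_assoc, ← mul_assoc, c]; simp only [descProd, mul_assoc]
        _ = descStair f k * (descProd (k + 1) (f (k + 1)) * descProd (k + 1) (f k)) := by rw [hc]
        _ = hgen k (f (k + 1)) * descStair (fun p => f (simpleRefl k p)) (k + 2) := by
            rw [descStair, descStair, e, simpleRefl_right, simpleRefl_left, ← mul_assoc (hgen k _),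
              ← mul_assoc (hgen k _), c]
            simp only [descProd, mul_assoc]

/-- The word of one row of a staircase. -/
def stairRow (x : R) (g : ℕ → R) : ℕ → List (ℕ × R)
  | 0 => []
  | k + 1 => (k, x * g (k + 1)) :: stairRow x g k

/-- The word of the staircase of the double Grothendieck polynomials. -/
def stairWord (f : ℕ → R) : (ℕ → R) → ℕ → List (ℕ × R)
  | _, 0 => []
  | g, k + 1 => stairWord f (fun i => g (i + 1)) k ++ stairRow (f k) g k

/-- Moving a descending row through an ascending staircase shifts the parameters of the
staircase. -/
lemma descProd_mul_ascStair (x : R) (g : ℕ → R) (k : ℕ) :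
    descProd k x * ascStair g (k + 1) =
      ascStair (fun i => g (i + 1)) k * hprod (stairRow x g k) := by
  induction k with
  | zero => simp [descProd, ascStair, ascProd, stairRow]
  | succ k ih =>
    have c : hgen k (x * g (k + 1)) * ascStair (fun i => g (i + 1)) k =
        ascStair (fun i => g (i + 1)) k * hgen k (x * g (k + 1)) :=
      hgen_commute _ (ascStair_mem _ k) (fun g hg => by simp at hg; omega)
    calc descProd (k + 1) x * ascStair g (k + 2)
        = descProd (k + 1) x * ascProd (k + 1) (g (k + 1)) * ascStair g (k + 1) := by
          rw [mul_assoc]; rfl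
      _ = ascProd k (g (k + 1)) * (hgen k (g (k + 1)) * hgen k x) *
            (descProd k x * ascStair g (k + 1)) := by
          rw [descProd_mul_ascProd]; simp only [ascProd, descProd, mul_assoc]
      _ = ascProd k (g (k + 1)) * (hgen k (x * g (k + 1)) * ascStair (fun i => g (i + 1)) k) *
            hprod (stairRow x g k) := by
          rw [ih, hgen_mul_hgen, mul_comm x]; simp only [mul_assoc]
      _ = _ := by
          rw [c]; simp only [ascStair, stairRow, hprod_cons, mul_assoc]

/-- The double staircase: `∏_{p + q ≤ N}`, one generator for each cell. -/
lemma descStair_mul_ascStair (f g : ℕ → R) (N : ℕ) :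
    descStair f N * ascStair g N = hprod (stairWord f g N) := by
  induction N generalizing g with
  | zero => simp [descStair, ascStair, stairWord]
  | succ k ih =>
    rw [descStair, mul_assoc, descProd_mul_ascStair, ← mul_assoc, ih, stairWord, hprod_append]

lemma length_stairRow (x : R) (g : ℕ → R) (k : ℕ) : (stairRow x g k).length = k := by
  induction k with
  | zero => rfl
  | succ k ih => simp [stairRow, ih]

lemma length_stairWord (f g : ℕ → R) (N : ℕ) :
    (stairWord f g N).length = ∑ k ∈ Finset.range N, k := by
  induction N generalizing g with
  | zero => rfl
  | succ k ih => rw [stairWord, List.length_append, ih, length_stairRow, Finset.sum_range_succ]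

lemma wordPerm_stairRow (x : R) (g : ℕ → R) (k p : ℕ) :
    wordPerm (stairRow x g k) p = if p = 0 then k else if p ≤ k then p - 1 else p := by
  induction k with
  | zero => rw [stairRow, wordPerm_nil, Perm.one_apply]; split_ifs <;> omega
  | succ k ih =>
    rw [stairRow, wordPerm_cons, Perm.mul_apply, ih, simpleRefl_apply]
    split_ifs <;> omega

lemma wordPerm_stairWord (f g : ℕ → R) (N : ℕ) : wordPerm (stairWord f g N) = longest N := by
  induction N generalizing g with
  | zero => ext p; simp [stairWord, longest_apply]
  | succ k ih =>
    ext p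
    rw [stairWord, wordPerm_append, ih, Perm.mul_apply, wordPerm_stairRow, longest_apply,
      longest_apply]
    split_ifs <;> omega

lemma prod_stairRow (x : R) (g : ℕ → R) (k : ℕ) :
    ((stairRow x g k).map fun y => 1 - y.2).prod = ∏ i ∈ Finset.range k, (1 - x * g (i + 1)) := by
  induction k with
  | zero => rfl
  | succ k ih => rw [stairRow, List.map_cons, List.prod_cons, ih, Finset.prod_range_succ, mul_comm]

lemma prod_stairWord (α β : ℕ → R) (N : ℕ) :
    ((stairWord (fun k => α (N - 1 - k)) (fun k => β (N - 1 - k)) N).map fun y => 1 - y.2).prod =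
      ∏ x ∈ (Finset.range N ×ˢ Finset.range N).filter (fun x => (x.1 + 1) + (x.2 + 1) ≤ N),
        (1 - β x.1 * α x.2) := by
  have h : ∀ N (α : ℕ → R) (f g : ℕ → R), (∀ k < N, f k = α (N - 1 - k)) →
      (∀ k < N, g k = β (N - 1 - k)) →
      ((stairWord f g N).map fun y => 1 - y.2).prod =
        ∏ q ∈ Finset.range N, ∏ p ∈ Finset.range (N - 1 - q), (1 - β p * α q) := by
    intro N
    induction N with
    | zero => intros; rfl
    | succ k ih =>
      intro α f g hf hg
      rw [stairWord, List.map_append, List.prod_append, prod_stairRow,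
        ih (fun q => α (q + 1)) f (fun i => g (i + 1)), Finset.prod_range_succ']
      · congr 1
        · refine Finset.prod_congr rfl fun q hq => ?_
          rw [show k + 1 - 1 - (q + 1) = k - 1 - q by omega]
        · rw [hf k (by omega), show k + 1 - 1 - k = 0 by omega, show k + 1 - 1 - 0 = k by omega,
            ← Finset.prod_range_reflect]
          refine Finset.prod_congr rfl fun i hi => ?_
          simp only [Finset.mem_range] at hi
          rw [hg _ (by omega), mul_comm]
          congr 3
          omega
      · intro i hi
        rw [hf i (by omega)]; congr 1; omega
      · intro i hi
        rw [hg _ (by omega)]; congr 1; omega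
  rw [h N α _ _ (fun _ _ => rfl) (fun _ _ => rfl), Finset.prod_filter, Finset.prod_product_right]
  refine Finset.prod_congr rfl fun q hq => ?_
  rw [← Finset.prod_filter]
  refine Finset.prod_congr ?_ fun _ _ => rfl
  ext p
  simp only [Finset.mem_filter, Finset.mem_range] at *
  omega

lemma topCoeff_eq (l : List (ℕ × R)) :
    topCoeff l = (-1) ^ l.length * (l.map fun y => 1 - y.2).prod := by
  induction l with
  | nil => simp [topCoeff]
  | cons x l ih =>
    rw [topCoeff, List.map_cons, List.prod_cons, ← topCoeff, ih, List.map_cons, List.prod_cons,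
      List.length_cons, pow_succ]
    ring

end

/-! ### Grothendieck polynomials as coefficients in the Hecke algebra -/

/-- The permutation `w_0 w⁻¹ w_0`, with `w_0` the longest element of `S_N`. -/
def hat (N : ℕ) (w : Perm ℕ) : Perm ℕ := longest N * w⁻¹ * longest N

/-- The sign `(-1) ^ ℓ(w)`. -/
def sgn (w : Perm ℕ) : ℤ := (-1) ^ length w

lemma sgn_mul_self (w : Perm ℕ) : sgn w * sgn w = 1 := by
  rw [sgn, ← mul_pow]; simp

lemma sgn_mul_simpleRefl {w : Perm ℕ} (hw : FinSupp w) (i : ℕ) :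
    sgn (w * simpleRefl i) = - sgn w := by
  unfold sgn
  rcases length_heckeStep_le hw i with ⟨h, _⟩ | ⟨h, _⟩
  · rw [← h, pow_succ]; ring
  · rw [h, pow_succ]; ring

lemma hat_inv_apply (N : ℕ) (w : Perm ℕ) (p : ℕ) :
    (hat N w)⁻¹ p = longest N (w (longest N p)) := by
  simp only [hat, mul_inv_rev, longest_inv, inv_inv, Perm.mul_apply]

lemma hat_hat (N : ℕ) (w : Perm ℕ) : hat N (hat N w) = w := by
  have : ∀ u : Perm ℕ, longest N * (longest N * u) = u := fun u => by
    rw [← mul_assoc, longest_mul_self, one_mul]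
  simp only [hat, mul_inv_rev, longest_inv, inv_inv, mul_assoc, this, longest_mul_self, mul_one]

lemma hat_mul_simpleRefl {N i : ℕ} (hi : i + 1 < N) (w : Perm ℕ) :
    hat N (w * simpleRefl i) = simpleRefl (N - 2 - i) * hat N w := by
  have h : longest N * simpleRefl i = simpleRefl (N - 2 - i) * longest N := by
    ext p
    simp only [Perm.mul_apply, longest_apply, simpleRefl_apply]
    split_ifs <;> omega
  rw [hat, hat, mul_inv_rev, simpleRefl_inv, ← mul_assoc, h]
  simp only [mul_assoc]

lemma perm_lt {N : ℕ} {w : Perm ℕ} (hw : ∀ p, N ≤ p → w p = p) {p : ℕ} (hp : p < N) : w p < N := by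
  by_contra hc
  have := w.injective (hw (w p) (by omega))
  omega

lemma hat_asc_iff {N i : ℕ} {w : Perm ℕ} (hw : ∀ p, N ≤ p → w p = p) (hi : i + 1 < N) :
    (hat N w)⁻¹ (N - 2 - i) < (hat N w)⁻¹ (N - 2 - i + 1) ↔ w i < w (i + 1) := by
  have h1 := perm_lt hw (p := i) (by omega)
  have h2 := perm_lt hw hi
  rw [hat_inv_apply, hat_inv_apply, longest_apply N (N - 2 - i), longest_apply N (N - 2 - i + 1),
    if_pos (by omega), if_pos (by omega), show N - 1 - (N - 2 - i) = i + 1 by omega,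
    show N - 1 - (N - 2 - i + 1) = i by omega, longest_apply, longest_apply, if_pos h1, if_pos h2]
  omega

lemma finSupp_of_fix {N : ℕ} {w : Perm ℕ} (hw : ∀ p, N ≤ p → w p = p) : FinSupp w := ⟨N, hw⟩

lemma fix_mul_simpleRefl {N i : ℕ} {w : Perm ℕ} (hw : ∀ p, N ≤ p → w p = p) (hi : i + 1 < N) :
    ∀ p, N ≤ p → (w * simpleRefl i) p = p := fun p hp => by
  rw [Perm.mul_apply, simpleRefl_of_gt (by omega), hw p hp]

/-- The recursion for the coefficients of staircase products. -/
lemma cf_descStair_recursion {R : Type*} [CommRing R] [IsDomain R] {f : ℕ → R} (T : HeckeAlg R)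
    {k N : ℕ} (hk : k + 1 < N) (hf : f k ≠ 0) {v : Perm ℕ} (hv : v⁻¹ k < v⁻¹ (k + 1)) :
    (f k - f (k + 1)) * cf v (descStair f N * T) =
      f (k + 1) * cf (simpleRefl k * v) (descStair (fun p => f (simpleRefl k p)) N * T) -
        f k * cf (simpleRefl k * v) (descStair f N * T) := by
  have h := congrArg (· * T) (hgen_mul_descStair hk (descProd_commute (k + 1) hf (f (k + 1))))
  simp only [mul_assoc] at h
  have h1 := congrArg (cf v) h
  rw [cf_hgen_mul_of_lt hv, cf_hgen_mul_of_lt hv] at h1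
  have h2 := congrArg (cf (simpleRefl k * v)) h
  have hv' : (simpleRefl k * v)⁻¹ (k + 1) < (simpleRefl k * v)⁻¹ k := by
    simp only [mul_inv_rev, Perm.mul_apply, simpleRefl_inv, simpleRefl_left, simpleRefl_right]
    exact hv
  rw [cf_hgen_mul_of_gt hv', cf_hgen_mul_of_gt hv', ← mul_assoc, simpleRefl_mul_self,
    one_mul] at h2
  linear_combination (1 - f (k + 1)) * h1 + h2

lemma eq_longest_of_ascents_eq_empty {N : ℕ} {w : Perm ℕ} (hw : ∀ p, N ≤ p → w p = p)
    (h : ¬ (ascents N w).Nonempty) : w = longest N := by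
  have hd : ∀ i, i + 1 < N → w (i + 1) < w i := by
    intro i hi
    by_contra hc
    have := (apply_lt_or_gt w i).resolve_right hc
    exact h ⟨i, by simp only [ascents, Finset.mem_filter, Finset.mem_range]; omega⟩
  have h1 : ∀ i, i < N → w i + i < N := by
    intro i
    induction i with
    | zero => intro h0; simpa using perm_lt hw h0
    | succ i ih => intro hi; have := hd i hi; have := ih (by omega); omega
  have h2 : ∀ j, j < N → j ≤ w (N - 1 - j) := by
    intro j
    induction j with
    | zero => intro; omega
    | succ j ih =>
      intro hj
      have := hd (N - 1 - (j + 1)) (by omega)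
      rw [show N - 1 - (j + 1) + 1 = N - 1 - j by omega] at this
      have := ih (by omega)
      omega
  ext p
  rw [longest_apply]
  split_ifs with hp
  · have a := h1 p hp
    have b := h2 (N - 1 - p) (by omega)
    rw [show N - 1 - (N - 1 - p) = p by omega] at b
    omega
  · exact hw p (by omega)

lemma aInv_injective : Function.Injective aInv := fun i j h => by
  simpa using MvPolynomial.X_injective h

/-- The Hecke algebra element whose coefficients are, up to sign, the double Grothendieck
polynomials of `S_N`, for values `α k` of `a_{k+1}⁻¹` and `β k` of `b_{k+1}`. -/
def grothElt {R : Type*} [CommRing R] (N : ℕ) (α β : ℕ → R) : HeckeAlg R :=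
  descStair (fun k => α (N - 1 - k)) N * ascStair (fun k => β (N - 1 - k)) N

lemma mapHecke_descStair {R S : Type*} [CommRing R] [CommRing S] (φ : R →+* S) (f : ℕ → R) (N : ℕ) :
    mapHecke φ (descStair f N) = descStair (fun k => φ (f k)) N := by
  induction N with
  | zero => simp [descStair]
  | succ N ih => simp [descStair, ih]

lemma mapHecke_ascStair {R S : Type*} [CommRing R] [CommRing S] (φ : R →+* S) (f : ℕ → R) (N : ℕ) :
    mapHecke φ (ascStair f N) = ascStair (fun k => φ (f k)) N := by
  induction N with
  | zero => simp [ascStair]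
  | succ N ih => simp [ascStair, ih]

lemma mapHecke_grothElt {R S : Type*} [CommRing R] [CommRing S] (φ : R →+* S) (N : ℕ)
    (α β : ℕ → R) :
    mapHecke φ (grothElt N α β) = grothElt N (fun k => φ (α k)) (fun k => φ (β k)) := by
  rw [grothElt, map_mul, mapHecke_descStair, mapHecke_ascStair, grothElt]

/-- Both sides satisfy the same recursion, and they agree at the longest element. -/
lemma groth_eq_cf {N : ℕ} {w : Perm ℕ} (hw : ∀ p, N ≤ p → w p = p) :
    groth N w = (sgn w : GPoly) * cf (hat N w) (grothElt N aInv bVar) := by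
  induction h : numNonInv N w using Nat.strong_induction_on generalizing w with
  | _ c ih =>
    by_cases hne : (ascents N w).Nonempty
    · rw [groth, dif_pos hne]
      set i := (ascents N w).min' hne with hi
      have hmem : i ∈ ascents N w := Finset.min'_mem _ hne
      have hi2 : i + 1 < N ∧ w i < w (i + 1) := (Finset.mem_filter.1 hmem).2
      have IH := ih _ (h ▸ numNonInv_lt hmem) (fix_mul_simpleRefl hw hi2.1) rfl
      have hne0 : aInv (i + 1) - aInv i ≠ 0 := by
        rw [sub_ne_zero]
        exact fun h => by simpa using aInv_injective h
      apply mul_left_cancel₀ hne0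
      rw [demazure_spec, IH, hat_mul_simpleRefl hi2.1, sgn_mul_simpleRefl (finSupp_of_fix hw)]
      -- rows are numbered from the other end, so `i` corresponds to `N - 2 - i`
      have hrec := cf_descStair_recursion (f := fun k => aInv (N - 1 - k))
        (ascStair (fun k => bVar (N - 1 - k)) N) (k := N - 2 - i) (N := N) (by omega)
        (MvPolynomial.X_ne_zero _) ((hat_asc_iff hw hi2.1).2 hi2.2)
      rw [show N - 1 - (N - 2 - i) = i + 1 by omega,
        show N - 1 - (N - 2 - i + 1) = i by omega] at hrec
      have hswap : swapA i (cf (simpleRefl (N - 2 - i) * hat N w) (grothElt N aInv bVar)) =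
          cf (simpleRefl (N - 2 - i) * hat N w)
            (descStair (fun p => aInv (N - 1 - simpleRefl (N - 2 - i) p)) N *
              ascStair (fun k => bVar (N - 1 - k)) N) := by
        have e1 := cf_mapHecke (swapA i).toRingHom (simpleRefl (N - 2 - i) * hat N w)
          (grothElt N aInv bVar)
        have e2 : ∀ x, (swapA i).toRingHom x = swapA i x := fun _ => rfl
        rw [e2] at e1
        rw [← e1, mapHecke_grothElt, grothElt]
        congr 2
        · refine descStair_congr fun p hp => ?_
          rw [e2, swapA, aInv, MvPolynomial.rename_X, Sum.map_inl, aInv]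
          congr 2
          simp only [simpleRefl_apply]
          split_ifs <;> omega
        · refine ascStair_congr fun p hp => ?_
          rw [e2, swapA, bVar, MvPolynomial.rename_X, Sum.map_inr]
          rfl
      rw [map_mul, hswap]
      have hint : ∀ z : ℤ, swapA i ((z : ℤ) : GPoly) = z := fun z => map_intCast (swapA i) z
      rw [hint]
      push_cast
      rw [grothElt]
      linear_combination (-(sgn w : GPoly)) * hrec
    -- the staircase word of the longest element is reduced, which leaves only its top coefficient
    · rw [groth, dif_neg hne]
      obtain rfl := eq_longest_of_ascents_eq_empty hw hne
      have e : hat N (longest N) = longest N := by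
        rw [hat, longest_inv, longest_mul_self, one_mul]
      have hlen := length_stairWord (fun k => aInv (N - 1 - k)) (fun k => bVar (N - 1 - k)) N
      rw [e, grothElt, descStair_mul_ascStair, cf_hprod_of_length_eq (finSupp_longest N)
        (by rw [hlen, length_longest]), if_pos (wordPerm_stairWord _ _ _), topCoeff_eq, hlen,
        prod_stairWord, sgn, length_longest, ← mul_assoc]
      push_cast
      rw [← mul_pow]
      simp

variable {K : Type*} [Field K]

/-- Double Grothendieck polynomials as coefficients of a double staircase product. -/
lemma grothEval_eq {N : ℕ} {w : Perm ℕ} (hw : ∀ p, N ≤ p → w p = p) (a b : List K) :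
    grothEval N w a b = sgn w * cf (hat N w)
      (grothElt N (fun k => (a.getD k 1)⁻¹) (fun k => b.getD k 1)) := by
  set φ : GPoly →ₐ[ℤ] K :=
    MvPolynomial.aeval (Sum.elim (fun i => (a.getD i 1)⁻¹) (fun i => b.getD i 1)) with hφ
  have e := cf_mapHecke (φ : GPoly →+* K) (hat N w) (grothElt N aInv bVar)
  rw [mapHecke_grothElt] at e
  have h1 : ∀ k, (φ : GPoly →+* K) (aInv k) = (a.getD k 1)⁻¹ := fun k => by
    simp [hφ, aInv]
  have h2 : ∀ k, (φ : GPoly →+* K) (bVar k) = b.getD k 1 := fun k => by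
    simp [hφ, bVar]
  simp only [h1, h2] at e
  rw [grothEval, ← hφ, groth_eq_cf hw, map_mul, map_intCast, e]
  rfl

/-! ### The flip anti-automorphism -/

section

variable {R : Type*}

/-- The word read backwards, with the generators of `S_k` numbered from the other end. -/
def flipWord (k : ℕ) (l : List (ℕ × R)) : List (ℕ × R) :=
  (l.map fun x => (k - 2 - x.1, x.2)).reverse

/-- The word of `descProd`. -/
def descWord (n : ℕ) (x : R) : List (ℕ × R) := (List.range n).reverse.map fun i => (i, x)

/-- The word of `ascProd`. -/
def ascWord (n : ℕ) (x : R) : List (ℕ × R) := (List.range n).map fun i => (i, x)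

lemma map_sub_range (n : ℕ) : (List.range n).map (fun i => n - 1 - i) = (List.range n).reverse := by
  apply List.ext_getElem
  · simp
  · intro i h1 h2
    simp

lemma flipWord_descWord (k : ℕ) (x : R) : flipWord k (descWord (k - 1) x) = descWord (k - 1) x := by
  have := map_sub_range (k - 1)
  rw [show k - 1 - 1 = k - 2 by omega] at this
  rw [flipWord, descWord, List.map_map, List.map_reverse, List.reverse_reverse, ← this]
  simp [Function.comp_def]

lemma flipWord_ascWord (k : ℕ) (x : R) : flipWord k (ascWord (k - 1) x) = ascWord (k - 1) x := by
  have := congrArg List.reverse (map_sub_range (k - 1))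
  rw [show k - 1 - 1 = k - 2 by omega, List.reverse_reverse] at this
  rw [flipWord, ascWord, List.map_map]
  conv_rhs => rw [← this, List.map_reverse, List.map_map]
  rfl

lemma flipWord_append (k : ℕ) (l l' : List (ℕ × R)) :
    flipWord k (l ++ l') = flipWord k l' ++ flipWord k l := by
  simp [flipWord]

end

/-! ### Stable Grothendieck polynomials as coefficients -/

section

variable {R : Type*} [CommRing R]

/-- The coefficients of `X` and `Y` at the elements of `S_k` agree. -/
def Agree (k : ℕ) (X Y : HeckeAlg R) : Prop :=
  ∀ w : Perm ℕ, (∀ p, k ≤ p → w p = p) → cf w X = cf w Y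

lemma Agree.refl (k : ℕ) (X : HeckeAlg R) : Agree k X X := fun _ _ => rfl

lemma Agree.trans {k : ℕ} {X Y Z : HeckeAlg R} (h : Agree k X Y) (h' : Agree k Y Z) :
    Agree k X Z := fun w hw => (h w hw).trans (h' w hw)

lemma Agree.mul_hgen {k g : ℕ} {X Y : HeckeAlg R} (h : Agree k X Y) (hg : g + 1 < k) (u : R) :
    Agree k (X * hgen g u) (Y * hgen g u) := by
  intro w hw
  rcases apply_lt_or_gt w g with h1 | h1
  · rw [cf_mul_hgen_of_lt h1, cf_mul_hgen_of_lt h1, h w hw]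
  · rw [cf_mul_hgen_of_gt h1, cf_mul_hgen_of_gt h1, h w hw, h _ (fix_mul_simpleRefl hw hg)]

/-- Generators outside of `S_k` do not affect the coefficients at the elements of `S_k`. -/
lemma agree_mul_hgen {k g : ℕ} (hg : k ≤ g + 1) (X : HeckeAlg R) (u : R) :
    Agree k (X * hgen g u) X := by
  intro w hw
  refine cf_mul_hgen_of_lt ?_ X u
  rw [hw (g + 1) hg]
  by_cases h : k ≤ g
  · rw [hw g h]; omega
  · have := perm_lt hw (p := g) (by omega)
    omega

lemma Agree.mul_descProd {k n : ℕ} {X Y : HeckeAlg R} (h : Agree k X Y) (hn : n + 1 ≤ k ∨ n = 0)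
    (u : R) : Agree k (X * descProd n u) (Y * descProd n u) := by
  induction n generalizing X Y with
  | zero => simpa [descProd] using h
  | succ n ih =>
    rw [descProd, ← mul_assoc, ← mul_assoc]
    exact ih (h.mul_hgen (by omega) u) (by omega)

lemma Agree.mul_ascProd {k n : ℕ} {X Y : HeckeAlg R} (h : Agree k X Y) (hn : n + 1 ≤ k ∨ n = 0)
    (u : R) : Agree k (X * ascProd n u) (Y * ascProd n u) := by
  induction n with
  | zero => simpa [ascProd] using h
  | succ n ih =>
    rw [ascProd, ← mul_assoc, ← mul_assoc]
    exact (ih (by omega)).mul_hgen (by omega) u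

lemma agree_mul_descProd {k n : ℕ} (hn : k - 1 ≤ n) (X : HeckeAlg R) (u : R) :
    Agree k (X * descProd n u) (X * descProd (k - 1) u) := by
  induction n, hn using Nat.le_induction generalizing X with
  | base => exact .refl _ _
  | succ n hn ih =>
    rw [descProd, ← mul_assoc]
    exact (ih _).trans ((agree_mul_hgen (by omega) X u).mul_descProd (by omega) u)

lemma agree_mul_ascProd {k n : ℕ} (hn : k - 1 ≤ n) (X : HeckeAlg R) (u : R) :
    Agree k (X * ascProd n u) (X * ascProd (k - 1) u) := by
  induction n, hn using Nat.le_induction with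
  | base => exact .refl _ _
  | succ n hn ih =>
    rw [ascProd, ← mul_assoc]
    exact (agree_mul_hgen (by omega) _ u).trans ih

/-- The product of `descProd (k - 1) (f j)` over `j < N`, the last factor having `j = 0`. -/
def descPow (k : ℕ) (f : ℕ → R) : ℕ → HeckeAlg R
  | 0 => 1
  | N + 1 => descPow k f N * descProd (k - 1) (f N)

/-- The product of `ascProd (k - 1) (g j)` over `j < N`, in decreasing order of `j`. -/
def ascPow (k : ℕ) (g : ℕ → R) : ℕ → HeckeAlg R
  | 0 => 1
  | N + 1 => ascProd (k - 1) (g N) * ascPow k g N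

/-- If the parameters of the rows of length `< k - 1` are `1`, those rows are trivial, and the
longer rows may be cut down to length `k - 1`. -/
lemma agree_descStair {k : ℕ} {f : ℕ → R} (hf : ∀ j, j + 1 < k → f j = 1) (N : ℕ) :
    Agree k (descStair f N) (descPow k f N) := by
  induction N with
  | zero => exact .refl _ _
  | succ N ih =>
    rw [descStair, descPow]
    by_cases h : N + 1 < k
    · rw [hf N h, descProd_one, descProd_one, mul_one, mul_one]; exact ih
    · exact (agree_mul_descProd (by omega) _ _).trans (ih.mul_descProd (by omega) _)

lemma Agree.mul_ascPow {k : ℕ} {X Y : HeckeAlg R} (h : Agree k X Y) (g : ℕ → R) (N : ℕ) :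
    Agree k (X * ascPow k g N) (Y * ascPow k g N) := by
  induction N generalizing X Y with
  | zero => simpa [ascPow] using h
  | succ N ih =>
    rw [ascPow, ← mul_assoc, ← mul_assoc]
    exact ih (h.mul_ascProd (by omega) _)

lemma agree_mul_ascStair {k : ℕ} {g : ℕ → R} (hg : ∀ j, j + 1 < k → g j = 1) (X : HeckeAlg R)
    (N : ℕ) : Agree k (X * ascStair g N) (X * ascPow k g N) := by
  induction N generalizing X with
  | zero => exact .refl _ _
  | succ N ih =>
    rw [ascStair, ascPow, ← mul_assoc, ← mul_assoc]
    by_cases h : N + 1 < k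
    · rw [hg N h, ascProd_one, ascProd_one, mul_one]; exact ih X
    · exact (ih _).trans ((agree_mul_ascProd (by omega) X _).mul_ascPow g N)

lemma Agree.mul_ascStair {k : ℕ} {X Y : HeckeAlg R} (h : Agree k X Y) {g : ℕ → R}
    (hg : ∀ j, j + 1 < k → g j = 1) (N : ℕ) :
    Agree k (X * ascStair g N) (Y * ascPow k g N) :=
  (agree_mul_ascStair hg X N).trans (h.mul_ascPow g N)

/-- Words and their flips have the same coefficients up to `w ↦ w_0 w⁻¹ w_0`. -/
lemma cf_hat_flipWord {k : ℕ} {l : List (ℕ × R)} (hl : ∀ x ∈ l, x.1 + 1 < k) {w : Perm ℕ}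
    (hw : ∀ p, k ≤ p → w p = p) : cf (hat k w) (hprod (flipWord k l)) = cf w (hprod l) := by
  induction l using List.reverseRecOn generalizing w with
  | nil =>
    simp only [flipWord, List.map_nil, List.reverse_nil, hprod_nil, cf_one]
    congr 1
    rw [eq_iff_iff]
    constructor
    · intro h
      rw [← hat_hat k w, h, hat, inv_one, mul_one, longest_mul_self]
    · rintro rfl
      rw [hat, inv_one, mul_one, longest_mul_self]
  | append_singleton l x ih =>
    obtain ⟨g, u⟩ := x
    have hg : g + 1 < k := hl (g, u) (by simp)
    have ih' := @ih (fun x hx => hl x (by simp [hx]))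
    have e : flipWord k (l ++ [(g, u)]) = (k - 2 - g, u) :: flipWord k l := by simp [flipWord]
    rw [e, hprod_cons, hprod_append, hprod_cons, hprod_nil, mul_one]
    have h3 := hat_asc_iff hw hg
    rcases apply_lt_or_gt w g with h1 | h1
    · rw [cf_mul_hgen_of_lt h1, cf_hgen_mul_of_lt (h3.2 h1), ih' hw]
    · have h4 : (hat k w)⁻¹ (k - 2 - g + 1) < (hat k w)⁻¹ (k - 2 - g) :=
        (apply_lt_or_gt _ _).resolve_left fun h => by have := h3.1 h; omega
      rw [cf_mul_hgen_of_gt h1, cf_hgen_mul_of_gt h4, ih' hw, ← hat_mul_simpleRefl hg,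
        ih' (fix_mul_simpleRefl hw hg)]

lemma hprod_descWord (n : ℕ) (x : R) : hprod (descWord n x) = descProd n x := by
  induction n with
  | zero => rfl
  | succ n ih =>
    rw [descProd, ← ih, descWord, List.range_succ, List.reverse_append]; simp [descWord]

lemma hprod_ascWord (n : ℕ) (x : R) : hprod (ascWord n x) = ascProd n x := by
  induction n with
  | zero => rfl
  | succ n ih => rw [ascProd, ← ih, ascWord, List.range_succ, List.map_append]; simp [ascWord]

end

/-! ### Signs -/

lemma sgn_mul_prod {u : Perm ℕ} (hu : FinSupp u) (l : List ℕ) :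
    sgn (u * (l.map simpleRefl).prod) = sgn u * (-1) ^ l.length := by
  induction l using List.reverseRecOn with
  | nil => simp
  | append_singleton l i ih =>
    rw [List.map_append, List.prod_append, List.map_singleton, List.prod_singleton, ← mul_assoc,
      sgn_mul_simpleRefl (hu.mul (.prod l)), ih, List.length_append, List.length_singleton,
      pow_succ]
    ring

lemma sgn_prod (l : List ℕ) : sgn (l.map simpleRefl).prod = (-1) ^ l.length := by
  have := sgn_mul_prod .one l
  rwa [one_mul, show sgn 1 = 1 by simp [sgn], one_mul] at this

lemma exists_word {v : Perm ℕ} (hv : FinSupp v) : ∃ l : List ℕ, (l.map simpleRefl).prod = v :=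
  ⟨_, (isReducedWord_reducedWord hv).1⟩

lemma sgn_mul {u v : Perm ℕ} (hu : FinSupp u) (hv : FinSupp v) : sgn (u * v) = sgn u * sgn v := by
  obtain ⟨l, rfl⟩ := exists_word hv
  rw [sgn_mul_prod hu, sgn_prod]

@[simp] lemma sgn_one : sgn 1 = 1 := by simp [sgn]

lemma sgn_inv {u : Perm ℕ} (hu : FinSupp u) : sgn u⁻¹ = sgn u := by
  have h := sgn_mul hu hu.inv
  rw [mul_inv_cancel, sgn_one] at h
  have h2 := sgn_mul_self u
  calc sgn u⁻¹ = (sgn u * sgn u) * sgn u⁻¹ := by rw [h2, one_mul]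
    _ = sgn u := by rw [mul_assoc, ← h, mul_one]

lemma sgn_hat (N : ℕ) {u : Perm ℕ} (hu : FinSupp u) : sgn (hat N u) = sgn u := by
  rw [hat, sgn_mul ((finSupp_longest N).mul hu.inv) (finSupp_longest N),
    sgn_mul (finSupp_longest N) hu.inv, sgn_inv hu]
  linear_combination sgn u * sgn_mul_self (longest N)

lemma sgn_list_prod {l : List (Perm ℕ)} (h : ∀ u ∈ l, FinSupp u) :
    FinSupp l.prod ∧ sgn l.prod = (l.map sgn).prod := by
  induction l with
  | nil => exact ⟨.one, by simp⟩
  | cons u l ih =>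
    have ih := ih fun v hv => h v (by simp [hv])
    have hu := h u (by simp)
    rw [List.prod_cons, List.map_cons, List.prod_cons, sgn_mul hu ih.1, ih.2]
    exact ⟨hu.mul ih.1, rfl⟩

/-! ### The permutations `1^m × w` -/

lemma shiftPerm_apply (m : ℕ) (w : Perm ℕ) (p : ℕ) :
    shiftPerm m w p = if p < m then p else w (p - m) + m := rfl

lemma shiftPerm_inv (m : ℕ) (w : Perm ℕ) : (shiftPerm m w)⁻¹ = shiftPerm m w⁻¹ := rfl

lemma length_shiftPerm (m : ℕ) (w : Perm ℕ) : length (shiftPerm m w) = length w := by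
  have hinj : Function.Injective (Prod.map (· + m) (· + m) : ℕ × ℕ → ℕ × ℕ) :=
    (add_left_injective m).prodMap (add_left_injective m)
  rw [length, length, ← Set.ncard_image_of_injective (inversions w) hinj]
  congr 1
  ext ⟨p, q⟩
  constructor
  · rintro ⟨h1, h2⟩
    simp only [shiftPerm_apply] at h1 h2
    have hp : m ≤ p := by
      by_contra hp
      rw [if_pos (show p < m by omega)] at h2
      split_ifs at h2 <;> omega
    rw [if_neg (by omega), if_neg (by omega)] at h2
    refine ⟨(p - m, q - m), ⟨?_, ?_⟩, ?_⟩
    · change p - m < q - m; omega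
    · change w (q - m) < w (p - m); omega
    · simp only [Prod.map_apply, Prod.mk.injEq]; omega
  · rintro ⟨⟨p', q'⟩, ⟨h1, h2⟩, h⟩
    simp only [Prod.map_apply, Prod.mk.injEq] at h
    obtain ⟨rfl, rfl⟩ := h
    refine ⟨?_, ?_⟩
    · change p' + m < q' + m; simpa using h1
    · simpa [shiftPerm_apply] using h2

lemma shiftPerm_fix {m k : ℕ} {w : Perm ℕ} (hw : ∀ p, k ≤ p → w p = p) :
    ∀ p, m + k ≤ p → shiftPerm m w p = p := fun p hp => by
  rw [shiftPerm_apply, if_neg (by omega), hw _ (by omega)]; omega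

lemma inv_fix {k : ℕ} {w : Perm ℕ} (hw : ∀ p, k ≤ p → w p = p) : ∀ p, k ≤ p → w⁻¹ p = p :=
  fun p hp => by rw [Perm.inv_eq_iff_eq, hw p hp]

/-- Conjugation by the longest element moves the shifted permutation back to the beginning. -/
lemma hat_shiftPerm {m k : ℕ} {w : Perm ℕ} (hw : ∀ p, k ≤ p → w p = p) :
    hat (m + k) (shiftPerm m w) = hat k w := by
  ext p
  have hw' := inv_fix hw
  simp only [hat, shiftPerm_inv, Perm.mul_apply, longest_apply (m + k) p, longest_apply k p]
  by_cases h1 : p < k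
  · have := perm_lt hw' (p := k - 1 - p) (by omega)
    rw [if_pos (by omega), if_pos h1, shiftPerm_apply, if_neg (by omega),
      show m + k - 1 - p - m = k - 1 - p by omega, longest_apply, if_pos (by omega), longest_apply,
      if_pos this]
    omega
  · rw [if_neg h1, hw' p (by omega), longest_apply k p, if_neg h1]
    split_ifs with h2
    · rw [shiftPerm_apply, if_pos (by omega), longest_apply, if_pos (by omega)]
      omega
    · rw [shiftPerm_fix hw' _ (by omega), longest_apply, if_neg h2]

lemma hat_fix {k : ℕ} {w : Perm ℕ} (hw : ∀ p, k ≤ p → w p = p) : ∀ p, k ≤ p → hat k w p = p :=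
  fun p hp => by
    have h : longest k p = p := by rw [longest_apply, if_neg (by omega)]
    rw [hat, Perm.mul_apply, Perm.mul_apply, h, inv_fix hw p hp, h]

/-! ### Coefficients of stable Grothendieck polynomials -/

/-- The element of the Hecke algebra of `S_k` whose coefficients are the stable double Grothendieck
polynomials `G_w(a; b)`. -/
def stableElt (k : ℕ) (a b : List K) : HeckeAlg K :=
  (a.map fun x => descProd (k - 1) x⁻¹).prod * (b.reverse.map (ascProd (k - 1))).prod

lemma descPow_getD (k : ℕ) (a : List K) {N : ℕ} (hN : a.length ≤ N) :
    descPow k (fun j => (a.getD (N - 1 - j) 1)⁻¹) N =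
      (a.reverse.map fun x => descProd (k - 1) x⁻¹).prod := by
  have key : ∀ (N : ℕ) (a : List K) (f : ℕ → K), a.length ≤ N →
      (∀ j < N, f j = (a.getD (N - 1 - j) 1)⁻¹) →
      descPow k f N = (a.reverse.map fun x => descProd (k - 1) x⁻¹).prod := by
    intro N
    induction N with
    | zero =>
      intro a f ha _
      rw [List.length_eq_zero_iff.1 (Nat.le_zero.1 ha)]; rfl
    | succ N ih =>
      intro a f ha hf
      rw [descPow, hf N (by omega), show N + 1 - 1 - N = 0 by omega]
      cases a with
      | nil =>
        rw [ih [] f (by simp) (fun j hj => by rw [hf j (by omega)]; simp)]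
        simp
      | cons x a =>
        rw [ih a f (by simpa using ha) (fun j hj => by
          rw [hf j (by omega), show N + 1 - 1 - j = (N - 1 - j) + 1 by omega]; simp)]
        simp
  exact key N a _ hN fun _ _ => rfl

lemma ascPow_getD (k : ℕ) (b : List K) {N : ℕ} (hN : b.length ≤ N) :
    ascPow k (fun j => b.getD (N - 1 - j) 1) N = (b.map (ascProd (k - 1))).prod := by
  have key : ∀ (N : ℕ) (b : List K) (f : ℕ → K), b.length ≤ N →
      (∀ j < N, f j = b.getD (N - 1 - j) 1) →
      ascPow k f N = (b.map (ascProd (k - 1))).prod := by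
    intro N
    induction N with
    | zero =>
      intro b f hb _
      rw [List.length_eq_zero_iff.1 (Nat.le_zero.1 hb)]; rfl
    | succ N ih =>
      intro b f hb hf
      rw [ascPow, hf N (by omega), show N + 1 - 1 - N = 0 by omega]
      cases b with
      | nil =>
        rw [ih [] f (by simp) (fun j hj => by rw [hf j (by omega)]; simp)]
        simp
      | cons x b =>
        rw [ih b f (by simpa using hb) (fun j hj => by
          rw [hf j (by omega), show N + 1 - 1 - j = (N - 1 - j) + 1 by omega]; simp)]
        simp
  exact key N b _ hN fun _ _ => rfl

lemma flipWord_flatMap {S T : Type*} (k : ℕ) (l : List T) (f : T → List (ℕ × S)) :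
    flipWord k (l.flatMap f) = l.reverse.flatMap fun x => flipWord k (f x) := by
  induction l with
  | nil => rfl
  | cons x l ih => rw [List.flatMap_cons, flipWord_append, ih]; simp

lemma hprod_flatMap {R T : Type*} [CommRing R] (l : List T) (f : T → List (ℕ × R)) :
    hprod (l.flatMap f) = (l.map fun x => hprod (f x)).prod := by
  induction l with
  | nil => rfl
  | cons x l ih => rw [List.flatMap_cons, hprod_append, ih]; simp

/-- The flip fixes descending and ascending rows, and only reverses the order of the factors. -/
lemma cf_hat_stableElt {k : ℕ} (a b : List K) {w : Perm ℕ} (hw : ∀ p, k ≤ p → w p = p) :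
    cf (hat k w) ((a.reverse.map fun x => descProd (k - 1) x⁻¹).prod *
      (b.map (ascProd (k - 1))).prod) = cf w (stableElt k a b) := by
  set l : List (ℕ × K) := b.reverse.flatMap (fun x => ascWord (k - 1) x) ++
    a.flatMap fun x => descWord (k - 1) x⁻¹ with hl
  have hl1 : hprod l = stableElt k a b := by
    rw [hl, hprod_append, hprod_flatMap, hprod_flatMap, stableElt]
    simp only [hprod_ascWord, hprod_descWord]
    symm
    apply Commute.list_prod_left
    intro x hx
    apply Commute.list_prod_right
    intro y hy
    obtain ⟨x, _, rfl⟩ := List.mem_map.1 hx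
    obtain ⟨y, _, rfl⟩ := List.mem_map.1 hy
    exact descProd_mul_ascProd _ _ _
  have hl2 : hprod (flipWord k l) = (a.reverse.map fun x => descProd (k - 1) x⁻¹).prod *
      (b.map (ascProd (k - 1))).prod := by
    rw [hl, flipWord_append, flipWord_flatMap, flipWord_flatMap, hprod_append, hprod_flatMap,
      hprod_flatMap, List.reverse_reverse]
    simp only [flipWord_ascWord, flipWord_descWord, hprod_ascWord, hprod_descWord]
  rw [← hl1, ← hl2]
  refine cf_hat_flipWord ?_ hw
  intro x hx
  simp only [hl, List.mem_append, List.mem_flatMap, ascWord, descWord, List.mem_map,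
    List.mem_reverse, List.mem_range] at hx
  rcases hx with ⟨_, _, _, h, rfl⟩ | ⟨_, _, _, h, rfl⟩ <;> simp only <;> omega

/-- Stable double Grothendieck polynomials as coefficients. -/
lemma stableGroth_eq {k : ℕ} (w : Perm (Fin k)) (a b : List K) :
    stableGroth w a b = sgn (embed w) * cf (embed w) (stableElt k a b) := by
  have hw : ∀ p, k ≤ p → embed w p = p := fun p hp => embed_of_ge w hp
  set m := max a.length b.length with hm
  have ha : a.length ≤ m := le_max_left _ _
  have hb : b.length ≤ m := le_max_right _ _
  rw [stableGroth, ← hm, grothEval_eq (shiftPerm_fix hw), hat_shiftPerm hw, sgn, length_shiftPerm,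
    ← sgn, ← cf_hat_stableElt a b hw]
  congr 1
  rw [grothElt, ← descPow_getD k a (N := m + k) (by omega),
    ← ascPow_getD k b (N := m + k) (by omega)]
  refine Agree.mul_ascStair (agree_descStair ?_ _) ?_ _ _ (hat_fix hw)
  -- the first `k` rows have the parameter `1`, as at most `m` of the `m + k` variables differ
  -- from `1`
  · intro j hj
    rw [List.getD_eq_default _ _ (by omega), inv_one]
  · intro j hj
    rw [List.getD_eq_default _ _ (by omega)]

section

variable {R : Type*} [CommRing R]

/-! ### Staircase products of units and rectangles -/

lemma hUnit_mul_hUnit (i : ℕ) (u v : Rˣ) : hUnit i u * hUnit i v = hUnit (R := R) i (u * v) :=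
  Units.ext (by simp [hgen_mul_hgen])

lemma unitSub_commute {G G' : Set ℕ} (h : ∀ g ∈ G, ∀ g' ∈ G', g + 2 ≤ g' ∨ g' + 2 ≤ g)
    {X Y : (HeckeAlg R)ˣ} (hX : X ∈ unitSub R G) (hY : Y ∈ unitSub R G') : X * Y = Y * X :=
  Units.ext (commute_of_mem_algSub h (val_mem_algSub hX) (val_mem_algSub hY))

/-- The product of `descUnit (o + i) x_i⁻¹` over the entries `x_0, x_1, …` of a list. -/
def stair : ℕ → List Rˣ → (HeckeAlg R)ˣ
  | _, [] => 1
  | o, x :: l => descUnit o x⁻¹ * stair (o + 1) l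

lemma stair_append (o : ℕ) (l l' : List Rˣ) :
    stair o (l ++ l') = stair o l * stair (o + l.length) l' := by
  induction l generalizing o with
  | nil => simp [stair]
  | cons x l ih =>
    rw [List.cons_append, stair, ih, stair, mul_assoc, List.length_cons,
      show o + 1 + l.length = o + (l.length + 1) by omega]

lemma stair_mem (o : ℕ) (l : List Rˣ) : stair o l ∈ unitSub R {g | g + 1 < o + l.length} := by
  induction l generalizing o with
  | nil => exact one_mem _
  | cons x l ih =>
    rw [stair]
    refine mul_mem (unitSub_mono (fun g hg => ?_) (descUnit_mem o _))
      (unitSub_mono (fun g hg => ?_) (ih _))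
    · simp only [Set.mem_ofPred_eq, List.length_cons] at *; omega
    · simp only [Set.mem_ofPred_eq, List.length_cons] at *; omega

lemma descStair_eq_stair {f : ℕ → R} {l : List Rˣ}
    (h : ∀ k < l.length, f k = (((l.getD k 1)⁻¹ : Rˣ) : R)) :
    descStair f l.length = (stair 0 l : HeckeAlg R) := by
  induction l using List.reverseRecOn with
  | nil => rfl
  | append_singleton l x ih =>
    rw [List.length_append, List.length_singleton, descStair, stair_append, stair, stair, mul_one,
      Units.val_mul, ih, h _ (by simp), descUnit_val]
    · simp
    · intro k hk
      rw [h k (by simp; omega), List.getD_append _ _ _ _ hk]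

lemma ascStair_eq_stair {f : ℕ → R} {l : List Rˣ}
    (h : ∀ k < l.length, f k = (l.getD k 1 : Rˣ)) :
    ascStair f l.length = ((stair 0 l)⁻¹ : (HeckeAlg R)ˣ) := by
  induction l using List.reverseRecOn with
  | nil => rfl
  | append_singleton l x ih =>
    rw [List.length_append, List.length_singleton, ascStair, stair_append, stair, stair, mul_one,
      mul_inv_rev, Units.val_mul, ih, h _ (by simp), descUnit_inv_val]
    · simp
    · intro k hk
      rw [h k (by simp; omega), List.getD_append _ _ _ _ hk]

/-- Exchanging the first two parameters of a staircase product. -/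
lemma stair_swap (o : ℕ) (x y : Rˣ) (l : List Rˣ) :
    stair o (x :: y :: l) = hUnit o (x * y⁻¹) * stair o (y :: x :: l) := by
  have h := (descUnit_commute (o + 1) x⁻¹ y⁻¹).eq
  have h1 : ∀ u : Rˣ, descUnit o u = (hUnit o u)⁻¹ * descUnit (o + 1) u := fun u => by
    rw [descUnit_succ, inv_mul_cancel_left]
  simp only [stair]
  rw [h1 x⁻¹, h1 y⁻¹, hUnit_inv, hUnit_inv, inv_inv, inv_inv, mul_assoc, ← mul_assoc (descUnit _ _),
    h, ← hUnit_mul_hUnit]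
  have h2 : hUnit o y⁻¹ * hUnit (R := R) o y = 1 := by
    rw [hUnit_mul_hUnit]; exact Units.ext (by simp)
  simp only [mul_assoc]
  rw [← mul_assoc (hUnit o y⁻¹), h2, one_mul]

/-- The product of the `hUnit i u` over a list of pairs `(i, u)`. -/
def hprodUnit (l : List (ℕ × Rˣ)) : (HeckeAlg R)ˣ := (l.map fun x => hUnit x.1 x.2).prod

@[simp] lemma hprodUnit_nil : hprodUnit ([] : List (ℕ × Rˣ)) = 1 := rfl

@[simp] lemma hprodUnit_cons (x : ℕ × Rˣ) (l : List (ℕ × Rˣ)) :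
    hprodUnit (x :: l) = hUnit x.1 x.2 * hprodUnit l := by simp [hprodUnit]

@[simp] lemma hprodUnit_append (l l' : List (ℕ × Rˣ)) :
    hprodUnit (l ++ l') = hprodUnit l * hprodUnit l' := by
  simp [hprodUnit]

lemma hprodUnit_mem {G : Set ℕ} {l : List (ℕ × Rˣ)} (h : ∀ x ∈ l, x.1 ∈ G) :
    hprodUnit l ∈ unitSub R G := by
  induction l with
  | nil => exact one_mem _
  | cons x l ih =>
    rw [hprodUnit_cons]
    exact mul_mem (hUnit_mem (h x (by simp)) _) (ih fun y hy => h y (by simp [hy]))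

lemma hprodUnit_val (l : List (ℕ × Rˣ)) :
    (hprodUnit l : HeckeAlg R) = hprod (l.map fun x => (x.1, (x.2 : R))) := by
  induction l with
  | nil => rfl
  | cons x l ih => rw [hprodUnit_cons, Units.val_mul, ih]; simp

end

section

variable {A : Type*} [Group A]

/-- The word of a row of a rectangle, exchanging `x` with the entries of a list. -/
def rowWord : ℕ → A → List A → List (ℕ × A)
  | _, _, [] => []
  | o, x, y :: a => (o, x * y⁻¹) :: rowWord (o + 1) x a

/-- The word of a rectangle, exchanging the lists `b` and `a`. -/
def rectWord : ℕ → List A → List A → List (ℕ × A)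
  | _, [], _ => []
  | o, x :: b, a => rectWord (o + 1) b a ++ rowWord o x a

lemma rowWord_mem {o : ℕ} {x : A} {a : List A} {z : ℕ × A} (hz : z ∈ rowWord o x a) :
    o ≤ z.1 ∧ z.1 < o + a.length ∧ ∃ y ∈ a, z.2 = x * y⁻¹ := by
  induction a generalizing o with
  | nil => simp [rowWord] at hz
  | cons y a ih =>
    rw [rowWord, List.mem_cons] at hz
    rcases hz with rfl | hz
    · simp
    · obtain ⟨h1, h2, y', hy', e⟩ := ih hz
      rw [List.length_cons]
      exact ⟨by omega, by omega, y', by simp [hy'], e⟩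

lemma rectWord_mem {o : ℕ} {b a : List A} {z : ℕ × A} (hz : z ∈ rectWord o b a) :
    o ≤ z.1 ∧ z.1 + 1 < o + a.length + b.length ∧ ∃ x ∈ b, ∃ y ∈ a, z.2 = x * y⁻¹ := by
  induction b generalizing o with
  | nil => simp [rectWord] at hz
  | cons x b ih =>
    rw [rectWord, List.mem_append] at hz
    rw [List.length_cons]
    rcases hz with hz | hz
    · obtain ⟨h1, h2, x', hx', y', hy', e⟩ := ih hz
      exact ⟨by omega, by omega, x', by simp [hx'], y', hy', e⟩
    · obtain ⟨h1, h2, y', hy', e⟩ := rowWord_mem hz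
      exact ⟨by omega, by omega, x, by simp, y', hy', e⟩

lemma length_rowWord (o : ℕ) (x : A) (a : List A) : (rowWord o x a).length = a.length := by
  induction a generalizing o with
  | nil => rfl
  | cons y a ih => simp [rowWord, ih]

lemma length_rectWord (o : ℕ) (b a : List A) :
    (rectWord o b a).length = b.length * a.length := by
  induction b generalizing o with
  | nil => simp [rectWord]
  | cons x b ih =>
    rw [rectWord, List.length_append, ih, length_rowWord, List.length_cons, Nat.succ_mul]

lemma blockSwap_apply (c A B p : ℕ) : blockSwap c A B p = if c ≤ p ∧ p < c + A then p + B
    else if c + A ≤ p ∧ p < c + A + B then p - A else p := rfl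

lemma wordPerm_rowWord (o : ℕ) (x : A) (a : List A) :
    wordPerm (rowWord o x a) = blockSwap o a.length 1 := by
  induction a generalizing o with
  | nil =>
    ext p
    simp only [rowWord, wordPerm_nil, blockSwap_apply, List.length_nil, Perm.one_apply]
    split_ifs <;> omega
  | cons y a ih =>
    ext p
    rw [rowWord, wordPerm_cons, ih, Perm.mul_apply, simpleRefl_apply, List.length_cons]
    simp only [blockSwap_apply]
    split_ifs <;> omega

/-- The word of a rectangle spells a block exchange. It is reduced, as the block exchange has as
many inversions as the rectangle has cells. -/
lemma wordPerm_rectWord (o : ℕ) (b a : List A) :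
    wordPerm (rectWord o b a) = blockSwap o a.length b.length := by
  induction b generalizing o with
  | nil =>
    ext p
    simp only [rectWord, wordPerm_nil, blockSwap_apply, List.length_nil, Perm.one_apply]
    split_ifs <;> omega
  | cons x b ih =>
    ext p
    rw [rectWord, wordPerm_append, ih, wordPerm_rowWord, Perm.mul_apply, List.length_cons]
    simp only [blockSwap_apply]
    split_ifs <;> omega

end

section

variable {R : Type*} [CommRing R]

lemma stair_row (o : ℕ) (x : Rˣ) (a t : List Rˣ) :
    stair o (x :: (a ++ t)) = hprodUnit (rowWord o x a) * stair o (a ++ x :: t) := by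
  induction a generalizing o with
  | nil => simp [rowWord]
  | cons y a ih =>
    rw [List.cons_append, stair_swap, stair, ih, rowWord, hprodUnit_cons, List.cons_append, stair]
    have c : descUnit o y⁻¹ * hprodUnit (rowWord (o + 1) x a) =
        hprodUnit (rowWord (o + 1) x a) * descUnit o y⁻¹ :=
      unitSub_commute (G := {g | g < o}) (G' := {g | o + 1 ≤ g})
        (fun g hg g' hg' => by simp only [Set.mem_ofPred_eq] at hg hg'; omega)
        (descUnit_mem _ _) (hprodUnit_mem fun z hz => (rowWord_mem hz).1)
    rw [← mul_assoc (descUnit _ _), c]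
    simp only [mul_assoc]

/-- Exchanging two adjacent blocks of parameters of a staircase product. -/
lemma stair_rect (o : ℕ) (b a t : List Rˣ) :
    stair o (b ++ (a ++ t)) = hprodUnit (rectWord o b a) * stair o (a ++ (b ++ t)) := by
  induction b generalizing o with
  | nil => simp [rectWord]
  | cons x b ih =>
    have c : descUnit o x⁻¹ * hprodUnit (rectWord (o + 1) b a) =
        hprodUnit (rectWord (o + 1) b a) * descUnit o x⁻¹ :=
      unitSub_commute (G := {g | g < o}) (G' := {g | o + 1 ≤ g})
        (fun g hg g' hg' => by simp only [Set.mem_ofPred_eq] at hg hg'; omega)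
        (descUnit_mem _ _) (hprodUnit_mem fun z hz => (rectWord_mem hz).1)
    rw [List.cons_append, stair, ih, ← mul_assoc, c, mul_assoc, ← stair, stair_row, rectWord,
      hprodUnit_append, mul_assoc, List.cons_append]

/-! ### Block exchanges in the Demazure monoid -/

lemma finSupp_blockSwap (c A B : ℕ) : FinSupp (blockSwap c A B) :=
  ⟨c + A + B, fun p hp => by rw [blockSwap_apply]; split_ifs <;> omega⟩

/-- `blockSwap` as an element of the Demazure monoid. -/
def demBlock (c A B : ℕ) : Dem := ⟨blockSwap c A B, finSupp_blockSwap c A B⟩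

/-- The basis element `τ_w`. -/
abbrev basisElt (R : Type*) [CommRing R] (w : Dem) : HeckeAlg R := MonoidAlgebra.single w 1

lemma mul_dgen_eq_dgen_mul {δ : Dem} {g g' : ℕ} (h : δ.perm g = g') (h' : δ.perm (g + 1) = g' + 1) :
    δ * dgen g = dgen g' * δ := by
  have a1 : δ.perm⁻¹ g' = g := by rw [Perm.inv_eq_iff_eq]; exact h.symm
  have a2 : δ.perm⁻¹ (g' + 1) = g + 1 := by rw [Perm.inv_eq_iff_eq]; exact h'.symm
  apply Dem.ext
  rw [Dem.mul_dgen_perm, Dem.dgen_mul_perm, heckeStep_of_lt (by omega), heckeStepLeft,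
    if_pos (by omega), simpleRefl, simpleRefl, Equiv.mul_swap_eq_swap_mul, h, h']

lemma basisElt_mul_hgen {δ : Dem} {g g' : ℕ} (h : δ.perm g = g') (h' : δ.perm (g + 1) = g' + 1)
    (u : R) : basisElt R δ * hgen g u = hgen g' u * basisElt R δ := by
  rw [hgen, hgen, mul_add, add_mul, mul_one, one_mul, MonoidAlgebra.single_mul_single,
    MonoidAlgebra.single_mul_single, mul_dgen_eq_dgen_mul h h', one_mul, mul_one]

/-- Moving products of generators through `τ_δ`. -/
lemma exists_basisElt_mul_unit {δ : Dem} {G G' : Set ℕ}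
    (h : ∀ g ∈ G, ∃ g' ∈ G', δ.perm g = g' ∧ δ.perm (g + 1) = g' + 1) {U : (HeckeAlg R)ˣ}
    (hU : U ∈ unitSub R G) :
    ∃ U' ∈ unitSub R G', basisElt R δ * (U : HeckeAlg R) = (U' : HeckeAlg R) * basisElt R δ := by
  refine unitSub_induction (R := R) (G := G)
    (p := fun U => ∃ U' ∈ unitSub R G', basisElt R δ * (U : HeckeAlg R) = U' * basisElt R δ)
    ⟨1, one_mem _, by simp⟩ ?_ hU
  rintro U ⟨U', hU', e⟩ g hg u
  obtain ⟨g', hg', h1, h2⟩ := h g hg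
  refine ⟨U' * hUnit g' u, mul_mem hU' (hUnit_mem hg' u), ?_⟩
  rw [Units.val_mul, Units.val_mul, ← mul_assoc, e, mul_assoc, hUnit_val, basisElt_mul_hgen h1 h2,
    hUnit_val, mul_assoc]

lemma exists_unit_mul_basisElt {δ : Dem} {G G' : Set ℕ}
    (h : ∀ g ∈ G, ∃ g' ∈ G', δ.perm g' = g ∧ δ.perm (g' + 1) = g + 1) {U : (HeckeAlg R)ˣ}
    (hU : U ∈ unitSub R G) :
    ∃ U' ∈ unitSub R G', (U : HeckeAlg R) * basisElt R δ = basisElt R δ * (U' : HeckeAlg R) := by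
  refine unitSub_induction (R := R) (G := G)
    (p := fun U => ∃ U' ∈ unitSub R G', (U : HeckeAlg R) * basisElt R δ = basisElt R δ * U')
    ⟨1, one_mem _, by simp⟩ ?_ hU
  rintro U ⟨U', hU', e⟩ g hg u
  obtain ⟨g', hg', h1, h2⟩ := h g hg
  refine ⟨U' * hUnit g' u, mul_mem hU' (hUnit_mem hg' u), ?_⟩
  rw [Units.val_mul, Units.val_mul, mul_assoc, hUnit_val, ← basisElt_mul_hgen h1 h2, ← mul_assoc, e,
    mul_assoc, hUnit_val]

end

section

/-! ### Splitting off one block from the quotient of staircase products -/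

/-- An element of `S_N` belongs to the submonoid generated by the `s_g` with `g + 1 < N`. -/
lemma mem_demSub_of_fix {N : ℕ} (w : Dem) (hw : ∀ p, N ≤ p → w.perm p = p) :
    w ∈ demSub {g | g + 1 < N} := by
  induction h : length w.perm generalizing w with
  | zero =>
    obtain ⟨l, hl1, hl2⟩ := exists_isReducedWord hw
    rw [h, List.length_eq_zero_iff] at hl2
    subst hl2
    have : w = 1 := Dem.ext hl1.symm
    rw [this]
    exact one_mem _
  | succ k ih =>
    obtain ⟨l, hl1, hl2⟩ := exists_isReducedWord hw
    rcases List.eq_nil_or_concat l with rfl | ⟨l', i, rfl⟩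
    · simp at hl2; omega
    rw [List.concat_eq_append] at hl1 hl2
    rw [List.map_append, List.prod_append, List.map_singleton, List.prod_singleton] at hl1
    have e : w.perm * simpleRefl i = (l'.map simpleRefl).prod := by
      rw [← hl1, mul_assoc, simpleRefl_mul_self, mul_one]
    have h2 := length_prod_le l'
    rw [← e] at h2
    rw [List.length_append, List.length_singleton] at hl2
    rcases length_heckeStep_le w.finSupp i with ⟨h3, h4⟩ | ⟨h3, -⟩
    swap
    · omega
    have hi : i + 1 < N := by
      by_contra hc
      have h5 := hw (i + 1) (by omega)
      rcases Nat.lt_or_ge i N with hN | hN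
      · have := perm_lt hw hN
        omega
      · have := hw i hN
        omega
    let v : Dem := ⟨w.perm * simpleRefl i, w.finSupp.mul (.simpleRefl i)⟩
    have hv : w = v * dgen i := by
      apply Dem.ext
      rw [Dem.mul_dgen_perm, heckeStep_of_lt]
      · simp [v, mul_assoc, simpleRefl_mul_self]
      · simpa [v] using h4
    rw [hv]
    refine mul_mem (ih v (fun p hp => ?_) (by simp only [v]; omega)) (dgen_mem_demSub hi)
    simp only [v, Perm.mul_apply]
    rw [simpleRefl_of_gt (by omega), hw p hp]

lemma basisElt_mem_algSub {R : Type*} [CommRing R] {G : Set ℕ} {w : Dem} (h : w ∈ demSub G) :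
    basisElt R w ∈ algSub R G := by
  induction h using Submonoid.closure_induction with
  | mem x hx => obtain ⟨g, hg, rfl⟩ := hx; exact tau_mem_algSub hg
  | one => exact one_mem _
  | mul x y _ _ hx hy =>
    have := mul_mem hx hy
    rwa [MonoidAlgebra.single_mul_single, mul_one] at this

lemma demBlock_mem (c A B : ℕ) : demBlock c A B ∈ demSub {g | g + 1 < c + A + B} :=
  mem_demSub_of_fix _ fun p hp => by
    rw [demBlock, blockSwap_apply]; split_ifs <;> omega

variable {A : Type*}

/-- The concatenation `a_j ++ a_{j+1} ++ ⋯` of `m` blocks. -/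
def concatUp (a : ℕ → List A) : ℕ → ℕ → List A
  | _, 0 => []
  | j, m + 1 => a j ++ concatUp a (j + 1) m

/-- The concatenation `⋯ ++ a_{j+1} ++ a_j` of `m` blocks. -/
def concatDown (a : ℕ → List A) : ℕ → ℕ → List A
  | _, 0 => []
  | j, m + 1 => concatDown a (j + 1) m ++ a j

/-- The sum `e_j + e_{j+1} + ⋯` of `m` block sizes. -/
def blockSum (e : ℕ → ℕ) : ℕ → ℕ → ℕ
  | _, 0 => 0
  | j, m + 1 => e j + blockSum e (j + 1) m

lemma length_concatUp (a : ℕ → List A) (j m : ℕ) :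
    (concatUp a j m).length = blockSum (fun i => (a i).length) j m := by
  induction m generalizing j with
  | zero => rfl
  | succ m ih => rw [concatUp, List.length_append, ih, blockSum]

lemma length_concatDown (a : ℕ → List A) (j m : ℕ) :
    (concatDown a j m).length = blockSum (fun i => (a i).length) j m := by
  induction m generalizing j with
  | zero => rfl
  | succ m ih => rw [concatDown, List.length_append, ih, blockSum, add_comm]

lemma mem_concatUp {a : ℕ → List A} {j m : ℕ} {x : A} (h : x ∈ concatUp a j m) :
    ∃ i, j ≤ i ∧ x ∈ a i := by
  induction m generalizing j with
  | zero => simp [concatUp] at h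
  | succ m ih =>
    rw [concatUp, List.mem_append] at h
    rcases h with h | h
    · exact ⟨j, le_rfl, h⟩
    · obtain ⟨i, hi, hx⟩ := ih h
      exact ⟨i, by omega, hx⟩

variable {R : Type*} [CommRing R]

/-- The quotient of the staircase products with parameters `a_j, a_{j+1}, …, a_{j+m}`, taken in
this and in the reverse order of blocks. -/
def stairQuot (a : ℕ → List Rˣ) (j m : ℕ) : (HeckeAlg R)ˣ :=
  stair 0 (concatUp a j (m + 1)) * (stair 0 (concatDown a j (m + 1)))⁻¹

/-- The factor of `stairQuot` that only involves the blocks `a_j` and `a_{j+1}`. -/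
def pairQuot (a : ℕ → List Rˣ) (j : ℕ) : (HeckeAlg R)ˣ :=
  stair 0 (a j ++ a (j + 1)) * (stair 0 (a (j + 1) ++ a j))⁻¹

lemma stairQuot_zero (a : ℕ → List Rˣ) (j : ℕ) : stairQuot a j 0 = 1 := by
  simp [stairQuot, concatUp, concatDown]

/-- `stairQuot` for `m + 2` blocks, in terms of the blocks other than the first. The middle factor
exchanges the first block with the blocks from the third one on. -/
lemma stairQuot_succ (a : ℕ → List Rˣ) (j m : ℕ) :
    stairQuot a j (m + 1) = pairQuot a j *
      hprodUnit (rectWord (a (j + 1)).length (a j) (concatUp a (j + 2) m)) *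
      stairQuot a (j + 1) m := by
  have e1 : stair 0 (concatUp a j (m + 1 + 1)) = pairQuot a j *
      stair 0 (a (j + 1) ++ (a j ++ (concatUp a (j + 2) m ++ []))) := by
    rw [pairQuot, concatUp, concatUp, ← List.append_assoc, List.append_nil, ← List.append_assoc,
      stair_append 0 (a j ++ _), stair_append 0 (a (j + 1) ++ _), mul_assoc, ← mul_assoc _⁻¹,
      inv_mul_cancel, one_mul, List.length_append, List.length_append, add_comm (a j).length]
  have c := unitSub_commute (G := {g | g + 1 < 0 + (a (j + 1)).length})
    (G' := {g | (a (j + 1)).length ≤ g})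
    (fun g hg g' hg' => by simp only [Set.mem_ofPred_eq] at hg hg'; omega)
    (stair_mem (R := R) 0 (a (j + 1)))
    (hprodUnit_mem (l := rectWord (a (j + 1)).length (a j) (concatUp a (j + 2) m))
      fun x hx => (rectWord_mem hx).1)
  have e2 : stair 0 (a (j + 1) ++ (a j ++ (concatUp a (j + 2) m ++ []))) =
      hprodUnit (rectWord (a (j + 1)).length (a j) (concatUp a (j + 2) m)) *
        stair 0 (concatUp a (j + 1) (m + 1) ++ a j) := by
    rw [stair_append, zero_add, stair_rect, ← mul_assoc, c, mul_assoc, List.append_nil, concatUp,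
      List.append_assoc, stair_append 0 (a (j + 1)), zero_add]
  rw [stairQuot, e1, e2, stair_append, concatDown, stair_append 0 (concatDown a (j + 1) (m + 1)),
    length_concatUp, length_concatDown, stairQuot]
  group

lemma pairQuot_mem (a : ℕ → List Rˣ) (j : ℕ) :
    pairQuot a j ∈ unitSub R {g | g + 1 < (a j).length + (a (j + 1)).length} := by
  refine mul_mem (unitSub_mono ?_ (stair_mem _ _)) (inv_mem (unitSub_mono ?_ (stair_mem _ _))) <;>
  · intro g hg
    simp only [Set.mem_ofPred_eq, List.length_append] at *
    omega

lemma stairQuot_mem (a : ℕ → List Rˣ) (j m : ℕ) :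
    stairQuot a j m ∈
      unitSub R {g | g + 1 < blockSum (fun i => (a i).length) j (m + 1)} := by
  refine mul_mem (unitSub_mono ?_ (stair_mem _ _)) (inv_mem (unitSub_mono ?_ (stair_mem _ _)))
  · intro g hg
    simpa only [Set.mem_ofPred_eq, length_concatUp, zero_add] using hg
  · intro g hg
    simpa only [Set.mem_ofPred_eq, length_concatDown, zero_add] using hg

/-- The exchange of the block of size `e_j` with the `m` blocks following the block of size
`e_{j+1}`. -/
def demDelta (e : ℕ → ℕ) (j m : ℕ) : Dem := demBlock (e (j + 1)) (blockSum e (j + 2) m) (e j)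

/-- The product `X_j τ_δ X_{j+1} τ_δ' ⋯ X_{j+m-1}` with block exchanges `δ, δ', …` between the
factors (and a trivial last factor). -/
def altProd (e : ℕ → ℕ) (X : ℕ → HeckeAlg R) : ℕ → ℕ → HeckeAlg R
  | _, 0 => 1
  | j, m + 1 => X j * basisElt R (demDelta e j m) * altProd e X (j + 1) m

lemma demDelta_mem (e : ℕ → ℕ) (j m : ℕ) :
    demDelta e j m ∈ demSub {g | g + 1 < blockSum e j (m + 2)} := by
  refine demSub_mono (fun g hg => ?_) (demBlock_mem _ _ _)
  have : blockSum e j (m + 2) = e j + (e (j + 1) + blockSum e (j + 2) m) := rfl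
  simp only [Set.mem_ofPred_eq] at *
  omega

lemma altProd_mem {e : ℕ → ℕ} {X : ℕ → HeckeAlg R}
    (hX : ∀ j, X j ∈ algSub R {g | g + 1 < e j + e (j + 1)}) (j m : ℕ) :
    altProd e X j m ∈ algSub R {g | g + 1 < blockSum e j (m + 1)} := by
  induction m generalizing j with
  | zero => exact one_mem _
  | succ m ih =>
    refine mul_mem (mul_mem (algSub_mono (fun g hg => ?_) (hX j))
      (basisElt_mem_algSub (demDelta_mem e j m))) (algSub_mono (fun g hg => ?_) (ih (j + 1)))
    · simp only [Set.mem_ofPred_eq, blockSum] at *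
      omega
    · simp only [Set.mem_ofPred_eq, blockSum] at *
      omega

end

section

/-! ### Coefficients of `stairQuot` as coefficients of an alternating product -/

lemma blockSum_add (e : ℕ → ℕ) (j m k : ℕ) :
    blockSum e j (m + k) = blockSum e j m + blockSum e (j + m) k := by
  induction m generalizing j with
  | zero => simp [blockSum]
  | succ m ih =>
    rw [show m + 1 + k = m + k + 1 by omega, blockSum, blockSum, ih,
      show j + 1 + m = j + (m + 1) by omega, add_assoc]

lemma blockSum_mono (e : ℕ → ℕ) (j : ℕ) {m m' : ℕ} (h : m ≤ m') :
    blockSum e j m ≤ blockSum e j m' := by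
  obtain ⟨k, rfl⟩ := Nat.exists_eq_add_of_le h
  rw [blockSum_add]; omega

/-- A permutation mapping `d` positions into the `d` places following the first `c` ones, over `q`
positions in between, has at least `q * d` inversions. -/
lemma mul_le_length {u : Perm ℕ} (hf : FinSupp u) {c q d : ℕ} (hc : ∀ p, u p < c ↔ p < c)
    (h : ∀ p, c + q ≤ p → p < c + q + d → u p < c + d) : q * d ≤ length u := by
  have himg : (Finset.Ico (c + q) (c + q + d)).image u = Finset.Ico c (c + d) := by
    apply Finset.eq_of_subset_of_card_le
    · intro v hv
      obtain ⟨p, hp, rfl⟩ := Finset.mem_image.1 hv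
      rw [Finset.mem_Ico] at hp ⊢
      have := hc p
      exact ⟨by omega, h p hp.1 hp.2⟩
    · rw [Finset.card_image_of_injective _ u.injective]; simp
  obtain ⟨m, hm⟩ := hf
  calc q * d = ((Finset.Ico c (c + q) ×ˢ Finset.Ico (c + q) (c + q + d) : Finset (ℕ × ℕ)) :
        Set (ℕ × ℕ)).ncard := by
        rw [Set.ncard_coe_finset]; simp
    _ ≤ _ := by
      refine Set.ncard_le_ncard ?_ (inversions_finite hm)
      rintro ⟨p, p'⟩ hp
      rw [Finset.mem_coe, Finset.mem_product, Finset.mem_Ico, Finset.mem_Ico] at hp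
      obtain ⟨⟨h1, h2⟩, h3, h4⟩ := hp
      simp only at h1 h2 h3 h4
      have h5 := h p' h3 h4
      refine ⟨by simp only; omega, ?_⟩
      simp only
      by_contra hcon
      have h6 : u p ∈ (Finset.Ico (c + q) (c + q + d)).image u := by
        rw [himg, Finset.mem_Ico]
        have := hc p
        omega
      obtain ⟨p'', h7, h8⟩ := Finset.mem_image.1 h6
      rw [Finset.mem_Ico] at h7
      have := u.injective h8
      omega

/-- For `1 ≤ i ≤ m` the values of `z` at the positions following the first `e_{j+i} + ⋯ + e_{j+m}`
of all `e_j + ⋯ + e_{j+m}` positions are among the first `e_j + ⋯ + e_{j+i}` values. -/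
def TailBound (e : ℕ → ℕ) (j m : ℕ) (z : Perm ℕ) : Prop :=
  ∀ i, 1 ≤ i → i ≤ m → ∀ p, blockSum e (j + i) (m + 1 - i) ≤ p → p < blockSum e j (m + 1) →
    z p < blockSum e j (i + 1)

lemma demDelta_apply (e : ℕ → ℕ) (j m p : ℕ) : (demDelta e j m).perm p =
    if e (j + 1) ≤ p ∧ p < blockSum e (j + 1) (m + 1) then p + e j
    else if blockSum e (j + 1) (m + 1) ≤ p ∧ p < blockSum e j (m + 2) then
      p - blockSum e (j + 2) m else p := by
  have h1 : blockSum e (j + 1) (m + 1) = e (j + 1) + blockSum e (j + 2) m := rfl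
  have h2 : blockSum e j (m + 2) = e j + (e (j + 1) + blockSum e (j + 2) m) := rfl
  rw [demDelta, demBlock, blockSwap_apply, h1, h2]
  split_ifs <;> omega

/-- The bound is inherited by the last factor when the first block is split off. -/
lemma TailBound.of_mul {e : ℕ → ℕ} {j m : ℕ} {z : Perm ℕ} (hz : TailBound e j (m + 1) z)
    {x y : Dem} (hx : x ∈ demSub {g | g + 1 < e j + e (j + 1)})
    (hy : y ∈ demSub {g | g + 1 < blockSum e (j + 1) (m + 1)})
    (h : (x * (demDelta e j m * y)).perm = z) : TailBound e (j + 1) m y.perm := by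
  have hM : blockSum e (j + 1) (m + 1) = e (j + 1) + blockSum e (j + 2) m := rfl
  have hN : blockSum e j (m + 1 + 1) = e j + blockSum e (j + 1) (m + 1) := rfl
  obtain ⟨x', hx', e1⟩ := exists_mul_left hx (demDelta e j m * y)
  rw [mul_perm_of_strictMonoOn (M := blockSum e (j + 1) (m + 1)) _ hy] at e1
  swap
  · intro p q hpq hq
    rw [demDelta_apply, demDelta_apply]
    split_ifs <;> omega
  intro i h1 h2 p hp hp'
  have h3 := hz (i + 1) (by omega) (by omega) p (by
    rwa [show j + (i + 1) = j + 1 + i by omega, show m + 1 + 1 - (i + 1) = m + 1 - i by omega])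
    (by omega)
  rw [← h, e1, Perm.mul_apply, Perm.mul_apply] at h3
  have h4 : blockSum e j (i + 1 + 1) = e j + blockSum e (j + 1) (i + 1) := rfl
  have h5 : blockSum e (j + 1) (i + 1) = e (j + 1) + blockSum e (j + 2) i := rfl
  rw [permSub_lt_iff hx' (fun g hg => by simp only [Set.mem_ofPred_eq] at hg; omega)] at h3
  have h6 : y.perm p < blockSum e (j + 1) (m + 1) := by
    rw [permSub_lt_iff (perm_mem_permSub hy)
      (fun g hg => by simp only [Set.mem_ofPred_eq] at hg; omega)]
    exact hp'
  rw [demDelta_apply] at h3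
  split_ifs at h3 <;> omega

/-- At permutations satisfying `TailBound` the exchange of the first block with the blocks from the
third one on contributes only its term of maximal length, with a nonzero factor. -/
lemma exists_cf_stairQuot (a : ℕ → List Kˣ) (ha : ∀ i i', i < i' → ∀ x ∈ a i, x ∉ a i')
    (j m : ℕ) : ∃ C : K, C ≠ 0 ∧ ∀ z, TailBound (fun i => (a i).length) j m z →
      cf z (stairQuot a j m : HeckeAlg K) =
        C * cf z (altProd (fun i => (a i).length) (fun i => (pairQuot a i : HeckeAlg K)) j m) := by
  induction m generalizing j with
  | zero => exact ⟨1, one_ne_zero, fun z _ => by rw [stairQuot_zero, altProd, one_mul]; rfl⟩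
  | succ m ih =>
    obtain ⟨C, hC, hz⟩ := ih (j + 1)
    set e : ℕ → ℕ := fun i => (a i).length with he
    have hM : blockSum e (j + 1) (m + 1) = e (j + 1) + blockSum e (j + 2) m := rfl
    have hN : blockSum e j (m + 1 + 1) = e j + blockSum e (j + 1) (m + 1) := rfl
    set l := (rectWord (a (j + 1)).length (a j) (concatUp a (j + 2) m)).map
      fun x => (x.1, (x.2 : K)) with hl
    have hlen : l.length = blockSum e (j + 2) m * e j := by
      rw [hl, List.length_map, length_rectWord, length_concatUp, mul_comm]
    have hword : wordPerm l = (demDelta e j m).perm := by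
      have : wordPerm l = wordPerm (rectWord (a (j + 1)).length (a j) (concatUp a (j + 2) m)) := by
        rw [wordPerm, hl, List.map_map]; rfl
      rw [this, wordPerm_rectWord, length_concatUp]; rfl
    -- the factors are `x / x' - 1` for parameters `x ≠ x'` in different blocks
    have htop : topCoeff l ≠ 0 := by
      rw [topCoeff]
      refine List.prod_ne_zero fun h => ?_
      simp only [hl, List.map_map, List.mem_map, Function.comp_apply] at h
      obtain ⟨y, hy, h0⟩ := h
      obtain ⟨-, -, x, hx, x', hx', e1⟩ := rectWord_mem hy
      obtain ⟨i, hi, hx'⟩ := mem_concatUp hx'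
      rw [sub_eq_zero, Units.val_eq_one, e1, mul_inv_eq_one] at h0
      exact ha j i (by omega) x hx (h0 ▸ hx')
    have hlG : ∀ x ∈ l, x.1 ∈ {g | e (j + 1) ≤ g ∧ g + 1 < blockSum e j (m + 1 + 1)} := by
      intro x hx
      rw [hl, List.mem_map] at hx
      obtain ⟨y, hy, rfl⟩ := hx
      obtain ⟨h1, h2, -⟩ := rectWord_mem hy
      rw [length_concatUp] at h2
      simp only [Set.mem_ofPred_eq]
      simp only [he] at hN hM ⊢
      omega
    have hδG : demDelta e j m ∈ demSub {g | e (j + 1) ≤ g ∧ g + 1 < blockSum e j (m + 1 + 1)} := by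
      refine mem_demSub_of_mem_algSub (hprod_mem_algSub hlG) ?_
      have h1 : l.length ≤ length (demDelta e j m).perm := by
        rw [hlen]
        refine mul_le_length (c := e (j + 1)) (demDelta e j m).finSupp (fun p => ?_)
          fun p hp hp' => ?_ <;>
        · rw [demDelta_apply]
          have : blockSum e j (m + 2) = e j + blockSum e (j + 1) (m + 1) := rfl
          split_ifs <;> omega
      have h2 := length_prod_le (l.map Prod.fst)
      rw [List.map_map, List.length_map] at h2
      have h3 := le_antisymm ((congrArg length hword).symm.le.trans h2) h1
      rwa [← cf_perm, cf_hprod_of_length_eq (demDelta e j m).finSupp h3, if_pos hword]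
    refine ⟨topCoeff l * C, mul_ne_zero htop hC, fun z hzT => ?_⟩
    rw [stairQuot_succ, Units.val_mul, Units.val_mul, hprodUnit_val, ← hl, altProd]
    set X := (pairQuot a j : HeckeAlg K)
    set Y := (stairQuot a (j + 1) m : HeckeAlg K)
    set Y' := altProd e (fun i => (pairQuot a i : HeckeAlg K)) (j + 1) m
    set T := basisElt K (demDelta e j m)
    have hX : X ∈ algSub K {g | g + 1 < e j + e (j + 1)} := val_mem_algSub (pairQuot_mem a j)
    have hY : Y ∈ algSub K {g | g + 1 < blockSum e (j + 1) (m + 1)} :=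
      val_mem_algSub (stairQuot_mem a (j + 1) m)
    have hY' : Y' ∈ algSub K {g | g + 1 < blockSum e (j + 1) (m + 1)} :=
      altProd_mem (fun i => val_mem_algSub (pairQuot_mem a i)) _ _
    -- a term of `hprod l` that contributes has at least as many inversions as `l` has letters
    have s1 : cf z (X * ((hprod l - topCoeff l • T) * Y)) = 0 := by
      refine cf_mul_eq_zero fun x v hx hv hxv => ?_
      obtain ⟨u, y, hu, hy, rfl⟩ := exists_of_coeff_mul_ne_zero hv
      have hx' := mem_demSub_of_mem_algSub hX hx
      have hy' := mem_demSub_of_mem_algSub hY hy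
      have hu' := mem_demSub_of_mem_algSub
        (sub_mem (hprod_mem_algSub hlG) (Subalgebra.smul_mem _ (basisElt_mem_algSub hδG) _)) hu
      apply hu
      have hlu : l.length ≤ length u.perm := by
        rw [hlen]
        refine mul_le_length (c := e (j + 1)) u.finSupp
          (permSub_lt_iff (perm_mem_permSub hu') fun g hg => by
            simp only [Set.mem_ofPred_eq] at hg; omega) fun p hp hp' => ?_
        have h1 := hzT 1 le_rfl (by omega) p (by simpa [hM] using hp) (by omega)
        obtain ⟨x', hx'', e1⟩ := exists_mul_left hx' (u * y)
        obtain ⟨y', hy'', e2⟩ := exists_mul_right hy' u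
        have h2 : blockSum e j (1 + 1) = e j + e (j + 1) := rfl
        rw [← hxv, e1, e2, Perm.mul_apply, Perm.mul_apply, permSub_fix hy'' (fun g hg => by
          simp only [Set.mem_ofPred_eq] at hg; omega), permSub_lt_iff hx'' (fun g hg => by
          simp only [Set.mem_ofPred_eq] at hg; omega)] at h1
        omega
      rw [← cf_perm, cf_sub, cf_smul, cf_single]
      rcases hlu.lt_or_eq with h | h
      · rw [cf_hprod_eq_zero h, if_neg, mul_zero, sub_zero]
        intro h2
        rw [← h2, ← hword] at h
        have := length_prod_le (l.map Prod.fst)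
        rw [List.map_map, List.length_map] at this
        exact absurd h (not_lt.2 this)
      · rw [cf_hprod_of_length_eq u.finSupp h.symm, hword]
        split_ifs <;> simp
    -- the terms of `Y` and `Y'` that contribute satisfy the bound, so induction applies to them
    have s2 : cf z (X * (T * (Y - C • Y'))) = 0 := by
      refine cf_mul_eq_zero fun x v hx hv hxv => ?_
      obtain ⟨u, y, hu, hy, rfl⟩ := exists_of_coeff_mul_ne_zero hv
      have hu' : u = demDelta e j m := by
        by_contra hne
        apply hu
        rw [← cf_perm, cf_single, if_neg]
        exact fun h => hne (Dem.ext h).symm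
      subst hu'
      have hx' := mem_demSub_of_mem_algSub hX hx
      have hy' := mem_demSub_of_mem_algSub (sub_mem hY (Subalgebra.smul_mem _ hY' C)) hy
      apply hy
      rw [← cf_perm, cf_sub, cf_smul, hz y.perm (hzT.of_mul hx' hy' hxv), sub_self]
    rw [sub_mul, mul_sub, cf_sub, sub_eq_zero, smul_mul_assoc, mul_smul_comm, cf_smul] at s1
    rw [mul_sub, mul_sub, cf_sub, sub_eq_zero, mul_smul_comm, mul_smul_comm, cf_smul] at s2
    rw [mul_assoc, s1, s2, mul_assoc X, mul_assoc]

end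

section

variable {R : Type*} [CommRing R]

/-! ### Replacing the factors of the alternating product by stable ones -/

/-- The product of the `descUnit (k - 1) x⁻¹` over the entries `x` of a list. -/
def descUnits (k : ℕ) (l : List Rˣ) : (HeckeAlg R)ˣ := (l.map fun x => descUnit (k - 1) x⁻¹).prod

lemma exists_descUnit_add (o d : ℕ) (u : Rˣ) :
    ∃ T ∈ unitSub R {g | o ≤ g ∧ g < o + d}, descUnit (o + d) u = T * descUnit o u := by
  induction d with
  | zero => exact ⟨1, one_mem _, by simp⟩
  | succ d ih =>
    obtain ⟨T, hT, e⟩ := ih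
    have h1 : hUnit (o + d) u ∈ unitSub R {g | o ≤ g ∧ g < o + (d + 1)} :=
      hUnit_mem (show o ≤ o + d ∧ o + d < o + (d + 1) by omega) u
    refine ⟨hUnit (o + d) u * T, mul_mem h1 (unitSub_mono (fun g hg => ?_) hT), ?_⟩
    · simp only [Set.mem_ofPred_eq] at hg ⊢; omega
    rw [← add_assoc, descUnit_succ, e, mul_assoc]

/-- Rows of equal length are the rows of a staircase, up to generators `≥ o`. -/
lemma exists_descUnits_eq {n : ℕ} (o : ℕ) (l : List Rˣ) (h : o + l.length ≤ n) :
    ∃ T ∈ unitSub R {g | o ≤ g ∧ g + 1 < n}, descUnits n l = T * stair o l := by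
  induction l generalizing o with
  | nil => exact ⟨1, one_mem _, by simp [descUnits, stair]⟩
  | cons x l ih =>
    rw [List.length_cons] at h
    obtain ⟨T, hT, e⟩ := ih (o + 1) (by omega)
    obtain ⟨T', hT', e'⟩ := exists_descUnit_add o (n - 1 - o) x⁻¹
    rw [show o + (n - 1 - o) = n - 1 by omega] at e' hT'
    have c : T * descUnit o x⁻¹ = descUnit o x⁻¹ * T :=
      unitSub_commute (fun g hg g' hg' => by
        simp only [Set.mem_ofPred_eq] at hg hg'; omega) hT (descUnit_mem o x⁻¹)
    refine ⟨T' * T, mul_mem (unitSub_mono (fun g hg => ?_) hT')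
      (unitSub_mono (fun g hg => ?_) hT), ?_⟩
    · simp only [Set.mem_ofPred_eq] at *; omega
    · simp only [Set.mem_ofPred_eq] at *; omega
    · have e2 : descUnits n (x :: l) = descUnit (n - 1) x⁻¹ * descUnits n l := by simp [descUnits]
      rw [e2, e, e', stair, mul_assoc, ← mul_assoc (descUnit o _), ← c]
      simp only [mul_assoc]

/-- The element whose coefficients are, up to sign, the stable double Grothendieck polynomials in
the blocks `a_{j+1}` and `a_j`. -/
def stablePair (a : ℕ → List Rˣ) (j : ℕ) : (HeckeAlg R)ˣ :=
  descUnits ((a j).length + (a (j + 1)).length) (a (j + 1)) *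
    (descUnits ((a j).length + (a (j + 1)).length) (a j))⁻¹

lemma descUnits_mem (k : ℕ) (l : List Rˣ) : descUnits k l ∈ unitSub R {g | g + 1 < k} := by
  refine Subgroup.list_prod_mem _ fun x hx => ?_
  obtain ⟨y, -, rfl⟩ := List.mem_map.1 hx
  refine unitSub_mono (fun g hg => ?_) (descUnit_mem (k - 1) _)
  simp only [Set.mem_ofPred_eq] at *
  omega

lemma stablePair_mem (a : ℕ → List Rˣ) (j : ℕ) :
    stablePair a j ∈ unitSub R {g | g + 1 < (a j).length + (a (j + 1)).length} :=
  mul_mem (descUnits_mem _ _) (inv_mem (descUnits_mem _ _))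

/-- The rows of both factors of `stablePair` are cut down to those of staircases. The remaining
factors involve only generators exchanging neighbours inside one block. -/
lemma exists_stablePair_eq (a : ℕ → List Rˣ) (j : ℕ) :
    ∃ T ∈ unitSub R {g | (a j).length ≤ g ∧ g + 1 < (a j).length + (a (j + 1)).length},
    ∃ T' ∈ unitSub R {g | (a (j + 1)).length ≤ g ∧ g + 1 < (a j).length + (a (j + 1)).length},
      stablePair a j = (stair 0 (a j))⁻¹ * T * pairQuot a j * stair 0 (a (j + 1)) * T' := by
  obtain ⟨T, hT, e⟩ := exists_descUnits_eq (R := R) (a j).length (a (j + 1)) le_rfl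
  obtain ⟨T', hT', e'⟩ := exists_descUnits_eq (R := R) (a (j + 1)).length (a j)
    (add_comm (a (j + 1)).length (a j).length).le
  refine ⟨T, hT, T'⁻¹, inv_mem hT', ?_⟩
  have c : T * (stair 0 (a j))⁻¹ = (stair 0 (a j))⁻¹ * T :=
    unitSub_commute (fun g hg g' hg' => by
      simp only [Set.mem_ofPred_eq] at hg hg'; omega) hT (inv_mem (stair_mem 0 (a j)))
  rw [stablePair, e, e', pairQuot, ← c, stair_append, stair_append, zero_add, zero_add]
  group

lemma basisElt_commute_unit {δ : Dem} {G : Set ℕ}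
    (h : ∀ g ∈ G, δ.perm g = g ∧ δ.perm (g + 1) = g + 1) {U : (HeckeAlg R)ˣ}
    (hU : U ∈ unitSub R G) : basisElt R δ * (U : HeckeAlg R) = (U : HeckeAlg R) * basisElt R δ := by
  refine unitSub_induction (R := R) (G := G)
    (p := fun U => basisElt R δ * (U : HeckeAlg R) = (U : HeckeAlg R) * basisElt R δ)
    (by simp) ?_ hU
  intro U e g hg u
  obtain ⟨h1, h2⟩ := h g hg
  rw [Units.val_mul, ← mul_assoc, e, mul_assoc, hUnit_val, basisElt_mul_hgen h1 h2, mul_assoc]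

/-- The generators exchanging neighbours inside the blocks of values of sizes
`e_{j+1}, …, e_{j+m}`, which follow the first `e_j` values. -/
def leftSlots (e : ℕ → ℕ) (j m : ℕ) : Set ℕ :=
  {g | ∃ i, 1 ≤ i ∧ i ≤ m ∧ blockSum e j i ≤ g ∧ g + 1 < blockSum e j (i + 1)}

/-- The generators exchanging neighbours inside the blocks of positions of sizes
`e_{j+m}, …, e_{j+1}, e_j`, taken in this order. -/
def rightSlots (e : ℕ → ℕ) (j m : ℕ) : Set ℕ :=
  {g | ∃ i ≤ m, blockSum e (j + i + 1) (m - i) ≤ g ∧ g + 1 < blockSum e (j + i) (m + 1 - i)}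

lemma leftSlots_lt {e : ℕ → ℕ} {j m g : ℕ} (h : g ∈ leftSlots e j m) :
    e j ≤ g ∧ g + 1 < blockSum e j (m + 1) := by
  obtain ⟨i, h1, h2, h3, h4⟩ := h
  have := blockSum_mono e j (show i + 1 ≤ m + 1 by omega)
  have h5 := blockSum_mono e j h1
  have : blockSum e j 1 = e j := rfl
  omega

/-- The alternating product of the `stablePair`s agrees with that of the `pairQuot`s, up to factors
that do not affect coefficients of permutations increasing on blocks. -/
lemma exists_altProd_stablePair (a : ℕ → List Rˣ) (j m : ℕ) :
    ∃ U ∈ unitSub R (leftSlots (fun i => (a i).length) j m),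
    ∃ V ∈ unitSub R (rightSlots (fun i => (a i).length) j m),
      altProd (fun i => (a i).length) (fun i => (stablePair a i : HeckeAlg R)) j m =
        ((stair 0 (a j))⁻¹ : (HeckeAlg R)ˣ) * U *
          altProd (fun i => (a i).length) (fun i => (pairQuot a i : HeckeAlg R)) j m * V := by
  induction m generalizing j with
  | zero =>
    refine ⟨1, one_mem _, stair 0 (a j), unitSub_mono (fun g hg => ?_) (stair_mem 0 (a j)), ?_⟩
    · refine ⟨0, le_rfl, Nat.zero_le _, ?_⟩
      simp only [Set.mem_ofPred_eq] at hg
      simp only [blockSum, add_zero]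
      omega
    · simp [altProd]
  | succ m ih =>
    obtain ⟨U, hU, V, hV, hUV⟩ := ih (j + 1)
    set e : ℕ → ℕ := fun i => (a i).length with he
    obtain ⟨T, hT, T', hT', hTT⟩ := exists_stablePair_eq a j
    have hM : blockSum e (j + 1) (m + 1) = e (j + 1) + blockSum e (j + 2) m := rfl
    have hN : blockSum e j (m + 1 + 1) = e j + blockSum e (j + 1) (m + 1) := rfl
    have hN' : blockSum e j (m + 2) = e j + blockSum e (j + 1) (m + 1) := rfl
    have hejs : ∀ i, (a i).length = e i := fun _ => rfl
    -- `T'` passes `τ_δ` to the right, into the block of the last `e_j` positions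
    obtain ⟨T'', hT'', e1⟩ := exists_unit_mul_basisElt (δ := demDelta e j m)
      (G' := {g | blockSum e (j + 1) (m + 1) ≤ g ∧ g + 1 < blockSum e j (m + 1 + 1)})
      (fun g hg => ⟨g + blockSum e (j + 2) m, by
        simp only [Set.mem_ofPred_eq, hejs] at hg ⊢; omega, by
        simp only [Set.mem_ofPred_eq, hejs] at hg
        rw [demDelta_apply, demDelta_apply]
        split_ifs <;> omega⟩) hT'
    -- `U` passes `τ_δ` to the left, its generators being shifted by `e_j`
    obtain ⟨U', hU', e2⟩ := exists_basisElt_mul_unit (δ := demDelta e j m)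
      (G' := {g | ∃ i, 2 ≤ i ∧ i ≤ m + 1 ∧ blockSum e j i ≤ g ∧ g + 1 < blockSum e j (i + 1)})
      (fun g hg => by
        have h0 := leftSlots_lt hg
        obtain ⟨i, h1, h2, h3, h4⟩ := hg
        have h5 : blockSum e j (i + 1) = e j + blockSum e (j + 1) i := rfl
        have h6 : blockSum e j (i + 1 + 1) = e j + blockSum e (j + 1) (i + 1) := rfl
        refine ⟨g + e j, ⟨i + 1, by omega, by omega, by omega, by omega⟩, ?_⟩
        rw [demDelta_apply, demDelta_apply]
        split_ifs <;> omega) hU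
    -- the staircase products in `a_{j+1}` on both sides of `τ_δ` cancel
    have e3 := basisElt_commute_unit (δ := demDelta e j m) (G := {g | g + 1 < e (j + 1)})
      (fun g hg => by
        simp only [Set.mem_ofPred_eq] at hg
        rw [demDelta_apply, demDelta_apply]
        split_ifs <;> omega)
      (unitSub_mono (fun g hg => by
        simpa only [zero_add] using hg) (inv_mem (stair_mem (R := R) 0 (a (j + 1)))))
    set Y := altProd e (fun i => (pairQuot a i : HeckeAlg R)) (j + 1) m with hYdef
    set S1 := stair 0 (a (j + 1)) with hS1
    have hY : Y ∈ algSub R {g | g + 1 < blockSum e (j + 1) (m + 1)} :=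
      altProd_mem (fun i => val_mem_algSub (pairQuot_mem a i)) _ _
    have hS1' : (S1⁻¹ : (HeckeAlg R)ˣ) ∈ unitSub R {g | g + 1 < blockSum e (j + 1) (m + 1)} :=
      unitSub_mono (fun g hg => by
        simp only [Set.mem_ofPred_eq, hejs] at hg ⊢; omega) (inv_mem (stair_mem 0 (a (j + 1))))
    have hU1 : U ∈ unitSub R {g | g + 1 < blockSum e (j + 1) (m + 1)} :=
      unitSub_mono (fun g hg => (leftSlots_lt hg).2) hU
    have c1 : (T'' : HeckeAlg R) * ((S1⁻¹ : (HeckeAlg R)ˣ) * (U : HeckeAlg R) * Y) =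
        (S1⁻¹ : (HeckeAlg R)ˣ) * (U : HeckeAlg R) * Y * T'' :=
      commute_of_mem_algSub (fun g hg g' hg' => by
        simp only [Set.mem_ofPred_eq] at hg hg'; omega) (val_mem_algSub hT'')
        (mul_mem (mul_mem (val_mem_algSub hS1') (val_mem_algSub hU1)) hY)
    have c2 : (pairQuot a j : HeckeAlg R) * (U' : HeckeAlg R) = U' * (pairQuot a j : HeckeAlg R) :=
      commute_of_mem_algSub (fun g hg g' hg' => by
        obtain ⟨i, h1, h2, h3, h4⟩ := hg'
        have h5 := blockSum_mono e j h1
        have h6 : blockSum e j 2 = e j + (e (j + 1) + 0) := rfl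
        simp only [Set.mem_ofPred_eq, hejs] at hg; omega) (val_mem_algSub (pairQuot_mem a j))
        (val_mem_algSub hU')
    have hTL : T ∈ unitSub R (leftSlots e j (m + 1)) := by
      refine unitSub_mono (fun g hg => ?_) hT
      refine ⟨1, le_rfl, by omega, ?_⟩
      have h5 : blockSum e j 1 = e j := rfl
      have h6 : blockSum e j (1 + 1) = e j + (e (j + 1) + 0) := rfl
      simp only [Set.mem_ofPred_eq, hejs] at hg
      omega
    have hUL : U' ∈ unitSub R (leftSlots e j (m + 1)) := by
      refine unitSub_mono (fun g hg => ?_) hU'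
      obtain ⟨i, h1, h2, h3⟩ := hg
      exact ⟨i, by omega, h2, h3⟩
    have hTR : T'' ∈ unitSub R (rightSlots e j (m + 1)) := by
      refine unitSub_mono (fun g hg => ?_) hT''
      exact ⟨0, by omega, by simpa using hg⟩
    have hVR : V ∈ unitSub R (rightSlots e j (m + 1)) := by
      refine unitSub_mono (fun g hg => ?_) hV
      obtain ⟨i, h1, h2⟩ := hg
      refine ⟨i + 1, by omega, ?_⟩
      rw [show j + (i + 1) + 1 = j + 1 + i + 1 by omega, show m + 1 - (i + 1) = m - i by omega,
        show j + (i + 1) = j + 1 + i by omega, show m + 1 + 1 - (i + 1) = m + 1 - i by omega]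
      exact h2
    refine ⟨T * U', mul_mem hTL hUL, T'' * V, mul_mem hTR hVR, ?_⟩
    rw [altProd, altProd, hUV, ← hYdef, hTT]
    simp only [Units.val_mul]
    have c3 : (S1 : HeckeAlg R) * ((S1⁻¹ : (HeckeAlg R)ˣ) : HeckeAlg R) = 1 := Units.mul_inv S1
    set τ := basisElt R (demDelta e j m)
    set S0 := (((stair 0 (a j))⁻¹ : (HeckeAlg R)ˣ) : HeckeAlg R)
    set P := (pairQuot a j : HeckeAlg R)
    set S1i := ((S1⁻¹ : (HeckeAlg R)ˣ) : HeckeAlg R)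
    calc S0 * T * P * S1 * T' * τ * (S1i * U * Y * V)
        = S0 * T * P * S1 * (T' * τ) * (S1i * U * Y) * V := by simp only [mul_assoc]
      _ = S0 * T * P * S1 * τ * (T'' * (S1i * U * Y)) * V := by rw [e1]; simp only [mul_assoc]
      _ = S0 * T * P * S1 * (τ * S1i) * U * Y * T'' * V := by rw [c1]; simp only [mul_assoc]
      _ = S0 * T * P * (S1 * S1i) * (τ * U) * Y * T'' * V := by rw [e3]; simp only [mul_assoc]
      _ = S0 * T * (P * U') * τ * Y * T'' * V := by
        rw [c3, e2, mul_one]; simp only [mul_assoc]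
      _ = S0 * (T * U') * (P * τ * Y) * (T'' * V) := by rw [c2]; simp only [mul_assoc]

/-- Both products have the same coefficients at permutations increasing on blocks of positions, and
with inverse increasing on blocks of values. -/
lemma cf_altProd_stablePair (a : ℕ → List Rˣ) (n : ℕ) {z : Perm ℕ}
    (hl : ∀ i ≤ n, ∀ g, blockSum (fun i => (a i).length) 0 i ≤ g →
      g + 1 < blockSum (fun i => (a i).length) 0 (i + 1) → z⁻¹ g < z⁻¹ (g + 1))
    (hr : ∀ i ≤ n, ∀ g, blockSum (fun i => (a i).length) (i + 1) (n - i) ≤ g →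
      g + 1 < blockSum (fun i => (a i).length) i (n + 1 - i) → z g < z (g + 1)) :
    cf z (altProd (fun i => (a i).length) (fun i => (stablePair a i : HeckeAlg R)) 0 n) =
      cf z (altProd (fun i => (a i).length) (fun i => (pairQuot a i : HeckeAlg R)) 0 n) := by
  obtain ⟨U, hU, V, hV, e⟩ := exists_altProd_stablePair a 0 n
  rw [e, cf_mul_unit _ hV, mul_assoc, cf_unit_mul _ (inv_mem (stair_mem 0 (a 0))),
    cf_unit_mul _ hU]
  · rintro g ⟨i, h1, h2, h3, h4⟩
    exact hl i h2 g h3 h4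
  · intro g hg
    refine hl 0 (Nat.zero_le _) g (Nat.zero_le _) ?_
    simpa [blockSum] using hg
  · rintro g ⟨i, h1, h2, h3⟩
    rw [zero_add] at h2 h3
    exact hr i h1 g h2 h3

/-! ### The coefficient of the product of the block exchanges -/

/-- The product of the block exchanges occurring in `altProd`. -/
def deltaProd (e : ℕ → ℕ) : ℕ → ℕ → Perm ℕ
  | _, 0 => 1
  | j, m + 1 => (demDelta e j m).perm * deltaProd e (j + 1) m

lemma deltaProd_fix (e : ℕ → ℕ) (j m p : ℕ) (hp : blockSum e j (m + 1) ≤ p) :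
    deltaProd e j m p = p := by
  induction m generalizing j with
  | zero => rfl
  | succ m ih =>
    have hN : blockSum e j (m + 1 + 1) = e j + blockSum e (j + 1) (m + 1) := rfl
    have hN' : blockSum e j (m + 2) = e j + blockSum e (j + 1) (m + 1) := rfl
    rw [deltaProd, Perm.mul_apply, ih _ (by omega), demDelta_apply]
    split_ifs <;> omega

lemma deltaProd_inv_lt (e : ℕ → ℕ) (j m g : ℕ) (hg : g + 1 < e j + e (j + 1)) :
    (deltaProd e j m)⁻¹ g < (deltaProd e j m)⁻¹ (g + 1) := by
  induction m generalizing j g with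
  | zero => simp [deltaProd]
  | succ m ih =>
    have hM : blockSum e (j + 1) (m + 1) = e (j + 1) + blockSum e (j + 2) m := rfl
    have hN' : blockSum e j (m + 2) = e j + blockSum e (j + 1) (m + 1) := rfl
    have h1 : ∀ g, e (j + 1) ≤ g → g < e j + e (j + 1) →
        (deltaProd e j (m + 1))⁻¹ g = g + blockSum e (j + 2) m := by
      intro g h1 h2
      rw [Perm.inv_eq_iff_eq, deltaProd, Perm.mul_apply, deltaProd_fix _ _ _ _ (by omega),
        demDelta_apply]
      split_ifs <;> omega
    have h2 : ∀ g, g < e (j + 1) →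
        (deltaProd e j (m + 1))⁻¹ g = (deltaProd e (j + 1) m)⁻¹ g := by
      intro g h1
      rw [Perm.inv_eq_iff_eq, deltaProd, Perm.mul_apply, ← Perm.mul_apply (deltaProd e (j + 1) m),
        mul_inv_cancel, Perm.one_apply, demDelta_apply]
      split_ifs <;> omega
    rcases Nat.lt_or_ge (g + 1) (e (j + 1)) with h | h
    · rw [h2 _ (by omega), h2 _ h]
      exact ih _ _ (by omega)
    · rcases Nat.lt_or_ge g (e (j + 1)) with h' | h'
      · rw [h2 _ h', h1 _ h hg]
        have := perm_lt (inv_fix (deltaProd_fix e (j + 1) m)) (p := g) (by omega)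
        omega
      · rw [h1 _ h' (by omega), h1 _ h hg]; omega

/-- If `δ` is increasing on the first `M` integers, multiplication by `τ_δ` on the left of elements
supported on `S_M` just translates coefficients. -/
lemma cf_basisElt_mul {M : ℕ} {δ : Dem} (hδ : ∀ p q, p < q → q < M → δ.perm p < δ.perm q)
    {y : Perm ℕ} (hy : ∀ p, M ≤ p → y p = p) {Y : HeckeAlg R} (hY : Y ∈ algSub R {g | g + 1 < M}) :
    cf (δ.perm * y) (basisElt R δ * Y) = cf y Y := by
  set v : Dem := ⟨y, M, hy⟩ with hv
  have hvG : v ∈ demSub {g | g + 1 < M} := mem_demSub_of_fix v hy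
  have h : cf (δ.perm * y) (basisElt R δ * (Y - cf y Y • basisElt R v)) = 0 := by
    refine cf_mul_eq_zero fun u x hu hx hux => ?_
    have hu' : u = δ := by
      by_contra hne
      apply hu
      rw [← cf_perm, cf_single, if_neg]
      exact fun h => hne (Dem.ext h).symm
    subst hu'
    have hx' := mem_demSub_of_mem_algSub
      (sub_mem hY (Subalgebra.smul_mem _ (basisElt_mem_algSub hvG) _)) hx
    rw [mul_perm_of_strictMonoOn hδ hx'] at hux
    have : x = v := Dem.ext (mul_left_cancel hux)
    subst this
    apply hx
    rw [← cf_perm, cf_sub, cf_smul, cf_single, if_pos rfl, mul_one, sub_self]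
  rw [mul_sub, cf_sub, sub_eq_zero] at h
  rw [h, mul_smul_comm, cf_smul, MonoidAlgebra.single_mul_single, cf_single, if_pos, mul_one,
    mul_one]
  rw [mul_perm_of_strictMonoOn hδ hvG]

/-- The first factor `pairQuot` and the following block exchange can be removed in turn. -/
lemma cf_deltaProd (a : ℕ → List Rˣ) (j m : ℕ) :
    cf (deltaProd (fun i => (a i).length) j m)
      (altProd (fun i => (a i).length) (fun i => (pairQuot a i : HeckeAlg R)) j m) = 1 := by
  induction m generalizing j with
  | zero => rw [altProd, cf_one, if_pos]; rfl
  | succ m ih =>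
    set e : ℕ → ℕ := fun i => (a i).length with he
    rw [altProd, mul_assoc, cf_unit_mul _ (pairQuot_mem a j), deltaProd,
      cf_basisElt_mul (M := blockSum e (j + 1) (m + 1)), ih]
    · intro p q hpq hq
      rw [demDelta_apply, demDelta_apply]
      have hM : blockSum e (j + 1) (m + 1) = e (j + 1) + blockSum e (j + 2) m := rfl
      have hN' : blockSum e j (m + 2) = e j + blockSum e (j + 1) (m + 1) := rfl
      split_ifs <;> omega
    · exact deltaProd_fix e (j + 1) m
    · exact altProd_mem (fun i => val_mem_algSub (pairQuot_mem a i)) _ _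
    · exact fun g hg => deltaProd_inv_lt e j (m + 1) g hg

end

section

/-! ### Expansion of the alternating product over KMS-factorizations -/

lemma heckeProd_map_perm (l : List Dem) : heckeProd (l.map Dem.perm) = l.prod.perm := by
  induction l using List.reverseRecOn with
  | nil => rfl
  | append_singleton l x ih =>
    rw [heckeProd] at ih ⊢
    rw [List.map_append, List.foldl_append, ih, List.prod_append, Dem.mul_perm]
    simp

lemma prod_flatMap_pair {M ι : Type*} [Monoid M] (l : List ι) (f g : ι → M) :
    (l.flatMap fun i => [f i, g i]).prod = (l.map fun i => f i * g i).prod := by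
  induction l with
  | nil => rfl
  | cons x l ih => simp [ih, mul_assoc]

/-- Expansion of an ordered product of sums. -/
lemma prod_finRange_sum {S : Type*} [Semiring S] {n : ℕ} {α : Fin n → Type*} [∀ i, Fintype (α i)]
    (f : (i : Fin n) → α i → S) :
    ((List.finRange n).map fun i => ∑ x, f i x).prod =
      ∑ w : (i : Fin n) → α i, ((List.finRange n).map fun i => f i (w i)).prod := by
  induction n with
  | zero => simp
  | succ n ih =>
    rw [List.finRange_succ, List.map_cons, List.prod_cons, List.map_map]
    have := ih fun i => f i.succ
    rw [show ((fun i => ∑ x, f i x) ∘ Fin.succ) = fun i : Fin n => ∑ x, f i.succ x from rfl, this,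
      ← (Fin.consEquiv α).sum_comp, Fintype.sum_prod_type, Finset.sum_mul]
    refine Finset.sum_congr rfl fun x _ => ?_
    rw [Finset.mul_sum]
    refine Finset.sum_congr rfl fun w _ => ?_
    rw [List.map_cons, List.prod_cons, List.map_map]
    rfl

variable {R : Type*} [CommRing R]

/-- The permutations in `S_k`, as elements of the Demazure monoid. -/
def demEmbed {k : ℕ} (w : Perm (Fin k)) : Dem := ⟨embed w, k, fun _ hp => embed_of_ge w hp⟩

/-- An element of the Hecke algebra of `S_k` as a linear combination of the `τ_w` with `w ∈ S_k`. -/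
lemma eq_sum_embed {k : ℕ} {X : HeckeAlg R} (hX : X ∈ algSub R {g | g + 1 < k}) :
    X = ∑ w : Perm (Fin k), MonoidAlgebra.single (demEmbed w) (cf (embed w) X) := by
  classical
  have key : ∀ v : Dem, X.coeff v =
      cf v.perm (∑ w : Perm (Fin k), MonoidAlgebra.single (demEmbed w) (cf (embed w) X)) := by
    intro v
    have hsum : cf v.perm (∑ w : Perm (Fin k), MonoidAlgebra.single (demEmbed w) (cf (embed w) X)) =
        ∑ w : Perm (Fin k), if embed w = v.perm then cf (embed w) X else 0 := by
      rw [cf_perm, MonoidAlgebra.coeff_sum, Finsupp.finsetSum_apply]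
      refine Finset.sum_congr rfl fun w _ => ?_
      rw [← cf_perm, cf_single]
      rfl
    rw [hsum]
    by_cases hv : X.coeff v = 0
    · rw [hv, Finset.sum_eq_zero]
      intro w _
      split_ifs with h
      · rw [h, cf_perm, hv]
      · rfl
    · have hv' := perm_mem_permSub (mem_demSub_of_mem_algSub hX hv)
      obtain ⟨u, hu⟩ := exists_embed_eq (m := k) (w := v.perm) fun p hp =>
        permSub_fix hv' fun g hg => by simp only [Set.mem_ofPred_eq] at hg; omega
      rw [Finset.sum_eq_single u, if_pos hu, hu, cf_perm]
      · intro w _ hw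
        rw [if_neg]
        exact fun h => hw (embed_injective (h.trans hu.symm))
      · simp
  ext v
  rw [key, cf_perm]

lemma altProd_eq_prod (e : ℕ → ℕ) (X : ℕ → HeckeAlg R) (j m : ℕ) :
    altProd e X j m = ((List.finRange m).map fun i : Fin m =>
      X (j + i) * basisElt R (demDelta e (j + i) (m - 1 - i))).prod := by
  induction m generalizing j with
  | zero => rfl
  | succ m ih =>
    rw [altProd, ih, List.finRange_succ, List.map_cons, List.prod_cons, List.map_map]
    congr 2
    refine List.map_congr_left fun i _ => ?_
    simp only [Function.comp_apply, Fin.val_succ]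
    rw [show j + 1 + (i : ℕ) = j + (i + 1) by omega,
      show m + 1 - 1 - ((i : ℕ) + 1) = m - 1 - i by omega]

lemma prod_single {ι : Type*} (l : List ι) (c : ι → R) (v : ι → Dem) :
    (l.map fun i => (MonoidAlgebra.single (v i) (c i) : HeckeAlg R)).prod =
      MonoidAlgebra.single (l.map v).prod (l.map c).prod := by
  induction l with
  | nil => rfl
  | cons x l ih => simp [ih, MonoidAlgebra.single_mul_single]

open Classical in
/-- The coefficients of an alternating product are sums over factorizations for the absolute Hecke
product. -/
lemma cf_altProd_eq_sum {n : ℕ} (e : ℕ → ℕ) (X : ℕ → HeckeAlg R)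
    (hX : ∀ j, X j ∈ algSub R {g | g + 1 < e j + e (j + 1)}) (z : Perm ℕ) :
    cf z (altProd e X 0 n) =
      ∑ w : (i : Fin n) → Perm (Fin (e i + e (i + 1))) with
        heckeProd ((List.finRange n).flatMap fun i : Fin n =>
          [embed (w i), (demDelta e i (n - 1 - i)).perm]) = z,
        ∏ i : Fin n, cf (embed (w i)) (X i) := by
  have h1 : altProd e X 0 n = ((List.finRange n).map fun i : Fin n =>
      ∑ w : Perm (Fin (e i + e (i + 1))), (MonoidAlgebra.single
        (demEmbed w * demDelta e i (n - 1 - i)) (cf (embed w) (X i)) : HeckeAlg R)).prod := by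
    rw [altProd_eq_prod]
    congr 1
    refine List.map_congr_left fun i _ => ?_
    rw [zero_add]
    conv_lhs => rw [eq_sum_embed (hX i), Finset.sum_mul]
    refine Finset.sum_congr rfl fun w _ => ?_
    rw [MonoidAlgebra.single_mul_single, mul_one]
  have h2 : ∀ (s : Finset ((i : Fin n) → Perm (Fin (e i + e (i + 1))))) (F : _ → HeckeAlg R),
      cf z (∑ w ∈ s, F w) = ∑ w ∈ s, cf z (F w) := by
    intro s F
    induction s using Finset.induction_on with
    | empty => simp
    | insert w s hw ih => rw [Finset.sum_insert hw, Finset.sum_insert hw, cf_add, ih]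
  rw [h1, prod_finRange_sum, h2, Finset.sum_filter]
  refine Finset.sum_congr rfl fun w _ => ?_
  rw [prod_single, cf_single, ← prod_flatMap_pair, ← heckeProd_map_perm, List.map_flatMap]
  rw [← List.prod_ofFn, List.ofFn_eq_map]
  rfl

lemma blockSwap_mul (c A A' B : ℕ) :
    blockSwap c A B * blockSwap (c + A) A' B = blockSwap c (A + A') B := by
  ext p
  rw [Perm.mul_apply]
  simp only [blockSwap_apply]
  split_ifs <;> omega

lemma ext_of_le (r : ℕ → ℕ → ℕ) {i j : ℕ} (h : j ≤ i) :
    ext r i j = ∑ k ∈ Finset.Icc j i, r k k := by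
  rcases h.lt_or_eq with h | rfl
  · rw [ext, if_neg (by omega)]
  · simp [ext]

lemma ext_succ_of_le (r : ℕ → ℕ → ℕ) {i j : ℕ} (h : j ≤ i) :
    ext r (i + 1) j = ext r i j + r (i + 1) (i + 1) := by
  rw [ext_of_le r h, ext_of_le r (by omega), Finset.sum_Icc_succ_top (by omega)]

lemma ext_eq_add (r : ℕ → ℕ → ℕ) {i j : ℕ} (h : j + 1 ≤ i) :
    ext r i j = r j j + ext r i (j + 1) := by
  rw [ext_of_le r h, ext_of_le r (by omega), ← Finset.add_sum_Ioc_eq_sum_Icc (by omega)]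
  congr 1
  exact Finset.sum_congr (by ext; simp) fun _ _ => rfl

/-- The lower part of a column of block exchanges, all moving the block of size `r_{jj}`. -/
lemma prod_W (r : ℕ → ℕ → ℕ) (j m s : ℕ) (h : j + 1 ≤ s) :
    ((List.range' s m).map fun i => W r i (j + 1)).prod =
      blockSwap (ext r s (j + 1)) (blockSum (fun i => r i i) (s + 1) m) (r j j) := by
  induction m generalizing s with
  | zero =>
    ext p
    simp only [List.range'_zero, List.map_nil, List.prod_nil, Perm.one_apply, blockSum,
      blockSwap_apply]
    split_ifs <;> omega
  | succ m ih =>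
    rw [List.range'_succ, List.map_cons, List.prod_cons, ih _ (by omega), W,
      ext_succ_of_le r h, Nat.add_sub_cancel, Nat.add_sub_cancel_left, ext_eq_add r h,
      Nat.add_sub_cancel_right, blockSwap_mul, blockSum]

lemma delta_eq (n : ℕ) (r : ℕ → ℕ → ℕ) (j : ℕ) :
    delta n r (j + 1) = (demDelta (fun i => r i i) j (n - 1 - j)).perm := by
  rw [delta, prod_W r j _ _ le_rfl, demDelta, demBlock, show n - (j + 1) = n - 1 - j by omega]
  simp [ext]

open Classical in
lemma cf_conjZel_eq_sum (n : ℕ) (r : ℕ → ℕ → ℕ) (X : ℕ → HeckeAlg R)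
    (hX : ∀ j, X j ∈ algSub R {g | g + 1 < r j j + r (j + 1) (j + 1)}) :
    cf (conjZel n r) (altProd (fun i => r i i) X 0 n) =
      ∑ w : PermSeq n r with IsKMS n r w, ∏ i : Fin n, cf (embed (w i)) (X i) := by
  rw [cf_altProd_eq_sum _ _ hX]
  simp only [IsKMS, delta_eq]

end

section

/-! ### The columns of a Zelevinsky permutation -/

lemma perm_inv_apply (u : Perm ℕ) (p : ℕ) : u⁻¹ (u p) = p := u.symm_apply_apply p

/-- The inequalities between two neighbouring columns of rank conditions, extended by a row of
zeros in front. -/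
structure IsColumnPair (n : ℕ) (C D : ℕ → ℕ) : Prop where
  zero_left : C 0 = 0
  zero_right : D 0 = 0
  mono : ∀ i ≤ n, C i ≤ C (i + 1)
  le : ∀ i ≤ n + 1, C i ≤ D i
  convex : ∀ i ≤ n, D i + C (i + 1) ≤ D (i + 1) + C i

/-- The product of the first `m` block exchanges belonging to a pair of columns. -/
def columnPerm (C D : ℕ → ℕ) (m : ℕ) : Perm ℕ :=
  ((List.range m).map fun i =>
    blockSwap (C (i + 1)) (C (i + 1 + 1) - C (i + 1)) (D (i + 1) - C (i + 1))).prod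

variable {n : ℕ} {C D : ℕ → ℕ}

/-- The first `m` factors of a column shift the positions from `C i` to `C (i + 1)`, `i ≤ m`, to
consecutive places starting at `D i`, and the positions after these fill the gaps in increasing
order. -/
lemma columnPerm_spec (h : IsColumnPair n C D) {m : ℕ} (hm : m ≤ n) :
    (∀ i ≤ m, ∀ p, C i ≤ p → p < C (i + 1) → columnPerm C D m p = p + (D i - C i)) ∧
    (∀ p q, C (m + 1) ≤ p → p < q → columnPerm C D m p < columnPerm C D m q) ∧
    ∀ p, C (m + 1) + (D m - C m) ≤ p → columnPerm C D m p = p := by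
  induction m with
  | zero =>
    refine ⟨fun i hi p _ _ => ?_, fun p q _ hpq => hpq, fun p _ => rfl⟩
    obtain rfl : i = 0 := by omega
    rw [h.zero_left, h.zero_right]
    rfl
  | succ m ih =>
    obtain ⟨h1, h2, h3⟩ := ih (by omega)
    have hC : ∀ i ≤ m + 1, C i ≤ C (m + 1) := by
      intro i hi
      induction hi using Nat.decreasingInduction with
      | self => exact le_rfl
      | of_succ i hi ih => exact (h.mono i (by omega)).trans ih
    have hc1 := h.mono (m + 1) hm
    have hv := h.convex m (by omega)
    have hl := h.le (m + 1) (by omega)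
    have hl' := h.le m (by omega)
    have hW : columnPerm C D (m + 1) = columnPerm C D m *
        blockSwap (C (m + 1)) (C (m + 1 + 1) - C (m + 1)) (D (m + 1) - C (m + 1)) := by
      rw [columnPerm, List.range_succ, List.map_append, List.prod_append]
      simp [columnPerm]
    refine ⟨fun i hi p hp hp' => ?_, fun p q hp hpq => ?_, fun p hp => ?_⟩
    · rw [hW, Perm.mul_apply, blockSwap_apply]
      rcases hi.lt_or_eq with hi | rfl
      · have := hC (i + 1) (by omega)
        rw [if_neg (by omega), if_neg (by omega)]
        exact h1 i (by omega) p hp hp'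
      · rw [if_pos (by omega), h3 _ (by omega)]
    · rw [hW, Perm.mul_apply, Perm.mul_apply]
      refine h2 _ _ ?_ ?_ <;> simp only [blockSwap_apply] <;> split_ifs <;> omega
    · rw [hW, Perm.mul_apply, blockSwap_apply, if_neg (by omega), if_neg (by omega)]
      exact h3 p (by omega)

lemma IsColumnPair.apply (h : IsColumnPair n C D) {i p : ℕ} (hi : i ≤ n) (hp : C i ≤ p)
    (hp' : p < C (i + 1)) : columnPerm C D n p = p + (D i - C i) :=
  (columnPerm_spec h le_rfl).1 i hi p hp hp'

lemma IsColumnPair.lt_of_le (h : IsColumnPair n C D) {p q : ℕ} (hp : C (n + 1) ≤ p) (hpq : p < q) :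
    columnPerm C D n p < columnPerm C D n q :=
  (columnPerm_spec h le_rfl).2.1 p q hp hpq

lemma IsColumnPair.fix (h : IsColumnPair n C D) {p : ℕ} (hp : D (n + 1) ≤ p) :
    columnPerm C D n p = p :=
  (columnPerm_spec h le_rfl).2.2 p (by
    have := h.convex n le_rfl
    have := h.le n (by omega)
    omega)

lemma IsColumnPair.mono_right (h : IsColumnPair n C D) {i i' : ℕ} (hi : i ≤ i') (hi' : i' ≤ n + 1) :
    D i ≤ D i' := by
  induction hi with
  | refl => exact le_rfl
  | step hi ih =>
    rename_i m
    have := h.convex m (by omega)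
    have := h.mono m (by omega)
    exact (ih (by omega)).trans (show D m ≤ D (m + 1) by omega)

lemma IsColumnPair.mono_left (h : IsColumnPair n C D) {i i' : ℕ} (hi : i ≤ i') (hi' : i' ≤ n + 1) :
    C i ≤ C i' := by
  induction hi with
  | refl => exact le_rfl
  | step hi ih =>
    rename_i m
    exact (ih (by omega)).trans (h.mono m (by omega))

lemma IsColumnPair.exists_slot (h : IsColumnPair n C D) {i p : ℕ} (hi : i ≤ n + 1) (hp : p < C i) :
    ∃ i' < i, C i' ≤ p ∧ p < C (i' + 1) := by
  induction i with
  | zero => rw [h.zero_left] at hp; omega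
  | succ i ih =>
    rcases Nat.lt_or_ge p (C i) with hlt | hge
    · obtain ⟨i', h1, h2⟩ := ih (by omega) hlt
      exact ⟨i', by omega, h2⟩
    · exact ⟨i, by omega, hge, hp⟩

lemma IsColumnPair.apply_mem (h : IsColumnPair n C D) {i p : ℕ} (hi : i ≤ n) (hp : C i ≤ p)
    (hp' : p < C (i + 1)) : D i ≤ columnPerm C D n p ∧ columnPerm C D n p < D (i + 1) := by
  rw [h.apply hi hp hp']
  have := h.convex i hi
  have := h.le i (by omega)
  omega

lemma IsColumnPair.apply_lt (h : IsColumnPair n C D) {i p : ℕ} (hi : i ≤ n + 1) (hp : p < C i) :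
    columnPerm C D n p < D i := by
  obtain ⟨i', h1, h2, h3⟩ := h.exists_slot hi hp
  exact (h.apply_mem (by omega) h2 h3).2.trans_le (h.mono_right (by omega) hi)

lemma IsColumnPair.lt_of_lt (h : IsColumnPair n C D) {p q : ℕ} (hpq : p < q) (hq : q < C (n + 1)) :
    columnPerm C D n p < columnPerm C D n q := by
  obtain ⟨i, h1, h2, h3⟩ := h.exists_slot le_rfl hq
  rcases Nat.lt_or_ge p (C i) with hlt | hge
  · exact (h.apply_lt (by omega) hlt).trans_le (h.apply_mem (by omega) h2 h3).1
  · rw [h.apply (by omega) h2 h3, h.apply (by omega) hge (by omega)]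
    omega

/-- The inverse of a column permutation is increasing on blocks of values. -/
lemma IsColumnPair.inv_lt (h : IsColumnPair n C D) {i v w : ℕ} (hi : i ≤ n) (hv : D i ≤ v)
    (hvw : v < w) (hw : w < D (i + 1)) :
    (columnPerm C D n)⁻¹ v < (columnPerm C D n)⁻¹ w := by
  obtain ⟨p, rfl⟩ := (columnPerm C D n).surjective v
  obtain ⟨q, rfl⟩ := (columnPerm C D n).surjective w
  rw [perm_inv_apply, perm_inv_apply]
  by_contra hc
  have hne : p ≠ q := by rintro rfl; omega
  rcases Nat.lt_or_ge p (C (n + 1)) with hp | hp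
  · exact absurd (h.lt_of_lt (p := q) (q := p) (by omega) hp) (by omega)
  rcases Nat.lt_or_ge q (C (n + 1)) with hq | hq
  · obtain ⟨i', h1, h2, h3⟩ := h.exists_slot le_rfl hq
    have h4 := h.apply_mem (by omega) h2 h3
    have hii : i' = i := by
      by_contra hcon
      rcases Nat.lt_or_ge i' i with hlt | hge
      · have := h.mono_right (i := i' + 1) (i' := i) (by omega) (by omega)
        omega
      · have := h.mono_right (i := i + 1) (i' := i') (by omega) (by omega)
        omega
    subst hii
    have h5 := h.apply hi h2 h3
    have h6 := h.le i' (by omega)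
    -- the value of `p` would also be taken in the block of `q`
    have h7 := h.apply (p := columnPerm C D n p - (D i' - C i')) hi (by omega) (by omega)
    rw [Nat.sub_add_cancel (by omega)] at h7
    have := (columnPerm C D n).injective h7
    omega
  · exact absurd (h.lt_of_le (p := q) (q := p) hq (by omega)) (by omega)

/-- The positions taking a value in the `i`-th block form the `i`-th block of the next column,
except for some among the last positions. -/
lemma IsColumnPair.inv_mem (h : IsColumnPair n C D) {i v : ℕ} (hi : i ≤ n) (hv : D i ≤ v)
    (hv' : v < D (i + 1)) :
    C i ≤ (columnPerm C D n)⁻¹ v ∧ (columnPerm C D n)⁻¹ v < C (i + 1) ∨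
      C (n + 1) ≤ (columnPerm C D n)⁻¹ v := by
  obtain ⟨p, rfl⟩ := (columnPerm C D n).surjective v
  rw [perm_inv_apply]
  rcases Nat.lt_or_ge p (C (n + 1)) with hp | hp
  · left
    obtain ⟨i', h1, h2, h3⟩ := h.exists_slot le_rfl hp
    have h4 := h.apply_mem (by omega) h2 h3
    have hii : i' = i := by
      by_contra hcon
      rcases Nat.lt_or_ge i' i with hlt | hge
      · have := h.mono_right (i := i' + 1) (i' := i) (by omega) (by omega)
        omega
      · have := h.mono_right (i := i + 1) (i' := i') (by omega) (by omega)
        omega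
    exact hii ▸ ⟨h2, h3⟩
  · exact .inr hp

/-! ### Zelevinsky permutations -/

/-- The extended rank conditions with a row of zeros in front. -/
def extRow (r : ℕ → ℕ → ℕ) : ℕ → ℕ → ℕ
  | 0, _ => 0
  | i + 1, j => ext r i j

lemma isColumnPair {n : ℕ} {r : ℕ → ℕ → ℕ} (hr : IsRankConditions n r) {j : ℕ} (hj : j < n) :
    IsColumnPair n (fun i => extRow r i (j + 1)) (fun i => extRow r i j) := by
  have hle : ∀ i, ext r i (j + 1) ≤ ext r i j := by
    intro i
    rcases Nat.lt_or_ge i (j + 1) with h | h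
    · rw [ext, ext, if_pos (by omega), if_pos (by omega)]
      exact hr.le_left i j (by omega) (by omega)
    · rw [ext_eq_add r h]; omega
  refine ⟨rfl, rfl, fun i hi => ?_, fun i hi => ?_, fun i hi => ?_⟩
  · rcases i with _ | i
    · exact Nat.zero_le _
    · simp only [extRow]
      rcases Nat.lt_or_ge i (j + 1) with h | h
      · rw [ext, ext, if_pos (by omega), if_pos (by omega)]
        exact hr.le_right i j (by omega) (by omega)
      · rw [ext_succ_of_le r h]; omega
  · rcases i with _ | i
    · exact le_rfl
    · exact hle i
  · rcases i with _ | i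
    · simpa [extRow] using hle 0
    · simp only [extRow]
      rcases Nat.lt_trichotomy i j with h | rfl | h
      · rw [ext, ext, ext, ext, if_pos (by omega), if_pos (by omega), if_pos (by omega),
          if_pos (by omega)]
        exact hr.convex i j (by omega) (by omega)
      · rw [ext_succ_of_le r le_rfl]
        simp only [ext, le_refl, if_true]
        omega
      · rw [ext_succ_of_le r h.le, ext_succ_of_le r (show j + 1 ≤ i from h)]
        omega

/-- The product of the first `k` columns of the Zelevinsky permutation. -/
def zelColumns (n : ℕ) (r : ℕ → ℕ → ℕ) (k : ℕ) : Perm ℕ :=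
  ((List.range k).map fun j =>
    columnPerm (fun i => extRow r i (j + 1)) (fun i => extRow r i j) n).prod

lemma zelColumns_succ (n : ℕ) (r : ℕ → ℕ → ℕ) (k : ℕ) : zelColumns n r (k + 1) =
    zelColumns n r k * columnPerm (fun i => extRow r i (k + 1)) (fun i => extRow r i k) n := by
  rw [zelColumns, List.range_succ, List.map_append, List.prod_append]
  simp [zelColumns]

lemma conjZel_eq (n : ℕ) (r : ℕ → ℕ → ℕ) : conjZel n r = zelColumns n r n := rfl

variable {r : ℕ → ℕ → ℕ}

/-- The later columns fix the later positions. -/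
lemma zelColumns_apply_of_le (hr : IsRankConditions n r) {k k' p : ℕ} (hk : k ≤ k') (hk' : k' ≤ n)
    (hp : ext r n k ≤ p) : zelColumns n r k' p = zelColumns n r k p := by
  induction hk with
  | refl => rfl
  | step hk ih =>
    rename_i m
    have hk : k ≤ m := hk
    rw [zelColumns_succ, Perm.mul_apply, (isColumnPair hr (by omega)).fix, ih (by omega)]
    refine le_trans ?_ hp
    show ext r n m ≤ ext r n k
    rw [ext_of_le r (by omega), ext_of_le r (by omega)]
    exact Finset.sum_le_sum_of_subset (Finset.Icc_subset_Icc_left (by simpa using hk))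

lemma zelColumns_lt (hr : IsRankConditions n r) {k : ℕ} (hk : k ≤ n) {p q : ℕ} (hpq : p < q)
    (hq : q < ext r n k) : zelColumns n r k p < zelColumns n r k q := by
  induction k generalizing p q with
  | zero => exact hpq
  | succ k ih =>
    have h := isColumnPair hr (j := k) (by omega)
    rw [zelColumns_succ, Perm.mul_apply, Perm.mul_apply]
    exact ih (by omega) (h.lt_of_lt hpq hq) (h.apply_lt le_rfl hq)

lemma zelColumns_apply_lt (hr : IsRankConditions n r) {k : ℕ} (hk : k ≤ n) {i p : ℕ} (hi : i ≤ n)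
    (hp : p < ext r i k) : zelColumns n r k p < ext r i 0 := by
  induction k generalizing p with
  | zero => exact hp
  | succ k ih =>
    have h := isColumnPair hr (j := k) (by omega)
    rw [zelColumns_succ, Perm.mul_apply]
    exact ih (by omega) (h.apply_lt (i := i + 1) (by omega) hp)

lemma conjZel_fix (hr : IsRankConditions n r) {p : ℕ} (hp : ext r n 0 ≤ p) : conjZel n r p = p := by
  rw [conjZel_eq, zelColumns_apply_of_le hr (Nat.zero_le n) le_rfl hp]
  rfl

/-- `z(r)` is increasing on blocks of positions. -/
lemma conjZel_lt (hr : IsRankConditions n r) {i : ℕ} (hi : i < n) {p q : ℕ}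
    (hp : ext r n (i + 1) ≤ p) (hpq : p < q) (hq : q < ext r n i) :
    conjZel n r p < conjZel n r q := by
  have h := isColumnPair hr hi
  rw [conjZel_eq, zelColumns_apply_of_le hr (show i + 1 ≤ n from hi) le_rfl hp,
    zelColumns_apply_of_le hr (show i + 1 ≤ n from hi) le_rfl (by omega), zelColumns_succ,
    Perm.mul_apply, Perm.mul_apply]
  refine zelColumns_lt hr hi.le (h.lt_of_le hp hpq) ?_
  exact perm_lt (N := ext r n i) (fun p hp => h.fix hp) hq

/-- The values of `z(r)` at the positions in the blocks of sizes `e_{i-1}, …, e_0` are among the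
first `e_0 + ⋯ + e_i` ones. -/
lemma conjZel_apply_lt (hr : IsRankConditions n r) {i p : ℕ} (hi : i ≤ n)
    (hp : ext r n i ≤ p) (hp' : p < ext r n 0) : conjZel n r p < ext r i 0 := by
  rw [conjZel_eq, zelColumns_apply_of_le hr hi le_rfl hp]
  induction i with
  | zero => exact absurd hp (by omega)
  | succ k ih =>
    have h := isColumnPair hr (j := k) (by omega)
    rcases Nat.lt_or_ge p (ext r n k) with hlt | hge
    · rw [zelColumns_succ, Perm.mul_apply]
      refine zelColumns_apply_lt hr (by omega) hi ?_
      set Z := columnPerm (fun i => extRow r i (k + 1)) (fun i => extRow r i k) n with hZ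
      have hv : Z p < ext r n k := perm_lt (N := ext r n k) (fun p hp => h.fix hp) hlt
      by_contra hc
      -- the values from `r_{k+1,k}` on are taken at the positions before `p`
      have hrow : ∀ i, k + 1 ≤ i → ext r i k = r k k + ext r i (k + 1) :=
        fun i hi => ext_eq_add r hi
      have h2 := hrow (k + 1) le_rfl
      have h3 := hrow n hi
      obtain ⟨i', h4, h5, h6⟩ := h.exists_slot (p := Z p - r k k) le_rfl
        (show Z p - r k k < ext r n (k + 1) by omega)
      have h7 : k + 2 ≤ i' := by
        by_contra hcon
        have h8 : ext r (k + 1) (k + 1) ≤ Z p - r k k := by omega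
        have h9 : extRow r (i' + 1) (k + 1) ≤ extRow r (k + 1 + 1) (k + 1) :=
          h.mono_left (by omega) (by omega)
        have h10 : extRow r (k + 1 + 1) (k + 1) = ext r (k + 1) (k + 1) := rfl
        omega
      obtain ⟨i'', rfl⟩ : ∃ i'', i' = i'' + 1 := ⟨i' - 1, by omega⟩
      have h8 := h.apply (by omega) h5 h6
      simp only [extRow] at h8
      rw [hrow i'' (by omega), Nat.add_sub_cancel, Nat.sub_add_cancel (by omega)] at h8
      have h9 := Z.injective h8
      simp only [extRow] at h6
      omega
    · rcases Nat.eq_zero_or_pos k with rfl | hk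
      · omega
      · rw [zelColumns_apply_of_le hr (Nat.le_succ k) hi hge]
        refine (ih (by omega) hge).trans_le ?_
        rw [ext_of_le r (Nat.zero_le _), ext_of_le r (Nat.zero_le _)]
        exact Finset.sum_le_sum_of_subset (Finset.Icc_subset_Icc_right (by omega))

/-- The inverse of `z(r)` is increasing on blocks of values. -/
lemma conjZel_inv_lt (hr : IsRankConditions n r) {i : ℕ} (hi : i ≤ n) {v w : ℕ}
    (hv : extRow r i 0 ≤ v) (hvw : v < w) (hw : w < extRow r (i + 1) 0) :
    (conjZel n r)⁻¹ v < (conjZel n r)⁻¹ w := by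
  have key : ∀ k ≤ n, (zelColumns n r k)⁻¹ v < (zelColumns n r k)⁻¹ w ∧
      ∀ u, v ≤ u → u ≤ w → (extRow r i k ≤ (zelColumns n r k)⁻¹ u ∧
        (zelColumns n r k)⁻¹ u < extRow r (i + 1) k ∨ ext r n k ≤ (zelColumns n r k)⁻¹ u) := by
    intro k hk
    induction k with
    | zero => exact ⟨hvw, fun u hu hu' => .inl ⟨hv.trans hu, lt_of_le_of_lt hu' hw⟩⟩
    | succ k ih =>
      obtain ⟨h1, h2⟩ := ih (by omega)
      have h := isColumnPair hr (j := k) (by omega)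
      have hfix : ∀ p, ext r n k ≤ p →
          (columnPerm (fun i => extRow r i (k + 1)) (fun i => extRow r i k) n)⁻¹ p = p :=
        inv_fix fun p hp => h.fix hp
      have hlt : ∀ p, p < ext r n k →
          (columnPerm (fun i => extRow r i (k + 1)) (fun i => extRow r i k) n)⁻¹ p < ext r n k :=
        fun p hp => perm_lt hfix hp
      have hcol : extRow r (i + 1) k ≤ ext r n k := h.mono_right (i' := n + 1) (by omega) le_rfl
      have hcd : ext r n (k + 1) ≤ ext r n k := h.le (n + 1) le_rfl
      simp only [zelColumns_succ, mul_inv_rev, Perm.mul_apply]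
      refine ⟨?_, fun u hu hu' => ?_⟩
      · rcases h2 v le_rfl hvw.le with hv' | hv'
        · rcases h2 w hvw.le le_rfl with hw' | hw'
          · exact h.inv_lt hi hv'.1 h1 hw'.2
          · rw [hfix _ hw']
            exact (hlt _ (by omega)).trans_le hw'
        · rw [hfix _ hv', hfix _ (by omega)]
          exact h1
      · rcases h2 u hu hu' with hu' | hu'
        · exact h.inv_mem hi hu'.1 hu'.2
        · rw [hfix _ hu']
          exact .inr (hcd.trans hu')
  exact (key n le_rfl).1

/-! ### The maximal rank conditions -/

lemma maxRank_self (r : ℕ → ℕ → ℕ) (i : ℕ) : maxRank r i i = r i i := by simp [maxRank]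

lemma maxRank_le (r : ℕ → ℕ → ℕ) {i j k : ℕ} (h1 : i ≤ k) (h2 : k ≤ j) : maxRank r i j ≤ r k k :=
  Nat.sInf_le ⟨k, ⟨h1, h2⟩, rfl⟩

lemma exists_maxRank_eq (r : ℕ → ℕ → ℕ) {i j : ℕ} (h : i ≤ j) :
    ∃ k, i ≤ k ∧ k ≤ j ∧ maxRank r i j = r k k := by
  obtain ⟨k, hk, e⟩ := Nat.sInf_mem (s := (fun k => r k k) '' Set.Icc i j) ⟨_, i, ⟨le_rfl, h⟩, rfl⟩
  exact ⟨k, hk.1, hk.2, e.symm⟩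

lemma blockSwap_eq_one {c A B : ℕ} (h : A = 0 ∨ B = 0) : blockSwap c A B = 1 := by
  ext p
  rw [blockSwap_apply, Perm.one_apply]
  split_ifs <;> omega

/-- Above the diagonal the block exchanges of the maximal rank conditions are trivial: a minimum
over `e_i, …, e_{j+1}` is attained among the first or among the last terms. -/
lemma W_maxRank (r : ℕ → ℕ → ℕ) {i j : ℕ} (h : i ≤ j) : W (maxRank r) i (j + 1) = 1 := by
  refine blockSwap_eq_one ?_
  rw [Nat.add_sub_cancel, ext, ext, ext, if_pos (by omega), if_pos (by omega), if_pos (by omega)]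
  obtain ⟨k, h1, h2, e⟩ := exists_maxRank_eq r (show i ≤ j + 1 by omega)
  rcases Nat.lt_or_ge j k with hk | hk
  · left
    have := maxRank_le r (i := i + 1) (j := j + 1) (k := k) (by omega) h2
    omega
  · right
    have := maxRank_le r h1 hk
    omega

lemma deltaProd_eq_prod (e : ℕ → ℕ) (j m : ℕ) : deltaProd e j m =
    ((List.range m).map fun i => (demDelta e (j + i) (m - 1 - i)).perm).prod := by
  induction m generalizing j with
  | zero => rfl
  | succ m ih =>
    rw [deltaProd, ih, List.range_succ_eq_map, List.map_cons, List.prod_cons, List.map_map]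
    congr 2
    refine List.map_congr_left fun i _ => ?_
    simp only [Function.comp_apply, Nat.succ_eq_add_one]
    rw [show j + 1 + i = j + (i + 1) by omega, show m + 1 - 1 - (i + 1) = m - 1 - i by omega]

lemma conjZel_maxRank (n : ℕ) (r : ℕ → ℕ → ℕ) :
    conjZel n (maxRank r) = deltaProd (fun i => r i i) 0 n := by
  rw [deltaProd_eq_prod, conjZel]
  congr 1
  refine List.map_congr_left fun j hj => ?_
  rw [List.mem_range] at hj
  have h1 : List.range n = List.range (j + 1) ++ List.range' (j + 1) (n - (j + 1)) := by
    have := List.range'_append_1 (s := 0) (m := j + 1) (n := n - (j + 1))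
    rw [zero_add, show j + 1 + (n - (j + 1)) = n by omega] at this
    rw [List.range_eq_range', List.range_eq_range', this]
  have h2 : ((List.range (j + 1)).map fun i => W (maxRank r) i (j + 1)).prod = 1 := by
    refine List.prod_eq_one fun x hx => ?_
    obtain ⟨i, hi, rfl⟩ := List.mem_map.1 hx
    exact W_maxRank r (by simpa [Nat.lt_succ_iff] using hi)
  rw [h1, List.map_append, List.prod_append, h2, one_mul, zero_add]
  have h3 := delta_eq n (maxRank r) j
  simp only [maxRank_self] at h3
  exact h3

lemma tailBound_deltaProd (e : ℕ → ℕ) (j m : ℕ) : TailBound e j m (deltaProd e j m) := by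
  induction m generalizing j with
  | zero => intro i h1 h2; omega
  | succ m ih =>
    intro i h1 h2 p hp hp'
    have hM : blockSum e (j + 1) (m + 1) = e (j + 1) + blockSum e (j + 2) m := rfl
    have hN : blockSum e j (m + 1 + 1) = e j + blockSum e (j + 1) (m + 1) := rfl
    have hN' : blockSum e j (m + 2) = e j + blockSum e (j + 1) (m + 1) := rfl
    have h3 : blockSum e j 2 = e j + (e (j + 1) + 0) := rfl
    have h4 := blockSum_mono e j (show 2 ≤ i + 1 by omega)
    rw [deltaProd, Perm.mul_apply]
    rcases Nat.lt_or_ge p (blockSum e (j + 1) (m + 1)) with hlt | hge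
    · obtain ⟨i, rfl⟩ : ∃ k, i = k + 1 := ⟨i - 1, by omega⟩
      have hi : 1 ≤ i := by
        by_contra hc
        obtain rfl : i = 0 := by omega
        simp only [zero_add, Nat.add_sub_cancel] at hp
        omega
      have h5 := ih (j + 1) i hi (by omega) p (by
        rwa [show j + (i + 1) = j + 1 + i by omega, show m + 1 + 1 - (i + 1) = m + 1 - i by omega]
          at hp) hlt
      have h6 : blockSum e j (i + 1 + 1) = e j + blockSum e (j + 1) (i + 1) := rfl
      rw [demDelta_apply]
      split_ifs <;> omega
    · rw [deltaProd_fix _ _ _ _ hge, demDelta_apply]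
      split_ifs <;> omega

end

section

/-! ### Signs of Zelevinsky permutations -/

lemma sgn_blockSwap (c A B : ℕ) : sgn (blockSwap c A B) = (-1) ^ (A * B) := by
  have h := wordPerm_rectWord c (List.replicate B (1 : ℤˣ)) (List.replicate A (1 : ℤˣ))
  rw [List.length_replicate, List.length_replicate] at h
  have h2 : wordPerm (rectWord c (List.replicate B (1 : ℤˣ)) (List.replicate A (1 : ℤˣ))) =
      (((rectWord c (List.replicate B (1 : ℤˣ)) (List.replicate A (1 : ℤˣ))).map Prod.fst).map
        simpleRefl).prod := by
    rw [List.map_map]; rfl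
  rw [← h, h2, sgn_prod, List.length_map, length_rectWord, List.length_replicate,
    List.length_replicate, mul_comm]

lemma prod_map_range {M : Type*} [CommMonoid M] (f : ℕ → M) (n : ℕ) :
    ((List.range n).map f).prod = ∏ i ∈ Finset.range n, f i := by
  induction n with
  | zero => rfl
  | succ n ih =>
    rw [List.range_succ, List.map_append, List.prod_append, ih, Finset.prod_range_succ]
    simp

lemma finSupp_W (r : ℕ → ℕ → ℕ) (i j : ℕ) : FinSupp (W r i j) := finSupp_blockSwap _ _ _

lemma sgn_conjZel (n : ℕ) (r : ℕ → ℕ → ℕ) : sgn (conjZel n r) =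
    ∏ j ∈ Finset.range n, ∏ i ∈ Finset.range n, sgn (W r i (j + 1)) := by
  have h1 : ∀ j, FinSupp ((List.range n).map fun i => W r i (j + 1)).prod ∧
      sgn ((List.range n).map fun i => W r i (j + 1)).prod =
        ∏ i ∈ Finset.range n, sgn (W r i (j + 1)) := by
    intro j
    have := sgn_list_prod (l := (List.range n).map fun i => W r i (j + 1)) (fun u hu => by
      obtain ⟨i, -, rfl⟩ := List.mem_map.1 hu
      exact finSupp_W _ _ _)
    refine ⟨this.1, ?_⟩
    rw [this.2, List.map_map, prod_map_range]
    rfl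
  rw [conjZel, (sgn_list_prod fun u hu => ?_).2, List.map_map, prod_map_range]
  · exact Finset.prod_congr rfl fun j _ => (h1 j).2
  · obtain ⟨j, -, rfl⟩ := List.mem_map.1 hu
    exact (h1 j).1

lemma W_maxRank_of_lt (r : ℕ → ℕ → ℕ) {i j : ℕ} (h : j + 1 ≤ i) :
    W (maxRank r) i (j + 1) = W r i (j + 1) := by
  rw [W, W, Nat.add_sub_cancel]
  simp only [ext_of_le _ h, ext_of_le _ (show j ≤ i by omega),
    ext_of_le _ (show j + 1 ≤ i + 1 by omega), maxRank_self]

/-- The factors `W_{ij}` with `i ≥ j` depend on the dimensions `e_i` only, and the others are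
trivial for the maximal rank conditions. -/
lemma sgn_conjZel_mul (n : ℕ) (r : ℕ → ℕ → ℕ) :
    sgn (conjZel n r) * sgn (conjZel n (maxRank r)) =
      (-1) ^ ∑ j ∈ Finset.range n, ∑ i ∈ Finset.range (j + 1),
        (r (i + 1) (j + 1) - r i (j + 1)) * (r i j - r i (j + 1)) := by
  rw [sgn_conjZel, sgn_conjZel, ← Finset.prod_mul_distrib, ← Finset.prod_pow_eq_pow_sum]
  refine Finset.prod_congr rfl fun j hj => ?_
  rw [← Finset.prod_mul_distrib, ← Finset.prod_pow_eq_pow_sum]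
  rw [Finset.mem_range] at hj
  have hsub : Finset.range (j + 1) ⊆ Finset.range n := Finset.range_subset_range.2 hj
  rw [← Finset.prod_subset hsub fun i _ hi => ?_]
  · refine Finset.prod_congr rfl fun i hi => ?_
    rw [Finset.mem_range] at hi
    rw [W_maxRank r (by omega), sgn_one, mul_one, W, sgn_blockSwap, Nat.add_sub_cancel, ext, ext,
      ext, if_pos (by omega), if_pos (by omega), if_pos (by omega)]
  · rw [Finset.mem_range] at hi
    rw [W_maxRank_of_lt r (by omega), sgn_mul_self]

lemma expCodim_eq {n : ℕ} {r : ℕ → ℕ → ℕ} (hr : IsRankConditions n r) : expCodim n r =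
    ((∑ j ∈ Finset.range n, ∑ i ∈ Finset.range (j + 1),
      (r (i + 1) (j + 1) - r i (j + 1)) * (r i j - r i (j + 1)) : ℕ) : ℤ) := by
  rw [expCodim, Finset.sum_range_succ', Finset.range_zero, Finset.sum_empty, add_zero]
  push_cast
  refine Finset.sum_congr rfl fun j hj => Finset.sum_congr rfl fun i hi => ?_
  rw [Finset.mem_range] at hi hj
  rw [Nat.cast_sub (hr.le_left i j (by omega) (by omega)),
    Nat.cast_sub (hr.le_right i j (by omega) (by omega)), mul_comm]

/-! ### Sizes of blocks -/

lemma blockSum_eq_sum (e : ℕ → ℕ) (j m : ℕ) :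
    blockSum e j m = ∑ k ∈ Finset.Ico j (j + m), e k := by
  induction m generalizing j with
  | zero => simp [blockSum]
  | succ m ih =>
    rw [blockSum, ih, Finset.sum_eq_sum_Ico_succ_bot (show j < j + (m + 1) by omega),
      show j + 1 + m = j + (m + 1) by omega]

lemma ext_eq_blockSum (r : ℕ → ℕ → ℕ) {n j : ℕ} (h : j ≤ n) :
    ext r n j = blockSum (fun i => r i i) j (n + 1 - j) := by
  rw [ext_of_le r h, blockSum_eq_sum, show j + (n + 1 - j) = n + 1 by omega]
  exact Finset.sum_congr (by ext; simp) fun _ _ => rfl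

lemma extRow_eq_blockSum (r : ℕ → ℕ → ℕ) (i : ℕ) :
    extRow r i 0 = blockSum (fun i => r i i) 0 i := by
  rcases i with _ | i
  · rfl
  · exact ext_eq_blockSum r (Nat.zero_le i)

lemma totalDim_eq (n : ℕ) (r : ℕ → ℕ → ℕ) : totalDim n r = blockSum (fun i => r i i) 0 (n + 1) := by
  rw [blockSum_eq_sum, zero_add, totalDim, Finset.range_eq_Ico]

/-! ### Grothendieck polynomials of Zelevinsky permutations -/

section

lemma descUnits_reverse (k : ℕ) (l : List Kˣ) : descUnits k l.reverse = descUnits k l := by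
  rw [descUnits, List.map_reverse]
  refine (List.reverse_perm _).prod_eq' ?_
  rw [List.pairwise_reverse, List.pairwise_map]
  exact List.pairwise_of_forall fun x y => descUnit_commute _ _ _

lemma descUnits_val (k : ℕ) (l : List Kˣ) : (descUnits k l : HeckeAlg K) =
    ((l.map Units.val).map fun x => descProd (k - 1) x⁻¹).prod := by
  induction l with
  | nil => rfl
  | cons x l ih =>
    have : descUnits k (x :: l) = descUnit (k - 1) x⁻¹ * descUnits k l := by simp [descUnits]
    rw [this, Units.val_mul, ih, descUnit_val]
    simp

lemma descUnits_inv_val (k : ℕ) (l : List Kˣ) : ((descUnits k l)⁻¹ : (HeckeAlg K)ˣ) =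
    ((l.map Units.val).reverse.map (ascProd (k - 1))).prod := by
  induction l with
  | nil => simp [descUnits]
  | cons x l ih =>
    have : descUnits k (x :: l) = descUnit (k - 1) x⁻¹ * descUnits k l := by simp [descUnits]
    rw [this, mul_inv_rev, Units.val_mul, ih, descUnit_inv_val]
    simp

lemma stablePair_val (b : ℕ → List K) (a : ℕ → List Kˣ)
    (h : ∀ i, (a i).map Units.val = (b i).reverse) (i : ℕ) : (stablePair a i : HeckeAlg K) =
      stableElt ((a i).length + (a (i + 1)).length) (b (i + 1)) (b i) := by
  have h' : ∀ i, (a i).reverse.map Units.val = b i := fun i => by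
    rw [List.map_reverse, h, List.reverse_reverse]
  rw [stablePair, Units.val_mul, ← descUnits_reverse _ (a (i + 1)), ← descUnits_reverse _ (a i),
    descUnits_val, descUnits_inv_val, h', h', stableElt]

lemma getD_sub_eq {A : List K} {l : List Kˣ} (h : A.reverse = l.map Units.val) {k : ℕ}
    (hk : k < l.length) : A.getD (l.length - 1 - k) 1 = ((l.getD k 1 : Kˣ) : K) := by
  have hlen : A.length = l.length := by simpa using congrArg List.length h
  have h1 : A.reverse.getD k 1 = ((l.getD k 1 : Kˣ) : K) := by
    rw [h, ← Units.val_one, List.getD_map]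
  rw [← h1, List.getD_eq_getElem _ _ (by omega), List.getD_eq_getElem _ _ (by simp; omega),
    List.getElem_reverse]
  simp only [hlen]

/-- The generating element of the Grothendieck polynomials in the variables `ă` and `a`. -/
lemma grothElt_eq_stairQuot {n : ℕ} {A B : List K} {a : ℕ → List Kˣ}
    (hA : A.reverse = (concatUp a 0 (n + 1)).map Units.val)
    (hB : B.reverse = (concatDown a 0 (n + 1)).map Units.val) :
    grothElt (blockSum (fun i => (a i).length) 0 (n + 1)) (fun k => (A.getD k 1)⁻¹)
      (fun k => B.getD k 1) = (stairQuot a 0 n : HeckeAlg K) := by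
  rw [grothElt, stairQuot, Units.val_mul, ← descStair_eq_stair (l := concatUp a 0 (n + 1))
    (f := fun k => (A.getD ((concatUp a 0 (n + 1)).length - 1 - k) 1)⁻¹),
    ← ascStair_eq_stair (l := concatDown a 0 (n + 1))
    (f := fun k => B.getD ((concatDown a 0 (n + 1)).length - 1 - k) 1), length_concatUp,
    length_concatDown]
  · exact fun k hk => getD_sub_eq hB hk
  · intro k hk
    rw [getD_sub_eq hA hk, Units.val_inv_eq_inv_val]

end

/-- The variable `a^i_j`, as a unit. -/
def varUnit (i j : ℕ) : RatFieldˣ :=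
  Units.mk0 (algebraMap (MvPolynomial (ℕ × ℕ) ℤ) RatField (MvPolynomial.X (i, j)))
    ((map_ne_zero_iff _ (IsFractionRing.injective (MvPolynomial (ℕ × ℕ) ℤ) RatField)).2
      (MvPolynomial.X_ne_zero _))

/-- The variables `a^i_j` with fixed `i`, as units. Their order is reversed, as the rows of
`grothElt` have the variables in reverse order. -/
def unitBlock (r : ℕ → ℕ → ℕ) (i : ℕ) : List RatFieldˣ :=
  ((List.range (r i i)).map (varUnit i)).reverse

lemma length_unitBlock (r : ℕ → ℕ → ℕ) : (fun i => (unitBlock r i).length) = fun i => r i i := by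
  funext i; simp [unitBlock]

lemma map_unitBlock (r : ℕ → ℕ → ℕ) (i : ℕ) :
    (unitBlock r i).map Units.val = (block r i).reverse := by
  rw [unitBlock, List.map_reverse, List.map_map, block]
  rfl

lemma unitBlock_disjoint (r : ℕ → ℕ → ℕ) {i i' : ℕ} (h : i < i') :
    ∀ x ∈ unitBlock r i, x ∉ unitBlock r i' := by
  intro x hx hx'
  simp only [unitBlock, List.mem_reverse, List.mem_map] at hx hx'
  obtain ⟨j, -, rfl⟩ := hx
  obtain ⟨j', -, e⟩ := hx'
  have h1 := congrArg Units.val e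
  have h2 := IsFractionRing.injective (MvPolynomial (ℕ × ℕ) ℤ) RatField h1
  have h3 := MvPolynomial.X_injective h2
  simp only [Prod.mk.injEq] at h3
  omega

lemma map_concatUp (r : ℕ → ℕ → ℕ) (j m : ℕ) :
    ((List.range' j m).reverse.flatMap (block r)).reverse =
      (concatUp (unitBlock r) j m).map Units.val := by
  induction m generalizing j with
  | zero => rfl
  | succ m ih =>
    rw [List.range'_succ, List.reverse_cons, List.flatMap_append, List.reverse_append, ih, concatUp,
      List.map_append, map_unitBlock]
    simp

lemma map_concatDown (r : ℕ → ℕ → ℕ) (j m : ℕ) :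
    ((List.range' j m).flatMap (block r)).reverse =
      (concatDown (unitBlock r) j m).map Units.val := by
  induction m generalizing j with
  | zero => rfl
  | succ m ih =>
    rw [List.range'_succ, List.flatMap_cons, List.reverse_append, ih, concatDown, List.map_append,
      map_unitBlock]

lemma grothEval_hat {n : ℕ} (r : ℕ → ℕ → ℕ) {z : Perm ℕ} (hz : ∀ p, totalDim n r ≤ p → z p = p) :
    grothEval (totalDim n r) (hat (totalDim n r) z) (allVarsRev n r) (allVars n r) =
      sgn z * cf z (stairQuot (unitBlock r) 0 n : HeckeAlg RatField) := by
  have h := grothElt_eq_stairQuot (n := n) (A := allVarsRev n r) (B := allVars n r)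
    (a := unitBlock r)
    (by rw [allVarsRev, List.range_eq_range', map_concatUp])
    (by rw [allVars, List.range_eq_range', map_concatDown])
  rw [length_unitBlock, ← totalDim_eq] at h
  rw [grothEval_eq (hat_fix hz), hat_hat, sgn_hat _ (finSupp_of_fix hz), h]

lemma tailBound_conjZel {n : ℕ} {r : ℕ → ℕ → ℕ} (hr : IsRankConditions n r) :
    TailBound (fun i => r i i) 0 n (conjZel n r) := by
  intro i h1 h2 p hp hp'
  rw [zero_add, ← ext_eq_blockSum r h2] at hp
  have h3 := ext_eq_blockSum r (Nat.zero_le n)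
  have h4 := ext_eq_blockSum r (Nat.zero_le i)
  rw [Nat.sub_zero] at h3 h4
  rw [← h3] at hp'
  rw [← h4]
  exact conjZel_apply_lt hr h2 hp hp'

end

end

end Quiver

open Classical in
theorem theoremT (n : ℕ) (r : ℕ → ℕ → ℕ) (hr : Quiver.IsRankConditions n r) :
    Quiver.grothEval (Quiver.totalDim n r) (Quiver.zel n (Quiver.maxRank r))
        (Quiver.allVarsRev n r) (Quiver.allVars n r) ≠ 0 ∧
    Quiver.grothEval (Quiver.totalDim n r) (Quiver.zel n r)
        (Quiver.allVarsRev n r) (Quiver.allVars n r) /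
      Quiver.grothEval (Quiver.totalDim n r) (Quiver.zel n (Quiver.maxRank r))
        (Quiver.allVarsRev n r) (Quiver.allVars n r) =
    ∑ w : Quiver.PermSeq n r with Quiver.IsKMS n r w,
      (-1 : Quiver.RatField) ^
          ((Quiver.length (List.ofFn fun i => Quiver.embed (w i)).prod : ℤ) -
            Quiver.expCodim n r) *
        ∏ i : Fin n, Quiver.stableGroth (w i) (Quiver.block r (i + 1)) (Quiver.block r i) := by
  open Quiver in
  have hN : ext r n 0 = totalDim n r := by rw [ext_eq_blockSum r (Nat.zero_le n), totalDim_eq]; rfl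
  have hfix : ∀ p, totalDim n r ≤ p → conjZel n r p = p :=
    fun p hp => conjZel_fix hr (hN ▸ hp)
  have hfix' : ∀ p, totalDim n r ≤ p → conjZel n (maxRank r) p = p := by
    intro p hp
    rw [conjZel_maxRank]
    exact deltaProd_fix _ _ _ _ (totalDim_eq n r ▸ hp)
  have hz : zel n r = hat (totalDim n r) (conjZel n r) := rfl
  have hz' : zel n (maxRank r) = hat (totalDim n r) (conjZel n (maxRank r)) := by
    have : totalDim n (maxRank r) = totalDim n r :=
      Finset.sum_congr rfl fun k _ => maxRank_self r k
    rw [zel, this]; rfl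
  obtain ⟨C, hC, hCf⟩ :=
    exists_cf_stairQuot (unitBlock r) (fun i i' h => unitBlock_disjoint r h) 0 n
  have hpair := cf_altProd_stablePair (unitBlock r) n (z := conjZel n r)
  have hdelta := cf_deltaProd (unitBlock r) 0 n
  have hstable : ∀ i, (stablePair (unitBlock r) i : HeckeAlg RatField) =
      stableElt (r i i + r (i + 1) (i + 1)) (block r (i + 1)) (block r i) := by
    intro i
    rw [stablePair_val (block r) (unitBlock r) (map_unitBlock r)]
    have := congrFun (length_unitBlock r)
    rw [this, this]
  have hmem : ∀ j, (stablePair (unitBlock r) j : HeckeAlg RatField) ∈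
      algSub RatField {g | g + 1 < r j j + r (j + 1) (j + 1)} := by
    intro j
    have h := val_mem_algSub (stablePair_mem (unitBlock r) j)
    have := congrFun (length_unitBlock r)
    rwa [this, this] at h
  rw [length_unitBlock] at hCf hpair hdelta
  -- both coefficients of the product in `ă` and `a` are divisible by the same constant `C`
  have h1 := hCf _ (tailBound_conjZel hr)
  have h2 := hCf _ (conjZel_maxRank n r ▸ tailBound_deltaProd (fun i => r i i) 0 n)
  rw [conjZel_maxRank, hdelta, mul_one, ← conjZel_maxRank] at h2
  rw [← hpair, cf_conjZel_eq_sum n r _ hmem] at h1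
  rotate_left
  · intro i hi g hg hg'
    rw [← extRow_eq_blockSum] at hg hg'
    exact conjZel_inv_lt hr hi hg (Nat.lt_succ_self g) hg'
  · intro i hi g hg hg'
    rw [← ext_eq_blockSum r hi] at hg'
    rcases hi.lt_or_eq with hi | rfl
    · rw [show n - i = n + 1 - (i + 1) by omega, ← ext_eq_blockSum r hi] at hg
      exact conjZel_lt hr hi hg (Nat.lt_succ_self g) hg'
    · exact zelColumns_lt hr le_rfl (Nat.lt_succ_self g) hg'
  rw [hz, hz', grothEval_hat r hfix, grothEval_hat r hfix', h1, h2]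
  have hsgn : ∀ w : Equiv.Perm ℕ, ((sgn w : ℤ) : RatField) * ((sgn w : ℤ) : RatField) = 1 := by
    intro w
    rw [← Int.cast_mul, sgn_mul_self, Int.cast_one]
  have hsgn0 : ∀ w : Equiv.Perm ℕ, ((sgn w : ℤ) : RatField) ≠ 0 :=
    fun w => left_ne_zero_of_mul_eq_one (hsgn w)
  refine ⟨mul_ne_zero (hsgn0 _) hC, ?_⟩
  have hd := sgn_conjZel_mul n r
  have hd' := expCodim_eq hr
  set D := ∑ j ∈ Finset.range n, ∑ i ∈ Finset.range (j + 1),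
    (r (i + 1) (j + 1) - r i (j + 1)) * (r i j - r i (j + 1))
  have hterm : ∀ w : PermSeq n r,
      (-1 : RatField) ^ ((length (List.ofFn fun i => embed (w i)).prod : ℤ) - expCodim n r) *
        ∏ i : Fin n, stableGroth (w i) (block r (i + 1)) (block r i) =
      (-1) ^ D *
        ∏ i : Fin n, cf (embed (w i)) (stablePair (unitBlock r) i : HeckeAlg RatField) := by
    intro w
    have hl : (-1 : RatField) ^ length (List.ofFn fun i => embed (w i)).prod =
        ∏ i : Fin n, ((sgn (embed (w i)) : ℤ) : RatField) := by
      have h := (sgn_list_prod (l := List.ofFn fun i => embed (w i)) (fun u hu => by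
        obtain ⟨i, rfl⟩ := (List.mem_ofFn' _ _).1 hu
        exact ⟨_, fun p hp => embed_of_ge (w i) hp⟩)).2
      rw [List.map_ofFn, List.prod_ofFn] at h
      have h' := congrArg (fun x : ℤ => (x : RatField)) h
      simp only [sgn, Int.cast_pow, Int.cast_neg, Int.cast_one, Int.cast_prod,
        Function.comp_apply] at h' ⊢
      exact h'
    have hD : ((-1 : RatField) ^ D)⁻¹ = (-1) ^ D := by
      rw [← inv_pow, inv_neg_one]
    rw [hd', zpow_sub₀ (by norm_num), zpow_natCast, zpow_natCast, div_eq_mul_inv, hD, hl,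
      mul_comm (∏ i : Fin n, _) (_ ^ D), mul_assoc, ← Finset.prod_mul_distrib]
    congr 1
    refine Finset.prod_congr rfl fun i _ => ?_
    rw [stableGroth_eq, ← mul_assoc, hsgn, one_mul, hstable]
  rw [Finset.sum_congr rfl fun w _ => hterm w, ← Finset.mul_sum, div_eq_iff
    (mul_ne_zero (hsgn0 _) hC)]
  have hd2 := congrArg (fun x : ℤ => (x : RatField)) hd
  simp only [Int.cast_mul, Int.cast_pow, Int.cast_neg, Int.cast_one] at hd2
  rw [← hd2]
  set S := ∑ w : PermSeq n r with IsKMS n r w,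
    ∏ i : Fin n, cf (embed (w i)) (stablePair (unitBlock r) i : HeckeAlg RatField)
  linear_combination (-((sgn (conjZel n r) : ℤ) : RatField) * C * S) * hsgn (conjZel n (maxRank r))
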